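/- Let $k$ be a field, let $F,G$ be finite-dimensional division $k$-algebras, and let $M={}_FM_G$ be an $F$-$G$-bimodule on which $k$ acts centrally. Suppose that $M$ is tame, i.e. $\dim {}_FM\cdot\dim M_G=4$, and put $\varepsilon=\sqrt{\dim {}_FM/\dim M_G}\in\{\tfrac12,1,2\}$. A representation of $M$ consists of finite-dimensional right vector spaces $U_F$, $V_G$ and a $G$-linear map $\rho:U\otimes_FM\to V$. It is regular if all its indecomposable direct summands $(U',V',\rho')$ satisfy $\dim U'_F=\varepsilon\dim V'_G$, and regular-simple if it is a simple object of the category of regular representations. Let $p_1,\dots,p_t\ge 2$ be integers ($t\ge 0$) and let $\rho_i:U_i\otimes_FM\to V_i$ $(1\le i\le t)$ be pairwise non-isomorphic regular-simple representations. Put $D_i=\operatorname{End}(\rho_i)$ (acting on $U_i$ and $V_i$ from the left), $U_i^*=\operatorname{Hom}_F(U_i,F)$ and $V_i^+=\ker(\rho_i)\subseteq U_i\otimes_FM$. The canonical algebra is the $k$-algebra of block upper triangular matrices $$C=\begin{pmatrix}F&U^*&M\\0&T&V^+\\0&0&G\end{pmatrix},\qquad T=\prod_{i=1}^tT_{p_i-1}(D_i),\quad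 U^*=\bigoplus_{i=1}^t(U_i^*)^{1\times(p_i-1)},\quad V^+=\bigoplus_{i=1}^t(V_i^+)^{(p_i-1)\times1},$$ where $T_n(D)$ is the algebra of upper triangular $n\times n$-matrices over $D$ and the multiplication uses the bimodule structures and the maps $U_i^*\otimes_{D_i}V_i^+\to M$, $\varphi\otimes\sum_l x_l\otimes m_l\mapsto\sum_l\varphi(x_l)m_l$. A bilinear lattice is a free abelian group of finite rank with a non-degenerate bilinear form for which there is an automorphism $\tau$ with $\langle y,x\rangle=-\langle x,\tau y\rangle$ for all $x,y$. For integers $p_i\ge2$, $e_i,f_i\ge1$ $(1\le i\le t)$ and $\epsilon\in\{1,2\}$ put $d_i=e_if_i$ and $\kappa=\operatorname{lcm}_i\frac{e_i}{\gcd(e_i,\epsilon f_i)}$ ($\kappa=1$ if $t=0$). The canonical bilinear lattice with symbol $$\left(\begin{array}{c|c}p_1\cdots p_t&\\ d_1\cdots d_t&\epsilon\\ f_1\cdots f_t&\end{array}\right)$$ is the free abelian group on $a,\,w,\,s_i^{(j)}$ $(1\le i\le t,\ 0\le j\le p_i-2)$ with the bilinear form whose only non-zero values on basis elements are $$\langle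 a,a\rangle=\kappa,\quad \langle a,w\rangle=-\langle w,a\rangle=\kappa\epsilon,\quad \langle a,s_i^{(0)}\rangle=\kappa\epsilon f_i,\quad \langle s_i^{(j)},s_i^{(j)}\rangle=\frac{\kappa\epsilon f_i}{e_i},\quad \langle s_i^{(j-1)},s_i^{(j)}\rangle=-\frac{\kappa\epsilon f_i}{e_i}\ (j\ge1).$$ **Lemma.** The Grothendieck groups $K_0(C\text{-mod})$ and $K_0(\text{mod-}C)$ of finitely generated left and right $C$-modules, each equipped with the (well-defined) Euler form $\langle[X],[Y]\rangle=\sum_{m\ge0}(-1)^m\dim_k\operatorname{Ext}^m_C(X,Y)$, are isomorphic bilinear lattices. Both are, up to a constant factor (a positive integer by which the canonical form has to be multiplied), isomorphic to the canonical bilinear lattice, which is itself a bilinear lattice, of the same symbol, namely: 1. if $\varepsilon\in\{1,2\}$, the one with weights $p_i$, $\epsilon=\varepsilon$, $e_i=\dim{}_{D_i}U_i=\frac1\varepsilon\dim{}_{D_i}V_i$, $f_i=\dim(V_i)_G=\frac1\varepsilon\dim(U_i)_F$ and $d_i=e_if_i$; 2. if $\varepsilon=\frac12$, the one with weights $p_i$,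 $\epsilon=2$, $e_i=\varepsilon\dim{}_{D_i}U_i=\dim{}_{D_i}V_i$, $f_i=\varepsilon\dim(V_i)_G=\dim(U_i)_F$ and $d_i=e_if_i$. -/

import Mathlib

open scoped TensorProduct MulOpposite
open MulOpposite

universe u

noncomputable section

/-! ### Representations of a bimodule

`F` and `G` are division algebras over the field `k` and `M` is an `F`-`G`-bimodule with central
`k`-action. Right modules over a ring `R` are modules over `Rᵐᵒᵖ`. -/

/-- The bimodule `M` over `F` and `G` is tame. -/
def IsTameBimodule (F G M : Type u) [DivisionRing F] [DivisionRing G] [AddCommGroup M]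
    [Module F M] [Module Gᵐᵒᵖ M] : Prop :=
  Module.finrank F M * Module.finrank Gᵐᵒᵖ M = 4

/-- The number `ε = √(dim _F M / dim M_G)`. -/
def bimoduleEpsilon (F G M : Type u) [DivisionRing F] [DivisionRing G] [AddCommGroup M]
    [Module F M] [Module Gᵐᵒᵖ M] : ℝ :=
  Real.sqrt ((Module.finrank F M : ℝ) / (Module.finrank Gᵐᵒᵖ M : ℝ))

/-- A finite-dimensional representation `(U, V, ρ)` of the bimodule `M`. The `G`-linear map
`U ⊗_F M → V` is recorded as the corresponding `F`-balanced map `U × M → V`. -/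
structure BimodRep (k F G M : Type u) [Field k] [DivisionRing F] [DivisionRing G]
    [Algebra k F] [Algebra k G] [AddCommGroup M] [Module k M] [Module F M] [Module Gᵐᵒᵖ M] where
  U : Type u
  V : Type u
  [addCommGroupU : AddCommGroup U]
  [addCommGroupV : AddCommGroup V]
  [moduleU : Module k U]
  [moduleV : Module k V]
  [rightModuleU : Module Fᵐᵒᵖ U]
  [rightModuleV : Module Gᵐᵒᵖ V]
  [towerU : IsScalarTower k Fᵐᵒᵖ U]
  [towerV : IsScalarTower k Gᵐᵒᵖ V]
  [finiteU : Module.Finite Fᵐᵒᵖ U]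
  [finiteV : Module.Finite Gᵐᵒᵖ V]
  ρ : U →ₗ[k] M →ₗ[k] V
  balanced : ∀ (x : U) (f : F) (m : M), ρ (op f • x) m = ρ x (f • m)
  map_right : ∀ (x : U) (m : M) (g : G), ρ x (op g • m) = op g • ρ x m

attribute [instance] BimodRep.addCommGroupU BimodRep.addCommGroupV BimodRep.moduleU
  BimodRep.moduleV BimodRep.rightModuleU BimodRep.rightModuleV BimodRep.towerU BimodRep.towerV
  BimodRep.finiteU BimodRep.finiteV

namespace BimodRep

variable {k F G M : Type u} [Field k] [DivisionRing F] [DivisionRing G]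
  [Algebra k F] [Algebra k G] [AddCommGroup M] [Module k M] [Module F M] [Module Gᵐᵒᵖ M]

/-- A homomorphism of representations. -/
structure Hom (X Y : BimodRep k F G M) where
  u : X.U →ₗ[Fᵐᵒᵖ] Y.U
  v : X.V →ₗ[Gᵐᵒᵖ] Y.V
  comm : ∀ (x : X.U) (m : M), v (X.ρ x m) = Y.ρ (u x) m

/-- Both components of a homomorphism are injective. -/
def Hom.Injective {X Y : BimodRep k F G M} (f : Hom X Y) : Prop :=
  Function.Injective f.u ∧ Function.Injective f.v

/-- A homomorphism is an isomorphism if and only if both components are bijective. -/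
def Hom.IsIso {X Y : BimodRep k F G M} (f : Hom X Y) : Prop :=
  Function.Bijective f.u ∧ Function.Bijective f.v

/-- The representation is the zero representation. -/
def IsZero (X : BimodRep k F G M) : Prop :=
  Subsingleton X.U ∧ Subsingleton X.V

/-- The endomorphism algebra of a representation (multiplication is composition). -/
def D (X : BimodRep k F G M) :
    Subalgebra k (Module.End Fᵐᵒᵖ X.U × Module.End Gᵐᵒᵖ X.V) where
  carrier := {d | ∀ (x : X.U) (m : M), d.2 (X.ρ x m) = X.ρ (d.1 x) m}
  mul_mem' := by
    intro a b ha hb x m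
    change ∀ (x : X.U) (m : M), _ = _ at ha hb
    simp [ha, hb]
  add_mem' := by
    intro a b ha hb x m
    change ∀ (x : X.U) (m : M), _ = _ at ha hb
    simp [ha, hb]
  algebraMap_mem' := by
    intro r x m
    simp [Prod.algebraMap_apply, Module.algebraMap_end_apply]

/-- A representation is indecomposable if it is non-zero and has no idempotent endomorphisms
besides `0` and `1`. -/
def IsIndecomposable (X : BimodRep k F G M) : Prop :=
  ¬ X.IsZero ∧ ∀ e : X.D, e * e = e → e = 0 ∨ e = 1

/-- `Y` is (isomorphic to) a direct summand of `X`. -/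
def IsSummand (Y X : BimodRep k F G M) : Prop :=
  ∃ (i : Hom Y X) (r : Hom X Y), (∀ x, r.u (i.u x) = x) ∧ ∀ x, r.v (i.v x) = x

/-- A representation is regular if each of its indecomposable direct summands `(U, V, ρ)`
satisfies `dim U_F = ε dim V_G`. -/
def IsRegular (X : BimodRep k F G M) : Prop :=
  ∀ Y : BimodRep k F G M, Y.IsIndecomposable → IsSummand Y X →
    (Module.finrank Fᵐᵒᵖ Y.U : ℝ) = bimoduleEpsilon F G M * Module.finrank Gᵐᵒᵖ Y.V

/-- A regular-simple representation: a simple object of the category of regular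
representations. -/
def IsRegularSimple (X : BimodRep k F G M) : Prop :=
  X.IsRegular ∧ ¬ X.IsZero ∧
    ∀ (Y : BimodRep k F G M) (f : Hom Y X), Y.IsRegular → f.Injective → Y.IsZero ∨ f.IsIso

variable (X : BimodRep k F G M)

/-- The left action of `D = End(ρ)` on `U`. -/
instance : Module X.D X.U :=
  Module.compHom X.U ((RingHom.fst (Module.End Fᵐᵒᵖ X.U) (Module.End Gᵐᵒᵖ X.V)).comp
    X.D.val.toRingHom)

/-- The left action of `D = End(ρ)` on `V`. -/
instance : Module X.D X.V :=
  Module.compHom X.V ((RingHom.snd (Module.End Fᵐᵒᵖ X.U) (Module.End Gᵐᵒᵖ X.V)).comp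
    X.D.val.toRingHom)

/-- The relations `xf ⊗ m = x ⊗ fm` that cut `U ⊗_F M` out of `U ⊗_k M`. -/
def tensorRel : Submodule k (X.U ⊗[k] M) :=
  Submodule.span k {z | ∃ (x : X.U) (f : F) (m : M), z = (op f • x) ⊗ₜ[k] m - x ⊗ₜ[k] (f • m)}

/-- The tensor product `U ⊗_F M`. -/
abbrev Tensor : Type u := (X.U ⊗[k] M) ⧸ X.tensorRel

/-- The class of `x ⊗ m` in `U ⊗_F M`. -/
def tmul (x : X.U) (m : M) : X.Tensor := X.tensorRel.mkQ (x ⊗ₜ[k] m)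

variable {X} in
theorem tensor_hom_ext {N : Type*} [AddCommGroup N] {f g : X.Tensor →+ N}
    (h : ∀ x m, f (X.tmul x m) = g (X.tmul x m)) : f = g := by
  ext z
  obtain ⟨z, rfl⟩ := X.tensorRel.mkQ_surjective z
  induction z with
  | zero => simp
  | tmul x m => exact h x m
  | add a b ha hb => simp only [map_add, ha, hb]

/-- The action of an endomorphism on `U ⊗_F M`, namely `x ⊗ m ↦ dx ⊗ m`. -/
def tensorLeft (d : X.D) : X.Tensor →ₗ[k] X.Tensor :=
  X.tensorRel.mapQ X.tensorRel (LinearMap.rTensor M (d.1.1.restrictScalars k)) (by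
    rw [tensorRel, Submodule.span_le]
    rintro _ ⟨x, f, m, rfl⟩
    refine Submodule.subset_span ⟨d.1.1 x, f, m, ?_⟩
    simp)

@[simp] theorem tensorLeft_tmul (d : X.D) (x : X.U) (m : M) :
    X.tensorLeft d (X.tmul x m) = X.tmul (d.1.1 x) m := rfl

/-- The left action of `D = End(ρ)` on `U ⊗_F M`. -/
instance : Module X.D X.Tensor where
  smul d z := X.tensorLeft d z
  one_smul z := by
    refine DFunLike.congr_fun (tensor_hom_ext (f := (X.tensorLeft 1).toAddMonoidHom)
      (g := AddMonoidHom.id _) fun x m => ?_) z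
    rfl
  mul_smul d d' z := by
    refine DFunLike.congr_fun (tensor_hom_ext (f := (X.tensorLeft (d * d')).toAddMonoidHom)
      (g := (X.tensorLeft d ∘ₗ X.tensorLeft d').toAddMonoidHom) fun x m => ?_) z
    rfl
  smul_zero d := map_zero (X.tensorLeft d)
  smul_add d := map_add (X.tensorLeft d)
  add_smul d d' z := by
    refine DFunLike.congr_fun (tensor_hom_ext (f := (X.tensorLeft (d + d')).toAddMonoidHom)
      (g := (X.tensorLeft d + X.tensorLeft d').toAddMonoidHom) fun x m => ?_) z
    change X.tmul (d.1.1 x + d'.1.1 x) m = X.tmul (d.1.1 x) m + X.tmul (d'.1.1 x) m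
    simp only [tmul, TensorProduct.add_tmul, map_add]
  zero_smul z := by
    refine DFunLike.congr_fun (tensor_hom_ext (f := (X.tensorLeft 0).toAddMonoidHom)
      (g := 0) fun x m => ?_) z
    change X.tmul 0 m = 0
    simp [tmul]

@[simp] theorem smul_tmul (d : X.D) (x : X.U) (m : M) :
    d • X.tmul x m = X.tmul (d.1.1 x) m := rfl

/-- The map `U ⊗_F M → V` of the representation. -/
def rhoTensor : X.Tensor →ₗ[k] X.V :=
  X.tensorRel.liftQ (TensorProduct.lift X.ρ) (by
    rw [tensorRel, Submodule.span_le]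
    rintro _ ⟨x, f, m, rfl⟩
    simp [X.balanced])

@[simp] theorem rhoTensor_tmul (x : X.U) (m : M) : X.rhoTensor (X.tmul x m) = X.ρ x m := rfl

theorem rhoTensor_smul (d : X.D) (z : X.Tensor) :
    X.rhoTensor (d • z) = d.1.2 (X.rhoTensor z) := by
  refine DFunLike.congr_fun (tensor_hom_ext
    (f := (X.rhoTensor ∘ₗ X.tensorLeft d).toAddMonoidHom)
    (g := d.1.2.toAddMonoidHom.comp X.rhoTensor.toAddMonoidHom) fun x m => ?_) z
  exact (d.2 x m).symm

/-- The kernel `V⁺` of `U ⊗_F M → V`. -/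
def VPlus : Submodule k X.Tensor := LinearMap.ker X.rhoTensor

instance : Module X.D X.VPlus where
  smul d z := ⟨d • z.1, LinearMap.mem_ker.2 (by
    rw [rhoTensor_smul, LinearMap.mem_ker.1 z.2, map_zero])⟩
  one_smul z := Subtype.ext (one_smul _ _)
  mul_smul d d' z := Subtype.ext (mul_smul _ _ _)
  smul_zero d := Subtype.ext (smul_zero _)
  smul_add d z z' := Subtype.ext (smul_add _ _ _)
  add_smul d d' z := Subtype.ext (add_smul _ _ _)
  zero_smul z := Subtype.ext (zero_smul _ _)

instance : IsScalarTower k X.D X.Tensor where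
  smul_assoc c d z := by
    refine DFunLike.congr_fun (tensor_hom_ext (f := (X.tensorLeft (c • d)).toAddMonoidHom)
      (g := (c • X.tensorLeft d).toAddMonoidHom) fun x m => ?_) z
    change X.tmul (c • d.1.1 x) m = c • X.tmul (d.1.1 x) m
    simp only [tmul, ← TensorProduct.smul_tmul', map_smul]

instance : IsScalarTower k X.D X.VPlus where
  smul_assoc c d z := Subtype.ext (smul_assoc c d z.1)

instance : SMulCommClass k X.D X.VPlus where
  smul_comm c d z := Subtype.ext (map_smul (X.tensorLeft d) c z.1).symm

theorem coe_smul_VPlus (d : X.D) (z : X.VPlus) : ((d • z : X.VPlus) : X.Tensor) = d • z.1 := rfl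

/-- The dual `U^* = Hom_F(U_F, F_F)`. Its left `F`-action is Mathlib's action on linear maps, and
its right `D`-action is composition. -/
abbrev UStar : Type u := X.U →ₗ[Fᵐᵒᵖ] F

section RightAction

variable [IsScalarTower k Gᵐᵒᵖ M] [SMulCommClass F Gᵐᵒᵖ M]

/-- The right action of `G` on `U ⊗_F M`, namely `x ⊗ m ↦ x ⊗ mg`. -/
def tensorRight (g : Gᵐᵒᵖ) : X.Tensor →ₗ[k] X.Tensor :=
  X.tensorRel.mapQ X.tensorRel
    (LinearMap.lTensor X.U ((Module.toModuleEnd k (S := Gᵐᵒᵖ) M g))) (by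
    rw [tensorRel, Submodule.span_le]
    rintro _ ⟨x, f, m, rfl⟩
    refine Submodule.subset_span ⟨x, f, g • m, ?_⟩
    simp [smul_comm f g m])

@[simp] theorem tensorRight_tmul (g : Gᵐᵒᵖ) (x : X.U) (m : M) :
    X.tensorRight g (X.tmul x m) = X.tmul x (g • m) := rfl

instance : Module Gᵐᵒᵖ X.Tensor where
  smul g z := X.tensorRight g z
  one_smul z := by
    refine DFunLike.congr_fun (tensor_hom_ext (f := (X.tensorRight 1).toAddMonoidHom)
      (g := AddMonoidHom.id _) fun x m => ?_) z
    change X.tmul x ((1 : Gᵐᵒᵖ) • m) = X.tmul x m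
    rw [one_smul]
  mul_smul d d' z := by
    refine DFunLike.congr_fun (tensor_hom_ext (f := (X.tensorRight (d * d')).toAddMonoidHom)
      (g := (X.tensorRight d ∘ₗ X.tensorRight d').toAddMonoidHom) fun x m => ?_) z
    change X.tmul x ((d * d') • m) = X.tmul x (d • d' • m)
    rw [mul_smul]
  smul_zero d := map_zero (X.tensorRight d)
  smul_add d := map_add (X.tensorRight d)
  add_smul d d' z := by
    refine DFunLike.congr_fun (tensor_hom_ext (f := (X.tensorRight (d + d')).toAddMonoidHom)
      (g := (X.tensorRight d + X.tensorRight d').toAddMonoidHom) fun x m => ?_) z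
    change X.tmul x ((d + d') • m) = X.tmul x (d • m) + X.tmul x (d' • m)
    simp only [tmul, add_smul, TensorProduct.tmul_add, map_add]
  zero_smul z := by
    refine DFunLike.congr_fun (tensor_hom_ext (f := (X.tensorRight 0).toAddMonoidHom)
      (g := 0) fun x m => ?_) z
    change X.tmul x ((0 : Gᵐᵒᵖ) • m) = 0
    simp [tmul]

@[simp] theorem op_smul_tmul (g : Gᵐᵒᵖ) (x : X.U) (m : M) :
    g • X.tmul x m = X.tmul x (g • m) := rfl

instance : SMulCommClass X.D Gᵐᵒᵖ X.Tensor where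
  smul_comm d g z := by
    refine DFunLike.congr_fun (tensor_hom_ext
      (f := (X.tensorLeft d ∘ₗ X.tensorRight g).toAddMonoidHom)
      (g := (X.tensorRight g ∘ₗ X.tensorLeft d).toAddMonoidHom) fun x m => ?_) z
    rfl

theorem rhoTensor_op_smul (g : Gᵐᵒᵖ) (z : X.Tensor) :
    X.rhoTensor (g • z) = g • X.rhoTensor z := by
  refine DFunLike.congr_fun (tensor_hom_ext
    (f := (X.rhoTensor ∘ₗ X.tensorRight g).toAddMonoidHom)
    (g := (DistribSMul.toAddMonoidHom X.V g).comp X.rhoTensor.toAddMonoidHom)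
      fun x m => ?_) z
  exact X.map_right x m g.unop

instance : Module Gᵐᵒᵖ X.VPlus where
  smul g z := ⟨g • z.1, LinearMap.mem_ker.2 (by
    rw [rhoTensor_op_smul, LinearMap.mem_ker.1 z.2, smul_zero])⟩
  one_smul z := Subtype.ext (one_smul _ _)
  mul_smul d d' z := Subtype.ext (mul_smul _ _ _)
  smul_zero d := Subtype.ext (smul_zero _)
  smul_add d z z' := Subtype.ext (smul_add _ _ _)
  add_smul d d' z := Subtype.ext (add_smul _ _ _)
  zero_smul z := Subtype.ext (zero_smul _ _)

instance : IsScalarTower k Gᵐᵒᵖ X.Tensor where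
  smul_assoc c g z := by
    refine DFunLike.congr_fun (tensor_hom_ext (f := (X.tensorRight (c • g)).toAddMonoidHom)
      (g := (c • X.tensorRight g).toAddMonoidHom) fun x m => ?_) z
    change X.tmul x ((c • g) • m) = c • X.tmul x (g • m)
    simp only [tmul, smul_assoc, TensorProduct.tmul_smul, map_smul]

instance : IsScalarTower k Gᵐᵒᵖ X.VPlus where
  smul_assoc c g z := Subtype.ext (smul_assoc c g z.1)

instance : SMulCommClass k Gᵐᵒᵖ X.VPlus where
  smul_comm c g z := Subtype.ext (map_smul (X.tensorRight g) c z.1).symm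

theorem coe_op_smul_VPlus (g : Gᵐᵒᵖ) (z : X.VPlus) :
    ((g • z : X.VPlus) : X.Tensor) = g • z.1 := rfl

instance : SMulCommClass X.D Gᵐᵒᵖ X.VPlus where
  smul_comm d g z := Subtype.ext (smul_comm d g z.1)

end RightAction

section Contraction

variable [IsScalarTower k F M]

/-- The map `U ⊗_F M → M`, `x ⊗ m ↦ φ(x) m` for `φ ∈ U^*`. -/
def contract (φ : X.UStar) : X.Tensor →ₗ[k] M :=
  X.tensorRel.liftQ
    (TensorProduct.lift ((Algebra.lsmul k k M).toLinearMap ∘ₗ φ.restrictScalars k)) (by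
    rw [tensorRel, Submodule.span_le]
    rintro _ ⟨x, f, m, rfl⟩
    simp)

@[simp] theorem contract_tmul (φ : X.UStar) (x : X.U) (m : M) :
    X.contract φ (X.tmul x m) = φ x • m := rfl

theorem contract_zero (z : X.Tensor) : X.contract 0 z = 0 := by
  refine DFunLike.congr_fun (tensor_hom_ext (f := (X.contract 0).toAddMonoidHom)
    (g := 0) fun x m => ?_) z
  exact zero_smul F m

theorem contract_add (φ ψ : X.UStar) (z : X.Tensor) :
    X.contract (φ + ψ) z = X.contract φ z + X.contract ψ z := by
  refine DFunLike.congr_fun (tensor_hom_ext (f := (X.contract (φ + ψ)).toAddMonoidHom)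
    (g := (X.contract φ + X.contract ψ).toAddMonoidHom) fun x m => ?_) z
  exact add_smul (φ x) (ψ x) m

theorem contract_sum {ι : Type*} (s : Finset ι) (φ : ι → X.UStar) (z : X.Tensor) :
    X.contract (∑ i ∈ s, φ i) z = ∑ i ∈ s, X.contract (φ i) z :=
  map_sum (AddMonoidHom.mk' (fun φ => X.contract φ z) fun φ ψ => X.contract_add φ ψ z) φ s

theorem contract_smul (f : F) (φ : X.UStar) (z : X.Tensor) :
    X.contract (f • φ) z = f • X.contract φ z := by
  refine DFunLike.congr_fun (tensor_hom_ext (f := (X.contract (f • φ)).toAddMonoidHom)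
    (g := (DistribSMul.toAddMonoidHom M f).comp (X.contract φ).toAddMonoidHom)
      fun x m => ?_) z
  exact mul_smul f (φ x) m

theorem contract_comp (φ : X.UStar) (d : X.D) (z : X.Tensor) :
    X.contract (φ ∘ₗ d.1.1) z = X.contract φ (d • z) := by
  refine DFunLike.congr_fun (tensor_hom_ext (f := (X.contract (φ ∘ₗ d.1.1)).toAddMonoidHom)
    (g := (X.contract φ ∘ₗ X.tensorLeft d).toAddMonoidHom) fun x m => ?_) z
  rfl

theorem contract_op_smul [IsScalarTower k Gᵐᵒᵖ M] [SMulCommClass F Gᵐᵒᵖ M]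
    (φ : X.UStar) (g : Gᵐᵒᵖ) (z : X.Tensor) :
    X.contract φ (g • z) = g • X.contract φ z := by
  refine DFunLike.congr_fun (tensor_hom_ext
    (f := (X.contract φ ∘ₗ X.tensorRight g).toAddMonoidHom)
    (g := (DistribSMul.toAddMonoidHom M g).comp (X.contract φ).toAddMonoidHom)
      fun x m => ?_) z
  exact smul_comm (φ x) g m

end Contraction

end BimodRep

/-! ### Rows and columns -/

namespace BimodRep

section RowsAndColumns

variable {k F G M : Type u} [Field k] [DivisionRing F] [DivisionRing G]
  [Algebra k F] [Algebra k G] [AddCommGroup M] [Module k M] [Module F M] [Module Gᵐᵒᵖ M]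
  (X : BimodRep k F G M) {n : ℕ}

/-- The product of a row with entries in `U^*` and a matrix over `D`. -/
def rowMul (φ : Fin n → X.UStar) (A : Matrix (Fin n) (Fin n) X.D) : Fin n → X.UStar :=
  fun s => ∑ r, φ r ∘ₗ (A r s).1.1

/-- The product of a matrix over `D` and a column with entries in `V⁺`. -/
def colMul (A : Matrix (Fin n) (Fin n) X.D) (z : Fin n → X.VPlus) : Fin n → X.VPlus :=
  fun r => ∑ s, A r s • z s

theorem rowMul_add (φ : Fin n → X.UStar) (A B : Matrix (Fin n) (Fin n) X.D) :
    X.rowMul φ (A + B) = X.rowMul φ A + X.rowMul φ B := by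
  funext s
  simp [rowMul, LinearMap.comp_add, Finset.sum_add_distrib]

theorem add_rowMul (φ ψ : Fin n → X.UStar) (A : Matrix (Fin n) (Fin n) X.D) :
    X.rowMul (φ + ψ) A = X.rowMul φ A + X.rowMul ψ A := by
  funext s
  simp [rowMul, LinearMap.add_comp, Finset.sum_add_distrib]

theorem zero_rowMul (A : Matrix (Fin n) (Fin n) X.D) : X.rowMul 0 A = 0 := by
  funext s
  simp [rowMul]

theorem rowMul_zero (φ : Fin n → X.UStar) : X.rowMul φ 0 = 0 := by
  funext s
  simp [rowMul]

theorem rowMul_one (φ : Fin n → X.UStar) : X.rowMul φ 1 = φ := by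
  funext s
  rw [rowMul, Finset.sum_eq_single s]
  · rw [Matrix.one_apply_eq]
    rfl
  · intro r _ hr
    rw [Matrix.one_apply_ne hr]
    exact LinearMap.comp_zero _
  · simp

theorem rowMul_mul (φ : Fin n → X.UStar) (A B : Matrix (Fin n) (Fin n) X.D) :
    X.rowMul φ (A * B) = X.rowMul (X.rowMul φ A) B := by
  funext s
  ext x
  simp only [rowMul, Matrix.mul_apply, LinearMap.sum_apply, LinearMap.comp_apply,
    AddSubmonoidClass.coe_finsetSum, Prod.fst_sum, map_sum]
  rw [Finset.sum_comm]
  rfl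

theorem smul_rowMul (f : F) (φ : Fin n → X.UStar) (A : Matrix (Fin n) (Fin n) X.D) :
    X.rowMul (f • φ) A = f • X.rowMul φ A := by
  funext s
  simp [rowMul, LinearMap.smul_comp, Finset.smul_sum]

theorem colMul_add (A : Matrix (Fin n) (Fin n) X.D) (z w : Fin n → X.VPlus) :
    X.colMul A (z + w) = X.colMul A z + X.colMul A w := by
  funext s
  simp [colMul, Finset.sum_add_distrib]

theorem add_colMul (A B : Matrix (Fin n) (Fin n) X.D) (z : Fin n → X.VPlus) :
    X.colMul (A + B) z = X.colMul A z + X.colMul B z := by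
  funext s
  simp [colMul, add_smul, Finset.sum_add_distrib]

theorem zero_colMul (z : Fin n → X.VPlus) : X.colMul 0 z = 0 := by
  funext s
  simp [colMul]

theorem colMul_zero (A : Matrix (Fin n) (Fin n) X.D) : X.colMul A 0 = 0 := by
  funext s
  simp [colMul]

theorem one_colMul (z : Fin n → X.VPlus) : X.colMul 1 z = z := by
  funext s
  simp [colMul, Matrix.one_apply, ite_smul]

theorem mul_colMul (A B : Matrix (Fin n) (Fin n) X.D) (z : Fin n → X.VPlus) :
    X.colMul (A * B) z = X.colMul A (X.colMul B z) := by
  funext s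
  simp only [colMul, Matrix.mul_apply, Finset.sum_smul, Finset.smul_sum, mul_smul]
  rw [Finset.sum_comm]

theorem colMul_op_smul [IsScalarTower k Gᵐᵒᵖ M] [SMulCommClass F Gᵐᵒᵖ M]
    (A : Matrix (Fin n) (Fin n) X.D) (g : Gᵐᵒᵖ) (z : Fin n → X.VPlus) :
    X.colMul A (g • z) = g • X.colMul A z := by
  funext s
  simp only [colMul, Pi.smul_apply, Finset.smul_sum]
  exact Finset.sum_congr rfl fun r _ => smul_comm (A s r) g (z r)

theorem scalar_rowMul (c : k) (φ : Fin n → X.UStar) (A : Matrix (Fin n) (Fin n) X.D) :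
    X.rowMul (c • φ) A = c • X.rowMul φ A := by
  funext s
  simp [rowMul, LinearMap.smul_comp, Finset.smul_sum]

theorem rowMul_scalar (c : k) (φ : Fin n → X.UStar) (A : Matrix (Fin n) (Fin n) X.D) :
    X.rowMul φ (c • A) = c • X.rowMul φ A := by
  funext s
  simp only [rowMul, Pi.smul_apply, Finset.smul_sum]
  exact Finset.sum_congr rfl fun r _ => LinearMap.ext fun x =>
    LinearMap.map_smul_of_tower (φ r) c ((A r s).1.1 x)

theorem scalar_colMul (c : k) (A : Matrix (Fin n) (Fin n) X.D) (z : Fin n → X.VPlus) :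
    X.colMul (c • A) z = c • X.colMul A z := by
  funext s
  simp only [colMul, Matrix.smul_apply, Pi.smul_apply, smul_assoc, Finset.smul_sum]

theorem colMul_scalar (c : k) (A : Matrix (Fin n) (Fin n) X.D) (z : Fin n → X.VPlus) :
    X.colMul A (c • z) = c • X.colMul A z := by
  funext s
  simp only [colMul, Pi.smul_apply, Finset.smul_sum]
  exact Finset.sum_congr rfl fun r _ => smul_comm (A s r) c (z r)

variable [IsScalarTower k F M]

/-- The product `∑ r, φ_r z_r ∈ M` of a row with entries in `U^*` and a column with entries in
`V⁺`, formed with the map `U^* ⊗ V⁺ → U^* ⊗ U ⊗_F M → F ⊗_F M = M`. -/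
def rowCol (φ : Fin n → X.UStar) (z : Fin n → X.VPlus) : M :=
  ∑ r, X.contract (φ r) (z r).1

theorem rowCol_add (φ : Fin n → X.UStar) (z w : Fin n → X.VPlus) :
    X.rowCol φ (z + w) = X.rowCol φ z + X.rowCol φ w := by
  simp [rowCol, Finset.sum_add_distrib]

theorem add_rowCol (φ ψ : Fin n → X.UStar) (z : Fin n → X.VPlus) :
    X.rowCol (φ + ψ) z = X.rowCol φ z + X.rowCol ψ z := by
  simp [rowCol, contract_add, Finset.sum_add_distrib]

theorem zero_rowCol (z : Fin n → X.VPlus) : X.rowCol 0 z = 0 := by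
  simp [rowCol, contract_zero]

theorem rowCol_zero (φ : Fin n → X.UStar) : X.rowCol φ 0 = 0 := by
  simp [rowCol]

theorem smul_rowCol (f : F) (φ : Fin n → X.UStar) (z : Fin n → X.VPlus) :
    X.rowCol (f • φ) z = f • X.rowCol φ z := by
  simp [rowCol, contract_smul, Finset.smul_sum]

theorem rowCol_op_smul [IsScalarTower k Gᵐᵒᵖ M] [SMulCommClass F Gᵐᵒᵖ M]
    (φ : Fin n → X.UStar) (g : Gᵐᵒᵖ) (z : Fin n → X.VPlus) :
    X.rowCol φ (g • z) = g • X.rowCol φ z := by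
  simp [rowCol, coe_op_smul_VPlus, contract_op_smul, Finset.smul_sum]

theorem rowCol_colMul (φ : Fin n → X.UStar) (A : Matrix (Fin n) (Fin n) X.D)
    (z : Fin n → X.VPlus) :
    X.rowCol φ (X.colMul A z) = X.rowCol (X.rowMul φ A) z := by
  simp only [rowCol, colMul, rowMul, contract_sum, AddSubmonoidClass.coe_finsetSum, map_sum,
    contract_comp, coe_smul_VPlus]
  rw [Finset.sum_comm]

theorem scalar_rowCol (c : k) (φ : Fin n → X.UStar) (z : Fin n → X.VPlus) :
    X.rowCol (c • φ) z = c • X.rowCol φ z := by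
  simp only [rowCol, Pi.smul_apply, Finset.smul_sum]
  refine Finset.sum_congr rfl fun r _ => ?_
  rw [← smul_one_smul F c (φ r), contract_smul, smul_one_smul]

theorem rowCol_scalar (c : k) (φ : Fin n → X.UStar) (z : Fin n → X.VPlus) :
    X.rowCol φ (c • z) = c • X.rowCol φ z := by
  simp [rowCol, Finset.smul_sum]

end RowsAndColumns

end BimodRep

/-! ### The canonical algebra -/

section CanonicalAlgebra

variable {k F G M : Type u} [Field k] [DivisionRing F] [DivisionRing G]
  [Algebra k F] [Algebra k G] [AddCommGroup M] [Module k M] [Module F M] [Module Gᵐᵒᵖ M]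

/-- The canonical algebra of weights `p i` and exceptional points `R i`, whose elements are the
block matrices
`(a, u, m; 0, d, v; 0, 0, g)` where, for each `i`, `d i` is an upper triangular matrix of size
`p i - 1` over `D i = End (R i)`, `u i` is a row with entries in `U_i^*`, and `v i` is a column
with entries in `V_i⁺`. -/
@[ext]
structure CanonicalAlgebra {t : ℕ} (p : Fin t → ℕ) (R : Fin t → BimodRep k F G M) : Type u where
  a : F
  u : ∀ i, Fin (p i - 1) → (R i).UStar
  m : M
  d : ∀ i, Matrix.blockTriangularSubalgebra k (R i).D (id : Fin (p i - 1) → Fin (p i - 1))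
  v : ∀ i, Fin (p i - 1) → (R i).VPlus
  g : G

namespace CanonicalAlgebra

variable {t : ℕ} {p : Fin t → ℕ} {R : Fin t → BimodRep k F G M}

variable (p R) in
/-- The underlying tuple of components. -/
def equivProd : CanonicalAlgebra p R ≃
    F × (∀ i, Fin (p i - 1) → (R i).UStar) × M ×
      (∀ i, Matrix.blockTriangularSubalgebra k (R i).D (id : Fin (p i - 1) → Fin (p i - 1))) ×
      (∀ i, Fin (p i - 1) → (R i).VPlus) × G where
  toFun x := (x.a, x.u, x.m, x.d, x.v, x.g)
  invFun y := ⟨y.1, y.2.1, y.2.2.1, y.2.2.2.1, y.2.2.2.2.1, y.2.2.2.2.2⟩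

instance : AddCommGroup (CanonicalAlgebra p R) := (equivProd p R).addCommGroup

instance : Module k (CanonicalAlgebra p R) := (equivProd p R).module k

section

variable (x y : CanonicalAlgebra p R) (c : k)

@[simp] theorem add_a : (x + y).a = x.a + y.a := rfl
@[simp] theorem add_u : (x + y).u = x.u + y.u := rfl
@[simp] theorem add_m : (x + y).m = x.m + y.m := rfl
@[simp] theorem add_d : (x + y).d = x.d + y.d := rfl
@[simp] theorem add_v : (x + y).v = x.v + y.v := rfl
@[simp] theorem add_g : (x + y).g = x.g + y.g := rfl
@[simp] theorem zero_a : (0 : CanonicalAlgebra p R).a = 0 := rfl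
@[simp] theorem zero_u : (0 : CanonicalAlgebra p R).u = 0 := rfl
@[simp] theorem zero_m : (0 : CanonicalAlgebra p R).m = 0 := rfl
@[simp] theorem zero_d : (0 : CanonicalAlgebra p R).d = 0 := rfl
@[simp] theorem zero_v : (0 : CanonicalAlgebra p R).v = 0 := rfl
@[simp] theorem zero_g : (0 : CanonicalAlgebra p R).g = 0 := rfl
@[simp] theorem smul_a : (c • x).a = c • x.a := rfl
@[simp] theorem smul_u : (c • x).u = c • x.u := rfl
@[simp] theorem smul_m : (c • x).m = c • x.m := rfl
@[simp] theorem smul_d : (c • x).d = c • x.d := rfl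
@[simp] theorem smul_v : (c • x).v = c • x.v := rfl
@[simp] theorem smul_g : (c • x).g = c • x.g := rfl

end

instance : One (CanonicalAlgebra p R) := ⟨⟨1, 0, 0, 1, 0, 1⟩⟩

@[simp] theorem one_a : (1 : CanonicalAlgebra p R).a = 1 := rfl
@[simp] theorem one_u : (1 : CanonicalAlgebra p R).u = 0 := rfl
@[simp] theorem one_m : (1 : CanonicalAlgebra p R).m = 0 := rfl
@[simp] theorem one_d : (1 : CanonicalAlgebra p R).d = 1 := rfl
@[simp] theorem one_v : (1 : CanonicalAlgebra p R).v = 0 := rfl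
@[simp] theorem one_g : (1 : CanonicalAlgebra p R).g = 1 := rfl

variable [IsScalarTower k F M] [IsScalarTower k Gᵐᵒᵖ M] [SMulCommClass F Gᵐᵒᵖ M]

/-- Matrix multiplication. -/
instance : Mul (CanonicalAlgebra p R) where
  mul x y :=
    { a := x.a * y.a
      u := fun i => x.a • y.u i + (R i).rowMul (x.u i) (y.d i).1
      m := x.a • y.m + (∑ i, (R i).rowCol (x.u i) (y.v i)) + op y.g • x.m
      d := x.d * y.d
      v := fun i => (R i).colMul (x.d i).1 (y.v i) + op y.g • x.v i
      g := x.g * y.g }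

section

variable (x y : CanonicalAlgebra p R)

theorem mul_a : (x * y).a = x.a * y.a := rfl
theorem mul_u (i : Fin t) :
    (x * y).u i = x.a • y.u i + (R i).rowMul (x.u i) (y.d i).1 := rfl
theorem mul_m : (x * y).m =
    x.a • y.m + (∑ i, (R i).rowCol (x.u i) (y.v i)) + op y.g • x.m := rfl
theorem mul_d : (x * y).d = x.d * y.d := rfl
theorem mul_v (i : Fin t) :
    (x * y).v i = (R i).colMul (x.d i).1 (y.v i) + op y.g • x.v i := rfl
theorem mul_g : (x * y).g = x.g * y.g := rfl

end

instance : Ring (CanonicalAlgebra p R) where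
  __ := (inferInstance : AddCommGroup (CanonicalAlgebra p R))
  left_distrib x y z := by
    apply CanonicalAlgebra.ext
    · simp [mul_a, mul_add]
    · funext i
      simp only [mul_u, add_u, add_d, Pi.add_apply, smul_add, AddMemClass.coe_add,
        BimodRep.rowMul_add]
      abel
    · simp only [mul_m, add_m, add_v, add_g, Pi.add_apply, smul_add, BimodRep.rowCol_add, op_add,
        add_smul, Finset.sum_add_distrib]
      abel
    · simp [mul_d, mul_add]
    · funext i
      simp only [mul_v, add_v, add_g, Pi.add_apply, BimodRep.colMul_add, op_add, add_smul]
      abel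
    · simp [mul_g, mul_add]
  right_distrib x y z := by
    apply CanonicalAlgebra.ext
    · simp [mul_a, add_mul]
    · funext i
      simp only [mul_u, add_u, add_a, Pi.add_apply, add_smul, BimodRep.add_rowMul]
      abel
    · simp only [mul_m, add_m, add_u, add_a, Pi.add_apply, smul_add, BimodRep.add_rowCol,
        add_smul, Finset.sum_add_distrib]
      abel
    · simp [mul_d, add_mul]
    · funext i
      simp only [mul_v, add_v, add_d, Pi.add_apply, AddMemClass.coe_add, BimodRep.add_colMul,
        smul_add]
      abel
    · simp [mul_g, add_mul]
  zero_mul x := by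
    apply CanonicalAlgebra.ext
    · simp [mul_a]
    · funext i
      simp [mul_u, BimodRep.zero_rowMul]
    · simp [mul_m, BimodRep.zero_rowCol]
    · simp [mul_d]
    · funext i
      simp [mul_v, BimodRep.zero_colMul]
    · simp [mul_g]
  mul_zero x := by
    apply CanonicalAlgebra.ext
    · simp [mul_a]
    · funext i
      simp [mul_u, BimodRep.rowMul_zero]
    · simp [mul_m, BimodRep.rowCol_zero]
    · simp [mul_d]
    · funext i
      simp [mul_v, BimodRep.colMul_zero]
    · simp [mul_g]
  mul_assoc x y z := by
    apply CanonicalAlgebra.ext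
    · simp [mul_a, mul_assoc]
    · funext i
      simp only [mul_u, mul_a, mul_d, Pi.mul_apply, MulMemClass.coe_mul, smul_add,
        BimodRep.add_rowMul, BimodRep.rowMul_mul, BimodRep.smul_rowMul, mul_smul]
      abel
    · simp only [mul_m, mul_u, mul_v, mul_a, mul_g, smul_add, BimodRep.add_rowCol,
        BimodRep.rowCol_add, BimodRep.smul_rowCol, BimodRep.rowCol_op_smul,
        BimodRep.rowCol_colMul, mul_smul, op_mul, Finset.sum_add_distrib, Finset.smul_sum,
        smul_comm x.a (op z.g) y.m]
      abel
    · simp [mul_d, mul_assoc]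
    · funext i
      simp only [mul_v, mul_g, mul_d, Pi.mul_apply, MulMemClass.coe_mul, smul_add,
        BimodRep.colMul_add, BimodRep.mul_colMul, BimodRep.colMul_op_smul, op_mul, mul_smul]
      abel
    · simp [mul_g, mul_assoc]
  one_mul x := by
    apply CanonicalAlgebra.ext
    · simp [mul_a]
    · funext i
      simp [mul_u, BimodRep.zero_rowMul]
    · simp [mul_m, BimodRep.zero_rowCol]
    · simp [mul_d]
    · funext i
      simp [mul_v, BimodRep.one_colMul]
    · simp [mul_g]
  mul_one x := by
    apply CanonicalAlgebra.ext
    · simp [mul_a]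
    · funext i
      simp [mul_u, BimodRep.rowMul_one]
    · simp [mul_m, BimodRep.rowCol_zero]
    · simp [mul_d]
    · funext i
      simp [mul_v, BimodRep.colMul_zero]
    · simp [mul_g]
instance : Algebra k (CanonicalAlgebra p R) :=
  Algebra.ofModule
    (fun c x y => by
      apply CanonicalAlgebra.ext
      · simp [mul_a]
      · funext i
        simp only [mul_u, smul_a, smul_u, Pi.smul_apply, smul_add, smul_assoc,
          BimodRep.scalar_rowMul]
      · simp only [mul_m, smul_a, smul_u, smul_m, Pi.smul_apply, smul_add, smul_assoc,
          BimodRep.scalar_rowCol, Finset.smul_sum, smul_comm c (op y.g) x.m]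
      · simp [mul_d]
      · funext i
        simp only [mul_v, smul_d, smul_v, Pi.smul_apply, smul_add, SetLike.val_smul,
          BimodRep.scalar_colMul]
        exact congrArg _ (funext fun r => smul_comm (op y.g) c (x.v i r))
      · simp [mul_g])
    (fun c x y => by
      apply CanonicalAlgebra.ext
      · simp [mul_a]
      · funext i
        simp only [mul_u, smul_d, smul_u, Pi.smul_apply, smul_add, SetLike.val_smul,
          BimodRep.rowMul_scalar, smul_comm x.a c (y.u i)]
      · simp only [mul_m, smul_v, smul_m, smul_g, Pi.smul_apply, smul_add, op_smul, smul_assoc,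
          BimodRep.rowCol_scalar, Finset.smul_sum, smul_comm x.a c y.m]
      · simp [mul_d]
      · funext i
        simp only [mul_v, smul_g, smul_v, Pi.smul_apply, smul_add, op_smul,
          BimodRep.colMul_scalar]
        exact congrArg _ (funext fun r => smul_assoc c (op y.g) (x.v i r))
      · simp [mul_g])

end CanonicalAlgebra
end CanonicalAlgebra

/-! ### Grothendieck groups and Euler forms -/

/-- Finitely generated left modules over a ring `A`. -/
abbrev FinMod (A : Type u) [Ring A] : Type (u + 1) :=
  {X : ModuleCat.{u} A // Module.Finite A X}

/-- The subgroup generated by the elements `[X₂] - [X₁] - [X₃]` for all short exact sequences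
`0 → X₁ → X₂ → X₃ → 0` of finitely generated left `A`-modules. -/
def grothendieckRel (A : Type u) [Ring A] : AddSubgroup (FreeAbelianGroup (FinMod A)) :=
  AddSubgroup.closure {z | ∃ (S : CategoryTheory.ShortComplex (ModuleCat.{u} A))
    (h₁ : Module.Finite A S.X₁) (h₂ : Module.Finite A S.X₂) (h₃ : Module.Finite A S.X₃),
    S.ShortExact ∧
      z = FreeAbelianGroup.of ⟨S.X₂, h₂⟩ - FreeAbelianGroup.of ⟨S.X₁, h₁⟩ -
        FreeAbelianGroup.of ⟨S.X₃, h₃⟩}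

/-- The Grothendieck group `K₀(A-mod)` of the category of finitely generated left `A`-modules. -/
abbrev K0 (A : Type u) [Ring A] : Type (u + 1) :=
  FreeAbelianGroup (FinMod A) ⧸ grothendieckRel A

/-- The class of a module in the Grothendieck group. -/
def K0.mk {A : Type u} [Ring A] (X : FinMod A) : K0 A :=
  QuotientAddGroup.mk (FreeAbelianGroup.of X)

/-- `B` is the Euler form of the `k`-algebra `A`: for all finitely generated modules `X` and `Y`
the spaces `Ext^n(X, Y)` are finite-dimensional over `k` and vanish for all large `n`, and
`B([X], [Y]) = ∑ₙ (-1)ⁿ dim_k Ext^n(X, Y)`. -/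
def IsEulerForm (k : Type u) {A : Type u} [Field k] [Ring A] [Algebra k A]
    (B : LinearMap.BilinForm ℤ (K0 A)) : Prop :=
  ∀ X Y : FinMod A,
    (∀ n, Module.Finite k (CategoryTheory.Abelian.Ext X.1 Y.1 n)) ∧
    ∃ N : ℕ, (∀ n, N ≤ n → Subsingleton (CategoryTheory.Abelian.Ext X.1 Y.1 n)) ∧
      B (K0.mk X) (K0.mk Y) = ∑ n ∈ Finset.range N,
        (-1) ^ n * (Module.finrank k (CategoryTheory.Abelian.Ext X.1 Y.1 n) : ℤ)

/-! ### Bilinear lattices -/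

/-- A bilinear lattice: a free abelian group of finite rank with a non-degenerate bilinear form
that admits a Coxeter transformation. -/
def IsBilinearLattice {V : Type*} [AddCommGroup V] (B : LinearMap.BilinForm ℤ V) : Prop :=
  Module.Free ℤ V ∧ Module.Finite ℤ V ∧ B.Nondegenerate ∧
    ∃ τ : V ≃+ V, ∀ x y, B y x = -B x (τ y)

/-- The groups with bilinear forms `B` and `B'` are isomorphic. -/
def LatticeIso {V W : Type*} [AddCommGroup V] [AddCommGroup W]
    (B : LinearMap.BilinForm ℤ V) (B' : LinearMap.BilinForm ℤ W) : Prop :=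
  ∃ φ : V ≃+ W, ∀ x y, B' (φ x) (φ y) = B x y

/-- The groups with bilinear forms `B` and `B'` are isomorphic up to a constant factor: `B`
corresponds to a positive integral multiple of `B'`. -/
def LatticeIsoUpToFactor {V W : Type*} [AddCommGroup V] [AddCommGroup W]
    (B : LinearMap.BilinForm ℤ V) (B' : LinearMap.BilinForm ℤ W) : Prop :=
  ∃ c : ℤ, 0 < c ∧ LatticeIso B (c • B')

/-- A symbol: weights `p i`, integers `e i` and `f i`, and the number `ε`. In the usual notation
it is displayed with rows `p i`, `d i = e i * f i` and `f i`, and with the entry `ε`. -/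
structure CanonicalSymbol (t : ℕ) where
  p : Fin t → ℕ
  e : Fin t → ℕ
  f : Fin t → ℕ
  ε : ℕ

namespace CanonicalSymbol

variable {t : ℕ} (σ : CanonicalSymbol t)

/-- `κ = lcm_i (e_i / gcd (e_i, ε f_i))`. -/
def κ : ℕ := Finset.univ.lcm fun i => σ.e i / Nat.gcd (σ.e i) (σ.ε * σ.f i)

/-- The indices of the basis `a`, `w`, `s i j` with `0 ≤ j ≤ p i - 2`. -/
inductive Index : Type
  | a : Index
  | w : Index
  | s (i : Fin t) (j : Fin (σ.p i - 1)) : Index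

/-- The Gram matrix of the canonical bilinear lattice in the basis `a`, `w`, `s i j`. The quotient
`κ ε f_i / e_i` is exact. -/
def gram : σ.Index → σ.Index → ℤ
  | .a, .a => σ.κ
  | .a, .w => σ.κ * σ.ε
  | .w, .a => -(σ.κ * σ.ε)
  | .a, .s i j => if (j : ℕ) = 0 then σ.κ * σ.ε * σ.f i else 0
  | .s i j, .s i' j' =>
      if i = i' then
        if (j : ℕ) = j' then σ.κ * σ.ε * σ.f i / σ.e i
        else if (j : ℕ) + 1 = j' then -(σ.κ * σ.ε * σ.f i / σ.e i)
        else 0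
      else 0
  | .w, .w => 0
  | .w, .s _ _ => 0
  | .s _ _, .a => 0
  | .s _ _, .w => 0

/-- The form of the canonical bilinear lattice, on the free abelian group on `a`, `w`, `s i j`. -/
def form : LinearMap.BilinForm ℤ (σ.Index →₀ ℤ) :=
  Finsupp.linearCombination ℤ fun x => Finsupp.linearCombination ℤ (σ.gram x)

end CanonicalSymbol

end

/-! The algebra C is triangular with the division rings F, D_i, G on its diagonal. Hence K_0 is free
on the classes of the projectives Ae belonging to the diagonal idempotents. Since higher Ext out of
a projective vanishes and Hom(Ae, X) = eX, the Euler form has Gram matrix dim_k(e_x A e_y) in this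
basis. It remains to compute the dimensions of the blocks of C and to recognise the resulting
integral matrix.

Block dimensions. Put b = dim M_G, so that εb = 2, and use the defect b dim U_F - 2 dim V_G. A
regular-simple representation has defect zero, and two facts about it are needed: its endomorphism
ring is a division ring, and its map U ⊗_F M → V is onto. Both follow once subrepresentations of an
indecomposable representation X of defect zero are known to have defect at most zero
(`IsIndecomposable.isTorsionFree`). If this failed, take a subrepresentation Y of maximal defect
and, among those, of minimal size. Then all non-zero quotients of Y have positive defect and no
subrepresentation of X/Y has positive defect. This forces Ext¹(X/Y, Y) = 0
(`extVanish_of_isTorsion`), so Y splits off, which is impossible. The Ext-vanishing rests on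
tameness: the Euler form of M is governed by defects, and its quadratic form is a positive multiple
of the squared defect (`euler_eq`).

Consequently dim V_i⁺ = dim V_i, and counting dim_k U_i and dim_k V_i from both sides expresses all
blocks through few numbers. For ε in {1, 2} and δ = dim_k F one has dim G = ε²δ, dim M = 2εδ, dim
U_i^* = εδf_i, dim V_i⁺ = ε²δf_i and e_i dim D_i = εδf_i.

Recognition. Take a = [Ae_first] and w = [Ae_last] - εa, complete each arm of projectives by f_i
[Ae_last], and let the s_i^(j) be its consecutive differences (`latticeIso_of_chains`). Pairings
that are constant along an arm cancel, and c times the canonical Gram matrix remains, where δ = cκ;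
the relation for dim D_i shows that κ divides δ. Right modules are modules over the opposite
algebra, whose Gram matrix is the transpose; there a is the last vertex and w = ε[last] - [first],
with the same c (`latticeIso_pair`), so the two Grothendieck groups are isometric. For ε = 1/2 the
sides are interchanged and δ = dim_k G. An explicit Coxeter transformation makes the canonical
lattice a bilinear lattice, and the isometries transport this property. -/

noncomputable section

/-! ### Algebras with a triangular system of idempotents -/

open CategoryTheory in
/-- A short exact sequence of modules, given by linear maps. -/
theorem shortExact_moduleCatMk {A : Type u} [Ring A] {X Y Z : Type u} [AddCommGroup X]
    [AddCommGroup Y] [AddCommGroup Z] [Module A X] [Module A Y] [Module A Z]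
    (f : X →ₗ[A] Y) (g : Y →ₗ[A] Z) (hf : Function.Injective f) (hg : Function.Surjective g)
    (h : Function.Exact f g) :
    (ShortComplex.moduleCatMk f g h.linearMap_comp_eq_zero).ShortExact where
  exact := by
    rw [ShortComplex.moduleCat_exact_iff]
    exact fun x hx => (h x).1 hx
  mono_f := (ModuleCat.mono_iff_injective _).2 hf
  epi_g := (ModuleCat.epi_iff_surjective _).2 hg

/-- A complete system of orthogonal idempotents `e x` of a ring `A` such that `e x * A * e y` is
zero unless `x = y` or `h x < h y`, and such that the rings `e x * A * e x` are division rings. -/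
structure TriangularIdempotents (A : Type u) [Ring A] (ι : Type) [Fintype ι] where
  e : ι → A
  h : ι → ℕ
  complete : CompleteOrthogonalIdempotents e
  ne_zero : ∀ x, e x ≠ 0
  triangular : ∀ x y a, e x * a * e y ≠ 0 → x = y ∨ h x < h y
  leftInv : ∀ x a, e x * a * e x ≠ 0 → ∃ b, b * (e x * a * e x) = e x

namespace TriangularIdempotents

section Ring

variable {A : Type u} [Ring A] {ι : Type} [Fintype ι] (T : TriangularIdempotents A ι)

theorem e_mul_e (x : ι) : T.e x * T.e x = T.e x := T.complete.idem x

/-- The projective module `A e`. -/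
def proj (x : ι) : Submodule A A where
  carrier := {a | a * T.e x = a}
  add_mem' {a b} ha hb := by
    rw [Set.mem_ofPred_eq] at *
    rw [add_mul, ha, hb]
  zero_mem' := zero_mul _
  smul_mem' c a ha := by
    rw [Set.mem_ofPred_eq] at *
    rw [smul_eq_mul, mul_assoc, ha]

theorem mem_proj {x : ι} {a : A} : a ∈ T.proj x ↔ a * T.e x = a := Iff.rfl

theorem e_mem_proj (x : ι) : T.e x ∈ T.proj x := T.e_mul_e x

/-- Right multiplication by `e`. -/
def toProj (x : ι) : A →ₗ[A] T.proj x :=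
  (LinearMap.toSpanSingleton A A (T.e x)).codRestrict _ fun a => by
    rw [LinearMap.toSpanSingleton_apply, smul_eq_mul, mem_proj, mul_assoc, e_mul_e]

instance (x : ι) : Module.Projective A (T.proj x) :=
  Module.Projective.of_split (T.proj x).subtype (T.toProj x) (by
    ext a
    exact a.2)

instance (x : ι) : Module.Finite A (T.proj x) :=
  Module.Finite.of_surjective (T.toProj x) fun a => ⟨a, Subtype.ext a.2⟩

/-- The projective module `A e` as an object of the category of finitely generated modules. -/
def projMod (x : ι) : FinMod A :=
  ⟨ModuleCat.of A (T.proj x), inferInstanceAs (Module.Finite A (T.proj x))⟩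

instance (x : ι) : CategoryTheory.Projective (T.projMod x).1 :=
  (IsProjective.iff_projective (T.proj x)).1 inferInstance

theorem sum_smul {X : Type*} [AddCommGroup X] [Module A X] (v : X) : ∑ x, T.e x • v = v := by
  rw [← Finset.sum_smul, T.complete.complete, one_smul]

theorem eq_zero_of_mem_support_lt {x y : ι} (hxy : x ≠ y) (h : T.h y ≤ T.h x) (a : A) :
    T.e x * a * T.e y = 0 := by
  by_contra hne
  rcases T.triangular x y a hne with h' | h'
  · exact hxy h'
  · omega

/-- Induction on a bound for the heights of the vertices that support X. In a submodule N maximal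
with property P, a missing element e_x v would give a map from Ae_x to X/N whose kernel has smaller
support; its image then has P, and so does the preimage of that image in X, which is larger than N.
-/
theorem induction_aux [IsNoetherianRing A] (P : ModuleCat.{u} A → Prop)
    (proj : ∀ x, P (T.projMod x).1) (zero : ∀ X : ModuleCat.{u} A, Subsingleton X → P X)
    (ext : ∀ S : CategoryTheory.ShortComplex (ModuleCat.{u} A), S.ShortExact →
      Module.Finite A S.X₂ → P S.X₁ → P S.X₃ → P S.X₂)
    (coker : ∀ S : CategoryTheory.ShortComplex (ModuleCat.{u} A), S.ShortExact →
      Module.Finite A S.X₂ → P S.X₁ → P S.X₂ → P S.X₃) (n : ℕ) :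
    ∀ (X : Type u) [AddCommGroup X] [Module A X] [Module.Finite A X],
      (∀ x, n ≤ T.h x → ∀ v : X, T.e x • v = 0) → P (ModuleCat.of A X) := by
  induction n with
  | zero =>
    intro X _ _ _ hX
    refine zero _ ⟨fun v w => ?_⟩
    change X at v w
    rw [← T.sum_smul v, ← T.sum_smul w]
    simp [hX]
  | succ n ih =>
    intro X _ _ _ hX
    obtain ⟨N, hN, hmax⟩ := set_has_maximal_iff_noetherian.2 (inferInstance : IsNoetherian A X)
      {N : Submodule A X | P (ModuleCat.of A N)} ⟨⊥, zero _ (inferInstanceAs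
        (Subsingleton (⊥ : Submodule A X)))⟩
    have key : N = ⊤ := by
      by_contra hne
      obtain ⟨v, hv⟩ : ∃ v, v ∉ N := by
        by_contra! h
        exact hne (eq_top_iff.2 fun v _ => h v)
      obtain ⟨x, hx⟩ : ∃ x, T.e x • v ∉ N := by
        by_contra! h
        exact hv (T.sum_smul v ▸ N.sum_mem fun x _ => h x)
      let φ : T.proj x →ₗ[A] X ⧸ N :=
        (LinearMap.toSpanSingleton A (X ⧸ N) (N.mkQ v)) ∘ₗ (T.proj x).subtype
      have hφ (a : T.proj x) : φ a = N.mkQ ((a : A) • v) := rfl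
      -- An element a of Ae_x with e_y a ≠ 0 forces y = x or h y < h x ≤ n. If y = x, then e_x a e_x
      -- is left invertible, so a cannot be killed by φ without putting e_x v into N. Thus the
      -- kernel is supported at heights below n.
      have hker : P (ModuleCat.of A (LinearMap.ker φ)) := by
        apply ih
        rintro y hy ⟨a, ha⟩
        apply Subtype.ext
        apply Subtype.ext
        change T.e y * (a : A) = 0
        have ha2 : (a : A) * T.e x = a := a.2
        by_contra hne0
        rw [← ha2, ← mul_assoc] at hne0
        have hxn : T.h x ≤ n := by
          by_contra hlt
          refine hx ?_
          rw [hX x (by omega) v]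
          exact N.zero_mem
        have hyx : y = x := by
          rcases T.triangular y x a hne0 with h | h
          · exact h
          · omega
        subst hyx
        obtain ⟨b, hb⟩ := T.leftInv y a hne0
        refine hx ?_
        rw [← hb, mul_smul, mul_assoc, ha2, mul_smul]
        refine N.smul_mem _ (N.smul_mem _ ?_)
        rw [LinearMap.mem_ker, hφ] at ha
        exact (Submodule.Quotient.mk_eq_zero N).1 ha
      have hrange : P (ModuleCat.of A (LinearMap.range φ)) :=
        coker _ (shortExact_moduleCatMk (LinearMap.ker φ).subtype φ.rangeRestrict
          (Submodule.subtype_injective _) φ.surjective_rangeRestrict (by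
            intro a
            rw [← LinearMap.mem_ker, LinearMap.ker_rangeRestrict]
            simp)) (T.projMod x).2 hker (proj x)
      let N' := (LinearMap.range φ).comap N.mkQ
      have hle : N ≤ N' := fun w hw => by
        rw [Submodule.mem_comap,
          (Submodule.Quotient.mk_eq_zero N).2 hw |> fun h => (h : N.mkQ w = 0)]
        exact zero_mem _
      have hN' : P (ModuleCat.of A N') :=
        ext _ (shortExact_moduleCatMk (Submodule.inclusion hle)
          (N.mkQ.restrict (p := N') (q := LinearMap.range φ) fun w hw => hw)
          (Submodule.inclusion_injective hle) (by
            rintro ⟨y, hy⟩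
            obtain ⟨w, rfl⟩ := N.mkQ_surjective y
            exact ⟨⟨w, hy⟩, rfl⟩) (by
            rintro ⟨w, hw⟩
            rw [← Subtype.coe_inj]
            change N.mkQ w = 0 ↔ _
            rw [← LinearMap.mem_ker, Submodule.ker_mkQ]
            constructor
            · exact fun h => ⟨⟨w, h⟩, rfl⟩
            · rintro ⟨y, hy⟩
              have hy' : (y : X) = w := congrArg Subtype.val hy
              exact hy' ▸ y.2)) (inferInstance : Module.Finite A N') hN hrange
      refine hmax N' hN' (lt_of_le_of_ne hle ?_)
      intro h
      refine hx ?_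
      rw [h]
      exact ⟨⟨T.e x, T.e_mem_proj x⟩, rfl⟩
    -- P is not assumed invariant under isomorphism; it passes from the submodule ⊤ to X by an
    -- extension with zero quotient.
    subst key
    refine ext _ (shortExact_moduleCatMk (⊤ : Submodule A X).subtype (⊤ : Submodule A X).mkQ
      (Submodule.subtype_injective _) (Submodule.mkQ_surjective _) ?_)
      (inferInstance : Module.Finite A X) hN (zero _ ?_)
    · intro w
      rw [← LinearMap.mem_ker, Submodule.ker_mkQ]
      simp
    · exact inferInstanceAs (Subsingleton (X ⧸ (⊤ : Submodule A X)))

/-- A property of finitely generated modules that holds for the modules `A e` and is inherited by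
extensions and by cokernels of injections holds for all finitely generated modules. -/
theorem induction [IsNoetherianRing A] (P : ModuleCat.{u} A → Prop)
    (proj : ∀ x, P (T.projMod x).1) (zero : ∀ X : ModuleCat.{u} A, Subsingleton X → P X)
    (ext : ∀ S : CategoryTheory.ShortComplex (ModuleCat.{u} A), S.ShortExact →
      Module.Finite A S.X₂ → P S.X₁ → P S.X₃ → P S.X₂)
    (coker : ∀ S : CategoryTheory.ShortComplex (ModuleCat.{u} A), S.ShortExact →
      Module.Finite A S.X₂ → P S.X₁ → P S.X₂ → P S.X₃) (X : FinMod A) : P X.1 := by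
  have := X.2
  refine T.induction_aux P proj zero ext coker ((∑ x, T.h x) + 1) X.1 fun x hx => ?_
  have := Finset.single_le_sum (f := T.h) (fun _ _ => Nat.zero_le _) (Finset.mem_univ x)
  omega

end Ring

end TriangularIdempotents

/-! ### Euler characteristics of short exact sequences -/

section EulerCharacteristic

open CategoryTheory CategoryTheory.Abelian

variable (k : Type u) {A : Type u} [Field k] [Ring A] [Algebra k A]

/-- The partial sum `∑_{m ≤ n} (-1)^m dim Ext^m(X, Y)`. -/
def eulerSum (X Y : ModuleCat.{u} A) (n : ℕ) : ℤ :=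
  ∑ m ∈ Finset.range (n + 1), (-1) ^ m * (Module.finrank k (Ext X Y m) : ℤ)

variable {S : ShortComplex (ModuleCat.{u} A)}

theorem ext_precomp_g_zero_injective (hS : S.ShortExact) (Y : ModuleCat.{u} A) :
    Function.Injective ((Ext.mk₀ S.g).precompOfLinear k Y (zero_add 0)) := by
  have := hS.epi_g
  exact Ext.precomp_mk₀_injective_of_epi Y S.g

theorem ext_exact₂ (hS : S.ShortExact) (Y : ModuleCat.{u} A)
    (n : ℕ) : Function.Exact ((Ext.mk₀ S.g).precompOfLinear k Y (zero_add n))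
    ((Ext.mk₀ S.f).precompOfLinear k Y (zero_add n)) := by
  intro x
  constructor
  · exact fun hx => Ext.contravariant_sequence_exact₂ hS Y x hx
  · rintro ⟨y, rfl⟩
    change (Ext.mk₀ S.f).comp ((Ext.mk₀ S.g).comp y (zero_add n)) (zero_add n) = 0
    rw [← Ext.comp_assoc (Ext.mk₀ S.f) (Ext.mk₀ S.g) y (zero_add 0) (zero_add n) (by omega)]
    simp

theorem ext_exact₁ (hS : S.ShortExact) (Y : ModuleCat.{u} A)
    (n : ℕ) : Function.Exact ((Ext.mk₀ S.f).precompOfLinear k Y (zero_add n))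
    (hS.extClass.precompOfLinear k Y (add_comm 1 n)) := by
  intro x
  constructor
  · exact fun hx => Ext.contravariant_sequence_exact₁ hS Y x (add_comm 1 n) hx
  · rintro ⟨y, rfl⟩
    change hS.extClass.comp ((Ext.mk₀ S.f).comp y (zero_add n)) (add_comm 1 n) = 0
    rw [← Ext.comp_assoc hS.extClass (Ext.mk₀ S.f) y (add_zero 1) (zero_add n) (by omega)]
    simp

theorem ext_exact₃ (hS : S.ShortExact) (Y : ModuleCat.{u} A)
    (n : ℕ) : Function.Exact (hS.extClass.precompOfLinear k Y (add_comm 1 n))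
    ((Ext.mk₀ S.g).precompOfLinear k Y (zero_add (n + 1))) := by
  intro x
  constructor
  · exact fun hx => Ext.contravariant_sequence_exact₃ hS Y x hx (add_comm 1 n)
  · rintro ⟨y, rfl⟩
    change (Ext.mk₀ S.g).comp (hS.extClass.comp y (add_comm 1 n)) (zero_add (n + 1)) = 0
    rw [← Ext.comp_assoc (Ext.mk₀ S.g) hS.extClass y (zero_add 1) (add_comm 1 n) (by omega)]
    simp

theorem finite_of_exact {V₁ V₂ V₃ : Type*} [AddCommGroup V₁] [AddCommGroup V₂] [AddCommGroup V₃]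
    [Module k V₁] [Module k V₂] [Module k V₃] {f : V₁ →ₗ[k] V₂} {g : V₂ →ₗ[k] V₃}
    (h : Function.Exact f g) [Module.Finite k V₁] [Module.Finite k V₃] : Module.Finite k V₂ := by
  have h₁ : Module.Finite k (LinearMap.ker g) := by
    rw [LinearMap.exact_iff.1 h]
    infer_instance
  have h₂ : Module.Finite k (V₂ ⧸ LinearMap.ker g) :=
    Module.Finite.equiv g.quotKerEquivRange.symm
  exact Module.Finite.of_submodule_quotient (LinearMap.ker g)

theorem ext_finite_X₂ (hS : S.ShortExact) (Y : ModuleCat.{u} A)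
    (n : ℕ) [Module.Finite k (Ext S.X₁ Y n)] [Module.Finite k (Ext S.X₃ Y n)] :
    Module.Finite k (Ext S.X₂ Y n) :=
  finite_of_exact k (ext_exact₂ k hS Y n)

theorem ext_finite_X₃ (hS : S.ShortExact) (Y : ModuleCat.{u} A)
    (n : ℕ) (h₁ : ∀ m, Module.Finite k (Ext S.X₁ Y m))
    (h₂ : ∀ m, Module.Finite k (Ext S.X₂ Y m)) : Module.Finite k (Ext S.X₃ Y n) := by
  cases n with
  | zero => exact Module.Finite.of_injective _ (ext_precomp_g_zero_injective k hS Y)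
  | succ n => exact finite_of_exact k (ext_exact₃ k hS Y n)

theorem subsingleton_of_exact {V₁ V₂ V₃ : Type*} [AddCommGroup V₁] [AddCommGroup V₂]
    [AddCommGroup V₃] [Module k V₁] [Module k V₂] [Module k V₃] {f : V₁ →ₗ[k] V₂}
    {g : V₂ →ₗ[k] V₃} (h : Function.Exact f g) [Subsingleton V₁] [Subsingleton V₃] :
    Subsingleton V₂ := by
  refine subsingleton_of_forall_eq 0 fun v => ?_
  obtain ⟨w, rfl⟩ := (h v).1 (Subsingleton.elim _ _)
  rw [Subsingleton.elim w 0, map_zero]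

theorem finrank_range_eq_zero_of_subsingleton {V₁ V₂ : Type*} [AddCommGroup V₁] [AddCommGroup V₂]
    [Module k V₁] [Module k V₂] [Subsingleton V₁] (f : V₁ →ₗ[k] V₂) :
    Module.finrank k (LinearMap.range f) = 0 := by
  rw [Subsingleton.elim f 0, LinearMap.range_zero, finrank_bot]

theorem finrank_of_exact {V₁ V₂ V₃ : Type*} [AddCommGroup V₁] [AddCommGroup V₂] [AddCommGroup V₃]
    [Module k V₁] [Module k V₂] [Module k V₃] {f : V₁ →ₗ[k] V₂} {g : V₂ →ₗ[k] V₃}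
    (h : Function.Exact f g) [Module.Finite k V₂] :
    Module.finrank k V₂ =
      Module.finrank k (LinearMap.range f) + Module.finrank k (LinearMap.range g) := by
  rw [← LinearMap.finrank_range_add_finrank_ker g, LinearMap.exact_iff.1 h, add_comm]

/-- Cutting the long exact sequence after degree n leaves exactly one uncancelled term, the rank of
the connecting map from Ext^n(X₁, Y) to Ext^(n+1)(X₃, Y). Additivity of Euler characteristics
follows as soon as Ext^n(X₁, Y) is zero. -/
theorem eulerSum_add (hS : S.ShortExact) (Y : ModuleCat.{u} A)
    (h₁ : ∀ m, Module.Finite k (Ext S.X₁ Y m))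
    (h₂ : ∀ m, Module.Finite k (Ext S.X₂ Y m)) (h₃ : ∀ m, Module.Finite k (Ext S.X₃ Y m)) (n : ℕ) :
    eulerSum k S.X₁ Y n + eulerSum k S.X₃ Y n - eulerSum k S.X₂ Y n = (-1) ^ n *
      Module.finrank k (LinearMap.range (hS.extClass.precompOfLinear k Y (add_comm 1 n))) := by
  induction n with
  | zero =>
    have e₁ := finrank_of_exact k (ext_exact₁ k hS Y 0)
    have e₂ := finrank_of_exact k (ext_exact₂ k hS Y 0)
    have e₃ := LinearMap.finrank_range_of_inj (ext_precomp_g_zero_injective k hS Y)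
    rw [e₃] at e₂
    simp only [eulerSum, zero_add, Finset.range_one, Finset.sum_singleton, pow_zero, one_mul]
    rw [e₁, e₂]
    push_cast
    ring
  | succ n ih =>
    have e₁ := finrank_of_exact k (ext_exact₁ k hS Y (n + 1))
    have e₂ := finrank_of_exact k (ext_exact₂ k hS Y (n + 1))
    have e₃ := finrank_of_exact k (ext_exact₃ k hS Y n)
    have step (X : ModuleCat.{u} A) : eulerSum k X Y (n + 1) = eulerSum k X Y n +
        (-1) ^ (n + 1) * (Module.finrank k (Ext X Y (n + 1)) : ℤ) :=
      Finset.sum_range_succ _ _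
    rw [step, step, step, e₁, e₂, e₃]
    push_cast
    linear_combination ih

end EulerCharacteristic

/-! ### The Grothendieck group of an algebra with a triangular system of idempotents -/

namespace K0

variable {A : Type u} [Ring A]

open CategoryTheory

theorem mk_eq_add {S : ShortComplex (ModuleCat.{u} A)} (hS : S.ShortExact)
    (h₁ : Module.Finite A S.X₁) (h₂ : Module.Finite A S.X₂) (h₃ : Module.Finite A S.X₃) :
    K0.mk ⟨S.X₂, h₂⟩ = K0.mk ⟨S.X₁, h₁⟩ + K0.mk ⟨S.X₃, h₃⟩ := by
  rw [← sub_eq_zero, ← sub_sub]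
  exact (QuotientAddGroup.eq_zero_iff _).2 (AddSubgroup.subset_closure ⟨S, h₁, h₂, h₃, hS, rfl⟩)

theorem mk_eq_zero (X : FinMod A) (hX : Subsingleton X.1) : K0.mk X = 0 := by
  -- For X = 0 the sequence 0 → X → X → X → 0 is exact, whence [X] = [X] + [X].
  have hS := shortExact_moduleCatMk (A := A) (X := X.1) (Y := X.1) (Z := X.1) LinearMap.id 0
    Function.injective_id (Function.surjective_to_subsingleton _) (fun x => by
      simp [Subsingleton.elim x 0])
  have := mk_eq_add hS X.2 X.2 X.2
  exact (left_eq_add.1 this : _)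

/-- An additive function on finitely generated modules induces a homomorphism on the Grothendieck
group. -/
def lift {B : Type*} [AddCommGroup B] (φ : FinMod A → B)
    (hφ : ∀ (S : ShortComplex (ModuleCat.{u} A)) (h₁ : Module.Finite A S.X₁)
      (h₂ : Module.Finite A S.X₂) (h₃ : Module.Finite A S.X₃), S.ShortExact →
      φ ⟨S.X₂, h₂⟩ = φ ⟨S.X₁, h₁⟩ + φ ⟨S.X₃, h₃⟩) : K0 A →+ B :=
  QuotientAddGroup.lift (grothendieckRel A) (FreeAbelianGroup.lift φ) (by
    rw [grothendieckRel, AddSubgroup.closure_le]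
    rintro _ ⟨S, h₁, h₂, h₃, hS, rfl⟩
    simp [hφ S h₁ h₂ h₃ hS])

@[simp] theorem lift_mk {B : Type*} [AddCommGroup B] (φ : FinMod A → B) (hφ) (X : FinMod A) :
    lift φ hφ (K0.mk X) = φ X :=
  FreeAbelianGroup.lift_apply_of _ _

theorem induction {p : K0 A → Prop} (mk : ∀ X, p (K0.mk X)) (zero : p 0)
    (add : ∀ a b, p a → p b → p (a + b)) (neg : ∀ a, p a → p (-a)) (a : K0 A) : p a := by
  obtain ⟨a, rfl⟩ := QuotientAddGroup.mk_surjective a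
  induction a using FreeAbelianGroup.induction_on with
  | zero => exact zero
  | of x => exact mk x
  | neg x h => exact neg _ h
  | add x y hx hy => exact add _ _ hx hy

end K0

namespace TriangularIdempotents

/-- Membership of the class in a subgroup is inherited by extensions and by cokernels of injections,
so the induction principle applies. -/
theorem span_projMod {A : Type u} [Ring A] {ι : Type} [Fintype ι]
    (T : TriangularIdempotents A ι) [IsNoetherianRing A] :
    ⊤ ≤ Submodule.span ℤ (Set.range fun x => K0.mk (T.projMod x)) := by
  rintro a -
  induction a using K0.induction with
  | zero => exact zero_mem _
  | add a b ha hb => exact add_mem ha hb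
  | neg a ha => exact neg_mem ha
  | mk X =>
    refine T.induction (fun X => ∀ h : Module.Finite A X, K0.mk ⟨X, h⟩ ∈
      Submodule.span ℤ (Set.range fun x => K0.mk (T.projMod x))) ?_ ?_ ?_ ?_ X X.2
    · exact fun x _ => Submodule.subset_span ⟨x, rfl⟩
    · intro X hX h
      rw [K0.mk_eq_zero _ hX]
      exact zero_mem _
    · intro S hS h₂ hX₁ hX₃ _
      have h₁ := Module.Finite.of_injective S.f.hom hS.moduleCat_injective_f
      have h₃ := Module.Finite.of_surjective S.g.hom hS.moduleCat_surjective_g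
      rw [K0.mk_eq_add hS h₁ h₂ h₃]
      exact add_mem (hX₁ _) (hX₃ _)
    · intro S hS h₂ hX₁ hX₂ h₃
      have h₁ := Module.Finite.of_injective S.f.hom hS.moduleCat_injective_f
      rw [← add_sub_cancel_left (K0.mk ⟨S.X₁, h₁⟩) (K0.mk ⟨S.X₃, h₃⟩), ← K0.mk_eq_add hS h₁ h₂ h₃]
      exact sub_mem (hX₂ _) (hX₁ _)

/-! ### The Euler form in the basis of projectives -/

section Algebra

variable (k : Type u) {A : Type u} [Field k] [Ring A] [Algebra k A] {ι : Type} [Fintype ι]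
  (T : TriangularIdempotents A ι)

/-- The space `e X`. -/
def peirce (x : ι) (X : Type*) [AddCommGroup X] [Module A X] [Module k X] [IsScalarTower k A X] :
    Submodule k X where
  carrier := {v | T.e x • v = v}
  add_mem' {v w} hv hw := by
    rw [Set.mem_ofPred_eq] at *
    rw [smul_add, hv, hw]
  zero_mem' := smul_zero _
  smul_mem' c v hv := by
    rw [Set.mem_ofPred_eq] at *
    rw [smul_comm, hv]

section

variable {X : Type*} [AddCommGroup X] [Module A X] [Module k X] [IsScalarTower k A X]

theorem mem_peirce {x : ι} {v : X} : v ∈ T.peirce k x X ↔ T.e x • v = v := Iff.rfl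

theorem smul_mem_peirce (x : ι) (v : X) : T.e x • v ∈ T.peirce k x X := by
  rw [mem_peirce, ← mul_smul, e_mul_e]

/-- `Hom_A(Ae, X) = eX`. -/
def homProjEquiv (x : ι) : (T.proj x →ₗ[A] X) ≃ₗ[k] T.peirce k x X where
  toFun f := ⟨f ⟨T.e x, T.e_mem_proj x⟩, by
    rw [mem_peirce, ← map_smul]
    exact congrArg f (Subtype.ext (T.e_mul_e x))⟩
  map_add' f g := rfl
  map_smul' c f := rfl
  invFun v := (LinearMap.toSpanSingleton A X v.1) ∘ₗ (T.proj x).subtype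
  left_inv f := by
    ext a
    change (a : A) • f _ = f a
    rw [← map_smul]
    exact congrArg f (Subtype.ext a.2)
  right_inv v := Subtype.ext v.2

end

open CategoryTheory CategoryTheory.Abelian
open scoped ModuleCat

theorem finite_restrictScalars [Module.Finite k A] (X : FinMod A) : Module.Finite k X.1 :=
  have := X.2
  Module.Finite.trans A X.1

/-- The space `e_x A e_y`. -/
def peirce₂ (x y : ι) : Submodule k A where
  carrier := {a | T.e x * a * T.e y = a}
  add_mem' {v w} hv hw := by
    rw [Set.mem_ofPred_eq] at *
    rw [mul_add, add_mul, hv, hw]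
  zero_mem' := by simp
  smul_mem' c v hv := by
    rw [Set.mem_ofPred_eq] at *
    rw [mul_smul_comm, smul_mul_assoc, hv]

theorem mem_peirce₂ {x y : ι} {a : A} : a ∈ T.peirce₂ k x y ↔ T.e x * a * T.e y = a := Iff.rfl

theorem finrank_ext_projMod_zero (x : ι) (Y : ModuleCat.{u} A) :
    Module.finrank k (Ext (T.projMod x).1 Y 0) = Module.finrank k (T.peirce k x Y) :=
  ((Ext.linearEquiv₀ (R := k)).trans ((ModuleCat.homLinearEquiv (S := k)).trans
    (T.homProjEquiv k x (X := Y)))).finrank_eq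

variable [Module.Finite k A]

/-- The additive function `[X] ↦ dim eX`. -/
def dimHom (x : ι) : K0 A →+ ℤ :=
  K0.lift (fun X => Module.finrank k (T.peirce k x X.1)) (by
    intro S h₁ h₂ h₃ hS
    have : Module.Finite k S.X₂ := finite_restrictScalars k ⟨S.X₂, h₂⟩
    let f : T.peirce k x S.X₁ →ₗ[k] T.peirce k x S.X₂ :=
      (S.f.hom.restrictScalars k).restrict fun v (hv : _ = _) => by
        change _ = _
        rw [LinearMap.coe_restrictScalars, ← map_smul, hv]
    let g : T.peirce k x S.X₂ →ₗ[k] T.peirce k x S.X₃ :=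
      (S.g.hom.restrictScalars k).restrict fun v (hv : _ = _) => by
        change _ = _
        rw [LinearMap.coe_restrictScalars, ← map_smul, hv]
    have hf : Function.Injective f := fun v w h =>
      Subtype.ext (hS.moduleCat_injective_f (congrArg Subtype.val h))
    have hg : Function.Surjective g := by
      rintro ⟨v, hv⟩
      obtain ⟨w, rfl⟩ := hS.moduleCat_surjective_g v
      refine ⟨⟨T.e x • w, T.smul_mem_peirce k x w⟩, Subtype.ext ?_⟩
      exact (map_smul S.g.hom _ _).trans hv
    have hfg : Function.Exact f g := by
      rintro ⟨v, hv⟩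
      have key := (ShortComplex.ShortExact.moduleCat_exact_iff_function_exact S).1 hS.exact v
      rw [← Subtype.coe_inj]
      refine key.trans ⟨?_, ?_⟩
      · rintro ⟨w, rfl⟩
        refine ⟨⟨w, ?_⟩, rfl⟩
        refine hS.moduleCat_injective_f ?_
        exact (map_smul S.f.hom _ _).trans hv
      · rintro ⟨w, hw⟩
        exact ⟨w.1, congrArg Subtype.val hw⟩
    rw [finrank_of_exact k hfg, LinearMap.finrank_range_of_inj hf,
      LinearMap.range_eq_top.2 hg, finrank_top]
    push_cast
    rfl)

@[simp] theorem dimHom_mk (x : ι) (X : FinMod A) :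
    T.dimHom k x (K0.mk X) = Module.finrank k (T.peirce k x X.1) := K0.lift_mk _ _ _

theorem dimHom_projMod (x y : ι) :
    T.dimHom k x (K0.mk (T.projMod y)) = Module.finrank k (T.peirce₂ k x y) := by
  rw [dimHom_mk]
  congr 1
  have hleft (a : A) (ha : T.e x * a * T.e y = a) : a * T.e y = a := by
    conv_lhs => rw [← ha, mul_assoc, e_mul_e, ha]
  have hright (a : A) (ha : T.e x * a * T.e y = a) : T.e x * a = a := by
    conv_lhs => rw [← ha, ← mul_assoc, ← mul_assoc, e_mul_e, ha]
  exact LinearEquiv.finrank_eq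
    { toFun v := ⟨v.1.1, by
        rw [mem_peirce₂, mul_assoc, show v.1.1 * T.e y = v.1.1 from v.1.2]
        exact congrArg Subtype.val v.2⟩
      map_add' v w := rfl
      map_smul' c v := Subtype.ext (Algebra.smul_def c v.1.1).symm
      invFun a := ⟨⟨a.1, hleft a.1 a.2⟩, Subtype.ext (hright a.1 a.2)⟩
      left_inv v := rfl
      right_inv a := rfl }

theorem finrank_peirce₂_eq_zero {x y : ι} (hxy : x ≠ y) (h : T.h y ≤ T.h x) :
    Module.finrank k (T.peirce₂ k x y) = 0 := by
  rw [Submodule.finrank_eq_zero, Submodule.eq_bot_iff]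
  intro a ha
  rw [← (T.mem_peirce₂ k).1 ha]
  exact T.eq_zero_of_mem_support_lt hxy h a

theorem finrank_peirce₂_self_ne_zero (x : ι) : Module.finrank k (T.peirce₂ k x x) ≠ 0 := by
  rw [Ne, Submodule.finrank_eq_zero, Submodule.eq_bot_iff]
  intro h
  exact T.ne_zero x (h _ (by rw [mem_peirce₂, e_mul_e, e_mul_e]))

/-- Triangularity: at a vertex x of maximal height among the non-zero coefficients, the function dim
e_x X vanishes on all other projectives that occur but not on Ae_x. -/
theorem linearIndependent_projMod (k : Type u) {A : Type u} [Field k] [Ring A] [Algebra k A]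
    {ι : Type} [Fintype ι] (T : TriangularIdempotents A ι) [Module.Finite k A] :
    LinearIndependent ℤ fun x => K0.mk (T.projMod x) := by
  rw [Fintype.linearIndependent_iff]
  intro c hc
  by_contra! hne
  obtain ⟨x, hx, hmax⟩ := Finset.exists_max_image (Finset.univ.filter fun x => c x ≠ 0) T.h
    (by simpa [Finset.Nonempty] using hne)
  have h0 := congrArg (T.dimHom k x) hc
  simp only [map_sum, map_zsmul, dimHom_projMod, map_zero, smul_eq_mul] at h0
  rw [Finset.sum_eq_single x] at h0
  · refine mul_ne_zero (Finset.mem_filter.1 hx).2 ?_ h0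
    exact_mod_cast T.finrank_peirce₂_self_ne_zero k x
  · intro y _ hyx
    by_cases hy : c y = 0
    · rw [hy, zero_mul]
    · rw [T.finrank_peirce₂_eq_zero k hyx.symm (hmax y (by simp [hy])), Nat.cast_zero, mul_zero]
  · simp

/-- The basis of the Grothendieck group that consists of the classes of the modules `A e`. -/
def basis : Module.Basis ι ℤ (K0 A) :=
  Module.Basis.mk (T.linearIndependent_projMod k)
    (have := IsNoetherianRing.of_finite k A; T.span_projMod)

theorem basis_apply (x : ι) : T.basis k x = K0.mk (T.projMod x) := Module.Basis.mk_apply _ _ _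

/-- The Euler form. -/
def eulerForm : LinearMap.BilinForm ℤ (K0 A) :=
  (T.basis k).constr ℤ fun x => (T.dimHom k x).toIntLinearMap

theorem eulerForm_basis_apply (x : ι) (a : K0 A) :
    T.eulerForm k (T.basis k x) a = T.dimHom k x a := by
  rw [eulerForm, Module.Basis.constr_basis]
  rfl

theorem eulerForm_basis_basis (x y : ι) :
    T.eulerForm k (T.basis k x) (T.basis k y) = Module.finrank k (T.peirce₂ k x y) := by
  rw [eulerForm_basis_apply, basis_apply, dimHom_projMod]

/-- The form is defined by its values dim e_x Y on the projectives, where it is the Euler form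
because only Hom contributes. Agreement spreads to all X by the induction principle. It is stated
for all large truncation degrees n, together with the vanishing of Ext^n, so that the error term of
`eulerSum_add` disappears. -/
theorem isEulerForm_aux (X Y : FinMod A) :
    (∀ n, Module.Finite k (Ext X.1 Y.1 n)) ∧ ∀ᶠ n in Filter.atTop, Subsingleton (Ext X.1 Y.1 n) ∧
      T.eulerForm k (K0.mk X) (K0.mk Y) = eulerSum k X.1 Y.1 n := by
  have : IsNoetherianRing A := IsNoetherianRing.of_finite k A
  have := finite_restrictScalars k Y
  have key := T.induction (fun X => (∀ n, Module.Finite k (Ext X Y.1 n)) ∧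
    ∀ h : Module.Finite A X, ∀ᶠ n in Filter.atTop, Subsingleton (Ext X Y.1 n) ∧
      T.eulerForm k (K0.mk ⟨X, h⟩) (K0.mk Y) = eulerSum k X Y.1 n) ?_ ?_ ?_ ?_ X
  · exact ⟨key.1, key.2 X.2⟩
  · intro x
    have hsub (n : ℕ) (hn : 1 ≤ n) : Subsingleton (Ext (T.projMod x).1 Y.1 n) :=
      HasProjectiveDimensionLT.subsingleton _ 1 n hn _
    refine ⟨fun n => ?_, fun h => ?_⟩
    · cases n with
      | zero =>
        exact Module.Finite.equiv ((Ext.linearEquiv₀ (R := k)).trans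
          ((ModuleCat.homLinearEquiv (S := k)).trans (T.homProjEquiv k x (X := Y.1)))).symm
      | succ n =>
        have := hsub (n + 1) (by omega)
        infer_instance
    · filter_upwards [Filter.eventually_ge_atTop 1] with n hn
      refine ⟨hsub n hn, ?_⟩
      change T.eulerForm k (K0.mk (T.projMod x)) _ = _
      rw [← T.basis_apply k, eulerForm_basis_apply, dimHom_mk, eulerSum, Finset.sum_eq_single 0]
      · rw [finrank_ext_projMod_zero]
        simp
      · intro m _ hm
        have := hsub m (by omega)
        rw [Module.finrank_zero_of_subsingleton, Nat.cast_zero, mul_zero]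
      · simp
  · intro X hX
    have hz : Limits.IsZero X := ModuleCat.isZero_of_subsingleton X
    have := hz.hasProjectiveDimensionLT_zero
    have hsub (n : ℕ) : Subsingleton (Ext X Y.1 n) :=
      HasProjectiveDimensionLT.subsingleton _ 0 n (Nat.zero_le n) _
    refine ⟨fun n => inferInstance, fun h => Filter.Eventually.of_forall fun n => ⟨hsub n, ?_⟩⟩
    rw [K0.mk_eq_zero _ hX]
    rw [map_zero, LinearMap.zero_apply, eulerSum, Finset.sum_eq_zero]
    intro m _
    have := hsub m
    rw [Module.finrank_zero_of_subsingleton, Nat.cast_zero, mul_zero]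
  · rintro S hS h₂ ⟨f₁, hX₁⟩ ⟨f₃, hX₃⟩
    have h₁ := Module.Finite.of_injective S.f.hom hS.moduleCat_injective_f
    have h₃ := Module.Finite.of_surjective S.g.hom hS.moduleCat_surjective_g
    have f₂ (n : ℕ) := ext_finite_X₂ k hS Y.1 n
    refine ⟨f₂, fun _ => ?_⟩
    filter_upwards [hX₁ h₁, hX₃ h₃] with n ⟨s₁, b₁⟩ ⟨s₃, b₃⟩
    refine ⟨subsingleton_of_exact k (ext_exact₂ k hS Y.1 n), ?_⟩
    have := eulerSum_add k hS Y.1 f₁ f₂ f₃ n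
    rw [finrank_range_eq_zero_of_subsingleton k, Nat.cast_zero, mul_zero] at this
    rw [K0.mk_eq_add hS h₁ h₂ h₃, map_add, LinearMap.add_apply, b₁, b₃]
    linarith
  · rintro S hS h₂ ⟨f₁, hX₁⟩ ⟨f₂, hX₂⟩
    have h₁ := Module.Finite.of_injective S.f.hom hS.moduleCat_injective_f
    have f₃ (n : ℕ) := ext_finite_X₃ k hS Y.1 n f₁ f₂
    refine ⟨f₃, fun h₃ => ?_⟩
    -- Ext^n(X₃, Y) sits between Ext^(n-1)(X₁, Y) and Ext^n(X₂, Y), so the vanishing for X₁ is also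
    -- needed one degree lower.
    filter_upwards [Filter.eventually_ge_atTop 1, hX₁ h₁, hX₂ h₂,
      (Filter.tendsto_sub_atTop_nat 1).eventually (hX₁ h₁)] with n hn ⟨s₁, b₁⟩ ⟨s₂, b₂⟩ ⟨s₁', _⟩
    refine ⟨?_, ?_⟩
    · obtain ⟨m, rfl⟩ := Nat.exists_eq_add_of_le' hn
      rw [Nat.add_sub_cancel] at s₁'
      exact subsingleton_of_exact k (ext_exact₃ k hS Y.1 m)
    · have := eulerSum_add k hS Y.1 f₁ f₂ f₃ n
      rw [finrank_range_eq_zero_of_subsingleton k, Nat.cast_zero, mul_zero] at this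
      rw [K0.mk_eq_add hS h₁ h₂ h₃, map_add, LinearMap.add_apply, b₁] at b₂
      linarith

theorem isEulerForm : IsEulerForm k (T.eulerForm k) := by
  intro X Y
  obtain ⟨h₁, h₂⟩ := T.isEulerForm_aux k X Y
  obtain ⟨N, hN⟩ := Filter.eventually_atTop.1 h₂
  -- `eulerSum` at N has the N + 1 terms of degrees 0, …, N.
  exact ⟨h₁, N + 1, fun n hn => (hN n (by omega)).1, (hN N le_rfl).2⟩

end Algebra

end TriangularIdempotents

/-! ### Canonical bilinear lattices -/

namespace CanonicalSymbol

variable {t : ℕ} (σ : CanonicalSymbol t)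

/-- The index type of the canonical basis as a sum type. -/
def indexEquiv : σ.Index ≃ Unit ⊕ Unit ⊕ (Σ i, Fin (σ.p i - 1)) where
  toFun
    | .a => .inl ()
    | .w => .inr (.inl ())
    | .s i j => .inr (.inr ⟨i, j⟩)
  invFun
    | .inl _ => .a
    | .inr (.inl _) => .w
    | .inr (.inr x) => .s x.1 x.2
  left_inv x := by cases x <;> rfl
  right_inv x := by rcases x with x | x | x <;> rfl

instance : Fintype σ.Index := Fintype.ofEquiv _ σ.indexEquiv.symm

theorem form_single (x y : σ.Index) (b c : ℤ) :
    σ.form (Finsupp.single x b) (Finsupp.single y c) = b * (c * σ.gram x y) := by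
  simp [form]

/-- The coefficient of `s i j`, and zero if there is no such basis element. -/
def coord (v : σ.Index → ℤ) (i : Fin t) (j : ℕ) : ℤ :=
  if h : j < σ.p i - 1 then v (.s i ⟨j, h⟩) else 0

/-- The value of the form on `s i j`. -/
def norm (i : Fin t) : ℤ := σ.κ * σ.ε * σ.f i / σ.e i

theorem coord_val (v : σ.Index → ℤ) (i : Fin t) (j : Fin (σ.p i - 1)) :
    σ.coord v i j = v (.s i j) := dif_pos j.2

theorem coord_eq_zero (v : σ.Index → ℤ) (i : Fin t) {j : ℕ} (h : σ.p i - 1 ≤ j) :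
    σ.coord v i j = 0 := dif_neg (by omega)

theorem coord_zero (i : Fin t) (j : ℕ) : σ.coord 0 i j = 0 := by
  simp [coord]

theorem coord_add (v w : σ.Index → ℤ) (i : Fin t) (j : ℕ) :
    σ.coord (v + w) i j = σ.coord v i j + σ.coord w i j := by
  unfold coord
  split_ifs <;> simp

theorem coord_single_a (i : Fin t) (n : ℕ) (c : ℤ) :
    σ.coord (Finsupp.single .a c : σ.Index →₀ ℤ) i n = 0 := by
  unfold coord
  split_ifs <;> simp

theorem coord_single_w (i : Fin t) (n : ℕ) (c : ℤ) :
    σ.coord (Finsupp.single .w c : σ.Index →₀ ℤ) i n = 0 := by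
  unfold coord
  split_ifs <;> simp

theorem coord_single_s (i i' : Fin t) (j : Fin (σ.p i - 1)) (n : ℕ) (c : ℤ) :
    σ.coord (Finsupp.single (.s i j) c : σ.Index →₀ ℤ) i' n =
      if i = i' then if (j : ℕ) = n then c else 0 else 0 := by
  unfold coord
  by_cases hi : i = i'
  · subst hi
    rw [if_pos rfl]
    split_ifs with h₁ h₂ h₂
    · subst h₂
      exact Finsupp.single_eq_same
    · refine Finsupp.single_eq_of_ne fun h => h₂ ?_
      injection h with h h'
      rw [← h']
    · exact absurd (h₂ ▸ j.2) h₁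
    · rfl
  · simp [hi]

theorem form_apply_w (v : σ.Index →₀ ℤ) : σ.form v (.single .w 1) = σ.κ * σ.ε * v .a := by
  induction v using Finsupp.induction_linear with
  | zero => simp
  | add v w hv hw =>
    rw [map_add, LinearMap.add_apply, hv, hw, Finsupp.add_apply]
    ring
  | single x c =>
    rw [form_single]
    rcases x with _ | _ | ⟨i, j⟩ <;> simp [gram, mul_comm]

theorem form_apply_a (v : σ.Index →₀ ℤ) :
    σ.form v (.single .a 1) = σ.κ * v .a - σ.κ * σ.ε * v .w := by
  induction v using Finsupp.induction_linear with
  | zero => simp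
  | add v w hv hw =>
    rw [map_add, LinearMap.add_apply, hv, hw, Finsupp.add_apply, Finsupp.add_apply]
    ring
  | single x c =>
    rw [form_single]
    rcases x with _ | _ | ⟨i, j⟩ <;> simp [gram, mul_comm]

theorem form_w_apply (v : σ.Index →₀ ℤ) : σ.form (.single .w 1) v = -(σ.κ * σ.ε * v .a) := by
  induction v using Finsupp.induction_linear with
  | zero => simp
  | add v w hv hw =>
    rw [map_add, hv, hw, Finsupp.add_apply]
    ring
  | single x c =>
    rw [form_single]
    rcases x with _ | _ | ⟨i, j⟩ <;> simp [gram, mul_comm]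

theorem form_a_apply (v : σ.Index →₀ ℤ) : σ.form (.single .a 1) v =
    σ.κ * v .a + σ.κ * σ.ε * v .w + ∑ i, σ.κ * σ.ε * σ.f i * σ.coord v i 0 := by
  induction v using Finsupp.induction_linear with
  | zero => simp [coord_zero]
  | add v w hv hw =>
    simp only [map_add, hv, hw, Finsupp.add_apply, Finsupp.coe_add, coord_add, mul_add,
      Finset.sum_add_distrib]
    ring
  | single x c =>
    rw [form_single]
    rcases x with _ | _ | ⟨i, j⟩
    · simp [gram, mul_comm, coord_single_a]
    · simp [gram, mul_comm, coord_single_w]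
    · simp [gram, mul_comm, coord_single_s]

theorem form_s_apply (i : Fin t) (j : Fin (σ.p i - 1)) (v : σ.Index →₀ ℤ) :
    σ.form (.single (.s i j) 1) v = σ.norm i * (σ.coord v i j - σ.coord v i (j + 1)) := by
  induction v using Finsupp.induction_linear with
  | zero => simp [coord_zero]
  | add v w hv hw =>
    simp only [map_add, hv, hw, Finsupp.coe_add, coord_add]
    ring
  | single x c =>
    rw [form_single]
    rcases x with _ | _ | ⟨i', j'⟩
    · simp [gram, coord_single_a]
    · simp [gram, coord_single_w]
    · rw [coord_single_s, coord_single_s, gram]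
      simp only [eq_comm (a := i'), eq_comm (a := (j' : ℕ))]
      change 1 * (c * (if i = i' then if (j : ℕ) = j' then σ.norm i else
        if (j : ℕ) + 1 = j' then -σ.norm i else 0 else 0)) = _
      split_ifs <;> first | omega | ring

theorem form_apply_s (i : Fin t) (j : Fin (σ.p i - 1)) (v : σ.Index →₀ ℤ) :
    σ.form v (.single (.s i j) 1) = (if (j : ℕ) = 0 then σ.κ * σ.ε * σ.f i * v .a else 0) +
      σ.norm i * (v (.s i j) - if (j : ℕ) = 0 then 0 else σ.coord v i (j - 1)) := by
  induction v using Finsupp.induction_linear with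
  | zero => simp [coord_zero]
  | add v w hv hw =>
    simp only [map_add, LinearMap.add_apply, hv, hw, Finsupp.coe_add, coord_add, Pi.add_apply]
    split_ifs <;> ring
  | single x c =>
    rw [form_single]
    rcases x with _ | _ | ⟨i', j'⟩
    · simp [gram, coord_single_a, mul_comm]
    · simp [gram, coord_single_w]
    · rw [coord_single_s, gram, ← σ.coord_val (Finsupp.single (.s i' j') c : σ.Index →₀ ℤ) i j,
        coord_single_s, Finsupp.single_eq_of_ne (by simp), mul_zero, ite_self, zero_add]
      change c * (1 * (if i' = i then if (j' : ℕ) = j then σ.norm i' else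
        if (j' : ℕ) + 1 = j then -σ.norm i' else 0 else 0)) = _
      by_cases hi : i' = i
      · subst hi
        simp only [if_true]
        split_ifs <;> first | omega | ring
      · simp [hi]

/-- The coefficient of `w` in `τ a - a`. -/
def coxeterCoeff : ℤ := ∑ i, (σ.e i * σ.f i : ℤ) - 2 / σ.ε

/-- The Coxeter transformation in coordinates. -/
def coxeterFun (v : σ.Index → ℤ) : σ.Index → ℤ
  | .a => v .a
  | .w => v .w + σ.coxeterCoeff * v .a + ∑ i, σ.f i * σ.coord v i (σ.p i - 2)
  | .s i j => (if (j : ℕ) = 0 then -(σ.e i * v .a) else σ.coord v i (j - 1)) -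
      σ.coord v i (σ.p i - 2)

/-- The inverse of the Coxeter transformation in coordinates. -/
def coxeterInv (v : σ.Index → ℤ) : σ.Index → ℤ
  | .a => v .a
  | .w => v .w - σ.coxeterCoeff * v .a + ∑ i, σ.f i * (σ.e i * v .a + σ.coord v i 0)
  | .s i j => σ.coord v i (j + 1) - (σ.e i * v .a + σ.coord v i 0)

variable {σ}

theorem coord_coxeterFun_zero (hp : ∀ i, 2 ≤ σ.p i) (v : σ.Index → ℤ) (i : Fin t) :
    σ.coord (σ.coxeterFun v) i 0 = -(σ.e i * v .a) - σ.coord v i (σ.p i - 2) := by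
  have := hp i
  rw [coord, dif_pos (by omega)]
  rfl

theorem coord_coxeterFun_succ (v : σ.Index → ℤ) (i : Fin t) {j : ℕ} (h : j + 1 < σ.p i - 1) :
    σ.coord (σ.coxeterFun v) i (j + 1) = σ.coord v i j - σ.coord v i (σ.p i - 2) := by
  rw [coord, dif_pos h]
  rfl

theorem coord_coxeterInv (v : σ.Index → ℤ) (i : Fin t) {j : ℕ} (h : j < σ.p i - 1) :
    σ.coord (σ.coxeterInv v) i j =
      σ.coord v i (j + 1) - (σ.e i * v .a + σ.coord v i 0) := by
  rw [coord, dif_pos h]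
  rfl

/-- The Coxeter transformation. -/
def coxeter (hp : ∀ i, 2 ≤ σ.p i) : (σ.Index →₀ ℤ) ≃+ (σ.Index →₀ ℤ) where
  toFun v := Finsupp.equivFunOnFinite.symm (σ.coxeterFun v)
  invFun v := Finsupp.equivFunOnFinite.symm (σ.coxeterInv v)
  left_inv v := by
    ext (_ | _ | ⟨i, j⟩)
    · rfl
    · simp only [Finsupp.coe_equivFunOnFinite_symm, coxeterInv, coord_coxeterFun_zero hp]
      simp only [coxeterFun]
      rw [add_sub_right_comm, add_sub_cancel_right, add_assoc, ← Finset.sum_add_distrib,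
        Finset.sum_eq_zero, add_zero]
      intro i _
      ring
    · simp only [Finsupp.coe_equivFunOnFinite_symm, coxeterInv, coord_coxeterFun_zero hp]
      by_cases h : (j : ℕ) + 1 < σ.p i - 1
      · rw [coord_coxeterFun_succ _ _ h, coord_val]
        simp only [coxeterFun]
        ring
      · rw [coord_eq_zero _ _ _ (by omega), ← σ.coord_val v i j]
        have : σ.p i - 2 = j := by omega
        rw [this]
        simp [coxeterFun]
  right_inv v := by
    ext (_ | _ | ⟨i, j⟩)
    · rfl
    · simp only [Finsupp.coe_equivFunOnFinite_symm, coxeterFun]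
      -- At the last index the shifted coordinate has index p i - 1, which is out of range and
      -- counts as zero.
      have h (i : Fin t) : σ.coord (σ.coxeterInv v) i (σ.p i - 2) =
          - (σ.e i * v .a + σ.coord v i 0) := by
        have := hp i
        rw [coord_coxeterInv _ _ (by omega), coord_eq_zero _ _ _ (by omega), zero_sub]
      simp only [h, coxeterInv]
      rw [add_right_comm (v .w - _), sub_add_cancel, add_assoc, ← Finset.sum_add_distrib,
        Finset.sum_eq_zero, add_zero]
      intro i _
      ring
    · simp only [Finsupp.coe_equivFunOnFinite_symm, coxeterFun]
      have hj := j.2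
      have := hp i
      rw [coord_coxeterInv v i (j := σ.p i - 2) (by omega),
        coord_eq_zero σ v i (j := σ.p i - 2 + 1) (by omega), ← σ.coord_val v i j]
      split_ifs with h0
      · rw [h0]
        simp [coxeterInv]
      · rw [coord_coxeterInv _ _ (by omega), Nat.sub_add_cancel (by omega)]
        ring
  map_add' v w := by
    ext (_ | _ | ⟨i, j⟩)
    · rfl
    · simp only [Finsupp.coe_equivFunOnFinite_symm, Finsupp.coe_add, Pi.add_apply, coxeterFun,
        coord_add, mul_add, Finset.sum_add_distrib]
      ring
    · simp only [Finsupp.coe_equivFunOnFinite_symm, Finsupp.coe_add, Pi.add_apply, coxeterFun,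
        coord_add, mul_add]
      split_ifs <;> ring

/-- By definition κ is a multiple of e_i / gcd(e_i, εf_i), and εf_i is a multiple of the gcd. This
makes the integer division in `norm` exact. -/
theorem dvd_kappa_mul (i : Fin t) : σ.e i ∣ σ.κ * σ.ε * σ.f i := by
  have h : σ.e i / Nat.gcd (σ.e i) (σ.ε * σ.f i) ∣ σ.κ := Finset.dvd_lcm (Finset.mem_univ i)
  have := mul_dvd_mul h (Nat.gcd_dvd_right (σ.e i) (σ.ε * σ.f i))
  rwa [Nat.div_mul_cancel (Nat.gcd_dvd_left _ _), ← mul_assoc] at this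

theorem norm_mul (i : Fin t) :
    σ.norm i * σ.e i = σ.κ * σ.ε * σ.f i := by
  apply Int.ediv_mul_cancel
  exact_mod_cast dvd_kappa_mul i

theorem kappa_pos (he : ∀ i, 0 < σ.e i) : 0 < σ.κ := by
  rw [Nat.pos_iff_ne_zero, κ, Ne, Finset.lcm_eq_zero_iff]
  rintro ⟨i, _, hi⟩
  refine absurd hi ?_
  exact (Nat.div_pos (Nat.le_of_dvd (he i) (Nat.gcd_dvd_left _ _))
    (Nat.gcd_pos_of_pos_left _ (he i))).ne'

/-- The map τ fixes w, sends s_i^(j) to s_i^(j+1), and closes the cycle by sending the last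
s_i^(p_i-2) to f_i w minus the sum of all s_i^(j). By linearity the identity is checked with x a
basis element. -/
theorem form_coxeter (hp : ∀ i, 2 ≤ σ.p i) (hε : σ.ε = 1 ∨ σ.ε = 2)
    (x y : σ.Index →₀ ℤ) : σ.form y x = -σ.form x (coxeter hp y) := by
  have hc : ⇑(coxeter hp y) = σ.coxeterFun y := rfl
  -- The integer quotient in `coxeterCoeff` is exact because ε divides 2.
  have h2 : (σ.ε : ℤ) * (2 / σ.ε) = 2 := by
    rcases hε with h | h <;> rw [h] <;> rfl
  induction x using Finsupp.induction_linear with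
  | zero => simp
  | add v w hv hw => rw [map_add, map_add, LinearMap.add_apply, hv, hw, neg_add]
  | single x c =>
    rw [← mul_one c, ← smul_eq_mul, ← Finsupp.smul_single, map_smul, map_smul,
      LinearMap.smul_apply, ← smul_neg]
    congr 1
    rcases x with _ | _ | ⟨i, j⟩
    · rw [form_apply_a, form_a_apply, hc]
      simp only [coord_coxeterFun_zero hp]
      simp only [coxeterFun, coxeterCoeff, mul_sub, Finset.sum_sub_distrib, mul_add, sub_mul,
        Finset.sum_mul, Finset.mul_sum]
      have e₁ : ∑ i, (σ.κ * σ.ε * (σ.e i * σ.f i * y .a) : ℤ) =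
          -∑ i, σ.κ * σ.ε * σ.f i * -(σ.e i * y .a) := by
        rw [← Finset.sum_neg_distrib]
        exact Finset.sum_congr rfl fun i _ => by ring
      have e₂ : ∑ i, (σ.κ * σ.ε * (σ.f i * σ.coord y i (σ.p i - 2)) : ℤ) =
          ∑ i, σ.κ * σ.ε * σ.f i * σ.coord y i (σ.p i - 2) :=
        Finset.sum_congr rfl fun i _ => by ring
      rw [e₁, e₂]
      linear_combination -(σ.κ * y .a) * h2
    · rw [form_apply_w, form_w_apply, hc]
      simp [coxeterFun]
    · rw [form_apply_s, form_s_apply, hc]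
      have hj := j.2
      have hn := norm_mul (σ := σ) i
      have e₂ : σ.coord (σ.coxeterFun y) i (j + 1) =
          y (.s i j) - σ.coord y i (σ.p i - 2) := by
        by_cases h : (j : ℕ) + 1 < σ.p i - 1
        · rw [coord_coxeterFun_succ _ _ h, coord_val]
        · rw [coord_eq_zero _ _ _ (by omega), ← σ.coord_val y i j]
          have : σ.p i - 2 = j := by omega
          rw [this, sub_self]
      rw [e₂, coord_val, coxeterFun]
      split_ifs
      · linear_combination -(y .a) * hn
      · ring

/-- The equations are triangular: pairing with w isolates the coefficient of a, pairing with a then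
isolates that of w, and pairing with s_i^(0), s_i^(1), … yields the remaining coefficients one after
another. -/
theorem separatingLeft (he : ∀ i, 0 < σ.e i) (hf : ∀ i, 0 < σ.f i)
    (hε : 0 < σ.ε) {v : σ.Index →₀ ℤ} (h : ∀ w, σ.form v w = 0) : v = 0 := by
  have hκ : (σ.κ : ℤ) ≠ 0 := by exact_mod_cast (kappa_pos he).ne'
  have hε' : (σ.ε : ℤ) ≠ 0 := by exact_mod_cast hε.ne'
  have ha : v .a = 0 := by
    have := h (.single .w 1)
    rw [form_apply_w] at this
    exact (mul_eq_zero.1 this).resolve_left (mul_ne_zero hκ hε')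
  have hw : v .w = 0 := by
    have := h (.single .a 1)
    rw [form_apply_a, ha, mul_zero, zero_sub, neg_eq_zero] at this
    exact (mul_eq_zero.1 this).resolve_left (mul_ne_zero hκ hε')
  have hs (i : Fin t) (n : ℕ) : σ.coord v i n = 0 := by
    have hnorm : σ.norm i ≠ 0 := by
      intro h0
      have hn := norm_mul (σ := σ) i
      rw [h0, zero_mul, eq_comm] at hn
      exact mul_ne_zero (mul_ne_zero hκ hε') (by exact_mod_cast (hf i).ne') hn
    induction n with
    | zero =>
      by_cases h0 : 0 < σ.p i - 1
      · have := h (.single (.s i ⟨0, h0⟩) 1)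
        rw [form_apply_s, ha, ← σ.coord_val v] at this
        simpa [hnorm] using this
      · exact coord_eq_zero _ _ _ (by omega)
    | succ n ih =>
      by_cases h0 : n + 1 < σ.p i - 1
      · have := h (.single (.s i ⟨n + 1, h0⟩) 1)
        rw [form_apply_s, ha, ← σ.coord_val v] at this
        simpa [hnorm, ih] using this
      · exact coord_eq_zero _ _ _ (by omega)
  ext (_ | _ | ⟨i, j⟩)
  · exact ha
  · exact hw
  · rw [← σ.coord_val v]
    exact hs i j

theorem isBilinearLattice_form (hp : ∀ i, 2 ≤ σ.p i) (he : ∀ i, 0 < σ.e i) (hf : ∀ i, 0 < σ.f i)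
    (hε : σ.ε = 1 ∨ σ.ε = 2) : IsBilinearLattice σ.form := by
  refine ⟨inferInstance, inferInstance, ⟨fun v hv => ?_, fun v hv => ?_⟩, coxeter hp,
    form_coxeter hp hε⟩
  · exact separatingLeft he hf (by omega) hv
  -- The Coxeter transformation is bijective and turns the right radical into the left one.
  · refine separatingLeft he hf (by omega) fun w => ?_
    obtain ⟨w, rfl⟩ := (coxeter hp).surjective w
    rw [← neg_eq_zero, ← form_coxeter hp hε]
    exact hv w

end CanonicalSymbol

/-! ### Isometries -/

section Isometries

variable {V W : Type*} [AddCommGroup V] [AddCommGroup W] {B : LinearMap.BilinForm ℤ V}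
  {B' : LinearMap.BilinForm ℤ W}

theorem LatticeIso.isBilinearLattice_of_smul {c : ℤ} (hc : c ≠ 0) (h : LatticeIso B (c • B'))
    (hB' : IsBilinearLattice B') : IsBilinearLattice B := by
  obtain ⟨φ, hφ⟩ := h
  obtain ⟨h₁, h₂, h₃, τ, hτ⟩ := hB'
  have hφ' (x y : V) : B x y = c * B' (φ x) (φ y) := (hφ x y).symm
  refine ⟨Module.Free.of_equiv φ.toIntLinearEquiv.symm, Module.Finite.equiv φ.toIntLinearEquiv.symm,
    ⟨fun x hx => ?_, fun x hx => ?_⟩, (φ.trans τ).trans φ.symm, fun x y => ?_⟩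
  · refine (map_eq_zero_iff φ φ.injective).1 (h₃.1 _ fun y => ?_)
    have := hx (φ.symm y)
    rw [hφ', φ.apply_symm_apply] at this
    exact (mul_eq_zero.1 this).resolve_left hc
  · refine (map_eq_zero_iff φ φ.injective).1 (h₃.2 _ fun y => ?_)
    have := hx (φ.symm y)
    rw [hφ', φ.apply_symm_apply] at this
    exact (mul_eq_zero.1 this).resolve_left hc
  · simp only [hφ', AddEquiv.trans_apply, AddEquiv.apply_symm_apply, hτ (φ x) (φ y), mul_neg]

theorem LatticeIso.of_common {U : Type*} [AddCommGroup U] {C : LinearMap.BilinForm ℤ U}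
    (h : LatticeIso B C) (h' : LatticeIso B' C) : LatticeIso B B' := by
  obtain ⟨φ, hφ⟩ := h
  obtain ⟨ψ, hψ⟩ := h'
  exact ⟨φ.trans ψ.symm, fun x y => by
    rw [← hφ, ← hψ, AddEquiv.trans_apply, AddEquiv.trans_apply, AddEquiv.apply_symm_apply,
      AddEquiv.apply_symm_apply]⟩

end Isometries

/-! ### Recognition of canonical bilinear lattices -/

namespace CanonicalSymbol

variable {t : ℕ} {σ : CanonicalSymbol t} {V : Type*} [AddCommGroup V]
  {B : LinearMap.BilinForm ℤ V}

/-- No independence of the generators is required: a linear relation among them would lie in the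
radical of the canonical form, which is zero. -/
theorem latticeIso_of_gram (b : σ.Index → V) {c : ℤ} (hc : c ≠ 0)
    (hb : ∀ x y, B (b x) (b y) = c * σ.gram x y) (hspan : Submodule.span ℤ (Set.range b) = ⊤)
    (hσ : IsBilinearLattice σ.form) : LatticeIso B (c • σ.form) := by
  let ψ : (σ.Index →₀ ℤ) →ₗ[ℤ] V := Finsupp.linearCombination ℤ b
  have hψ (x y : σ.Index →₀ ℤ) : B (ψ x) (ψ y) = c * σ.form x y := by
    have : B.compl₁₂ ψ ψ = c • σ.form := by
      ext x y
      simpa [ψ, form_single] using hb x y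
    exact LinearMap.congr_fun₂ this x y
  have hinj : Function.Injective ψ := by
    rw [injective_iff_map_eq_zero]
    intro x hx
    refine hσ.2.2.1.1 x fun y => ?_
    have := hψ x y
    rw [hx, map_zero, LinearMap.zero_apply] at this
    exact (mul_eq_zero.1 this.symm).resolve_left hc
  have hsurj : Function.Surjective ψ := by
    rw [← LinearMap.range_eq_top, Finsupp.range_linearCombination, hspan]
  let e := LinearEquiv.ofBijective ψ ⟨hinj, hsurj⟩
  refine ⟨e.symm.toAddEquiv, fun x y => ?_⟩
  obtain ⟨x, rfl⟩ := e.surjective x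
  obtain ⟨y, rfl⟩ := e.surjective y
  change c * σ.form (e.symm (e x)) (e.symm (e y)) = _
  rw [e.symm_apply_apply, e.symm_apply_apply]
  exact (hψ x y).symm

/-- A lattice that is generated by elements `a`, `w` and `z i x` with `x ≤ p i - 1` whose Gram
matrix has the given shape is canonical, with `s i j = z i (p i - 1 - j) - z i (p i - 2 - j)`. -/
theorem latticeIso_of_chains (a w : V) (z : Fin t → ℕ → V) {c : ℤ} (hc : c ≠ 0)
    (hσ : IsBilinearLattice σ.form)
    (haa : B a a = c * σ.κ) (haw : B a w = c * (σ.κ * σ.ε)) (hwa : B w a = -(c * (σ.κ * σ.ε)))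
    (hww : B w w = 0) (C₁ C₂ C₃ C₄ : Fin t → ℤ) (C₅ : Fin t → Fin t → ℤ)
    (haz : ∀ i x, x < σ.p i - 1 → B a (z i x) = C₁ i)
    (haz' : ∀ i, B a (z i (σ.p i - 1)) = C₁ i + c * (σ.κ * σ.ε * σ.f i))
    (hza : ∀ i x, x ≤ σ.p i - 1 → B (z i x) a = C₂ i)
    (hzw : ∀ i x, x ≤ σ.p i - 1 → B (z i x) w = C₃ i)
    (hwz : ∀ i x, x ≤ σ.p i - 1 → B w (z i x) = C₄ i)
    (hzz : ∀ i x i' y, x ≤ σ.p i - 1 → y < σ.p i' - 1 →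
      B (z i x) (z i' y) = if i = i' then if x ≤ y then c * σ.norm i else 0 else 0)
    (hzz' : ∀ i x i', x ≤ σ.p i - 1 → B (z i x) (z i' (σ.p i' - 1)) = C₅ i i')
    (hz : ∀ i, z i (σ.p i - 1) ∈ Submodule.span ℤ {a, w})
    (hspan : ∀ N : Submodule ℤ V, a ∈ N → w ∈ N → (∀ i x, x < σ.p i - 1 → z i x ∈ N) → N = ⊤) :
    LatticeIso B (c • σ.form) := by
  -- Each chain is read downwards from its top z i (p i - 1), and s i j is the j-th difference. The
  -- values C₁, …, C₅ are constant along chains and cancel in these differences; only the jump of c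
  -- κ ε f_i at the top in `haz'` and the triangular pattern in `hzz` survive.
  let b : σ.Index → V
    | .a => a
    | .w => w
    | .s i j => z i (σ.p i - 1 - j) - z i (σ.p i - 1 - j - 1)
  -- The top of each chain lies in the span of a and w, so subtracting the differences one by one
  -- recovers all lower elements.
  have key (N : Submodule ℤ V) (ha : a ∈ N) (hw : w ∈ N)
      (hs : ∀ i j, b (.s i j) ∈ N) : N = ⊤ := by
    have hle : Submodule.span ℤ {a, w} ≤ N := by
      rw [Submodule.span_le]
      rintro _ (rfl | rfl) <;> assumption
    have hmem (i : Fin t) (j : ℕ) (hj : j ≤ σ.p i - 1) : z i (σ.p i - 1 - j) ∈ N := by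
      induction j with
      | zero => exact hle (hz i)
      | succ j ih =>
        have h₁ := sub_mem (ih (by omega)) (hs i ⟨j, by omega⟩)
        simp only [b, sub_sub_cancel] at h₁
        rwa [Nat.sub_sub] at h₁
    refine hspan N ha hw fun i x hx => ?_
    have := hmem i (σ.p i - 1 - x) (by omega)
    rwa [Nat.sub_sub_self hx.le] at this
  refine latticeIso_of_gram b hc ?_ (key _ (Submodule.subset_span ⟨.a, rfl⟩)
    (Submodule.subset_span ⟨.w, rfl⟩) fun i j => Submodule.subset_span ⟨.s i j, rfl⟩) hσ
  rintro (_ | _ | ⟨i, j⟩) (_ | _ | ⟨i', j'⟩)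
  · exact haa
  · exact haw
  · have hj' := j'.2
    simp only [b, gram, map_sub]
    rw [haz i' (σ.p i' - 1 - j' - 1) (by omega)]
    split_ifs with h
    · rw [h, Nat.sub_zero, haz']
      ring
    · rw [haz _ _ (by omega), sub_self, mul_zero]
  · simp only [b, gram, hwa, mul_neg]
  · simp only [b, gram, hww, mul_zero]
  · simp only [b, gram, map_sub]
    rw [hwz _ _ (by omega), hwz _ _ (by omega), sub_self, mul_zero]
  · simp only [b, gram, map_sub, LinearMap.sub_apply]
    rw [hza _ _ (by omega), hza _ _ (by omega), sub_self, mul_zero]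
  · simp only [b, gram, map_sub, LinearMap.sub_apply]
    rw [hzw _ _ (by omega), hzw _ _ (by omega), sub_self, mul_zero]
  · have hj := j.2
    have hj' := j'.2
    change B _ _ = c * if i = i' then if (j : ℕ) = j' then σ.norm i else
      if (j : ℕ) + 1 = j' then -σ.norm i else 0 else 0
    simp only [b, map_sub, LinearMap.sub_apply]
    rw [hzz _ _ _ (σ.p i' - 1 - j' - 1) (by omega) (by omega),
      hzz _ _ _ (σ.p i' - 1 - j' - 1) (by omega) (by omega)]
    by_cases h0 : (j' : ℕ) = 0
    · rw [h0, Nat.sub_zero, hzz' _ _ _ (by omega), hzz' _ _ _ (by omega)]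
      by_cases hi : i = i'
      · subst hi
        simp only [if_true]
        split_ifs <;> first | contradiction | omega
      · simp [hi]
    · rw [hzz _ _ _ _ (by omega) (by omega), hzz _ _ _ _ (by omega) (by omega)]
      by_cases hi : i = i'
      · subst hi
        simp only [if_true]
        split_ifs <;> first | contradiction | omega | ring
      · simp [hi]

end CanonicalSymbol

/-- The vertices of a canonical algebra. -/
inductive Vertex {t : ℕ} (p : Fin t → ℕ) : Type
  | first : Vertex p
  | last : Vertex p
  | mid (i : Fin t) (j : Fin (p i - 1)) : Vertex p

/-- The Gram matrix of the elements `q x` has the shape of the Cartan matrix of a canonical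
algebra. -/
structure IsCanonicalGram {t : ℕ} {p : Fin t → ℕ} {V : Type*} [AddCommGroup V]
    (B : LinearMap.BilinForm ℤ V) (q : Vertex p → V) (α β m : ℤ) (μ ν d : Fin t → ℤ) : Prop where
  span : Submodule.span ℤ (Set.range q) = ⊤
  first_first : B (q .first) (q .first) = α
  first_last : B (q .first) (q .last) = m
  last_first : B (q .last) (q .first) = 0
  last_last : B (q .last) (q .last) = β
  first_mid : ∀ i j, B (q .first) (q (.mid i j)) = μ i
  mid_first : ∀ i j, B (q (.mid i j)) (q .first) = 0
  last_mid : ∀ i j, B (q .last) (q (.mid i j)) = 0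
  mid_last : ∀ i j, B (q (.mid i j)) (q .last) = ν i
  mid_mid : ∀ i j i' j', B (q (.mid i j)) (q (.mid i' j')) =
    if i = i' then if (j : ℕ) ≤ j' then d i else 0 else 0

namespace IsCanonicalGram

variable {t : ℕ} {σ : CanonicalSymbol t} {V : Type*} [AddCommGroup V]
  {B : LinearMap.BilinForm ℤ V} {q : Vertex σ.p → V} {α β m : ℤ} {μ ν d : Fin t → ℤ}

/-- The elements `q (mid i x)`, completed by a multiple of `q last`. -/
def chain (q : Vertex σ.p → V) (φ : Fin t → ℤ) (i : Fin t) (x : ℕ) : V :=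
  if h : x < σ.p i - 1 then q (.mid i ⟨x, h⟩) else φ i • q .last

theorem chain_lt {φ : Fin t → ℤ} {i : Fin t} {x : ℕ} (h : x < σ.p i - 1) :
    chain q φ i x = q (.mid i ⟨x, h⟩) := dif_pos h

theorem chain_top {φ : Fin t → ℤ} {i : Fin t} : chain q φ i (σ.p i - 1) = φ i • q .last :=
  dif_neg (lt_irrefl _)

theorem forall_chain {φ : Fin t → ℤ} {i : Fin t} {P : V → Prop} (hlt : ∀ j, P (q (.mid i j)))
    (htop : P (φ i • q .last)) (x : ℕ) (_ : x ≤ σ.p i - 1) : P (chain q φ i x) := by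
  unfold chain
  split_ifs
  · exact hlt _
  · exact htop

theorem eq_top_of_mem (h : IsCanonicalGram B q α β m μ ν d) {φ : Fin t → ℤ} {N : Submodule ℤ V}
    (hfirst : q .first ∈ N) (hlast : q .last ∈ N)
    (hmid : ∀ i x, x < σ.p i - 1 → chain q φ i x ∈ N) : N = ⊤ := by
  rw [← top_le_iff, ← h.span, Submodule.span_le]
  rintro _ ⟨_ | _ | ⟨i, j⟩, rfl⟩
  · exact hfirst
  · exact hlast
  · have := hmid i j j.2
    rwa [chain_lt j.2] at this

/-- The completed top of a chain is a multiple of the last vertex and pairs to zero with every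
middle vertex on its right, so it fits the triangular pattern of the middle vertices. -/
theorem chain_chain (h : IsCanonicalGram B q α β m μ ν d) {φ : Fin t → ℤ} {c : ℤ}
    (hd : ∀ i, d i = c * σ.norm i) (i : Fin t) (x : ℕ) (i' : Fin t) (y : ℕ)
    (hx : x ≤ σ.p i - 1) (hy : y < σ.p i' - 1) :
    B (chain q φ i x) (chain q φ i' y) =
      if i = i' then if x ≤ y then c * σ.norm i else 0 else 0 := by
  rw [chain_lt hy, ← hd]
  by_cases hx' : x < σ.p i - 1
  · rw [chain_lt hx', h.mid_mid]
  · obtain rfl : x = σ.p i - 1 := by omega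
    rw [chain_top, map_smul, LinearMap.smul_apply, h.last_mid, smul_zero]
    split_ifs with h₁ h₂
    · subst h₁
      omega
    · rfl
    · rfl

/-- The condition φ_i β = ν_i fixes the multiple chosen for the top: it makes the top pair with the
last vertex exactly as the other members of its chain do. -/
theorem chain_top_right (h : IsCanonicalGram B q α β m μ ν d) {φ : Fin t → ℤ}
    (hν : ∀ i, φ i * β = ν i) (i : Fin t) (x : ℕ) (i' : Fin t) (hx : x ≤ σ.p i - 1) :
    B (chain q φ i x) (chain q φ i' (σ.p i' - 1)) = φ i' * ν i := by
  rw [chain_top, map_smul, smul_eq_mul]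
  congr 1
  refine forall_chain (P := fun v => B v _ = _) (fun j => h.mid_last i j) ?_ x hx
  rw [map_smul, LinearMap.smul_apply, h.last_last, smul_eq_mul, hν]

/-- The first kind of canonical Gram matrix, where `a` is the first vertex. -/
theorem latticeIso_first (h : IsCanonicalGram B q α β m μ ν d) {c : ℤ} (hc : c ≠ 0)
    (hσ : IsBilinearLattice σ.form) (hα : α = c * σ.κ) (hβ : β = σ.ε ^ 2 * α)
    (hm : m = 2 * σ.ε * α) (hμ : ∀ i, μ i = σ.ε * α * σ.f i)
    (hν : ∀ i, ν i = σ.ε ^ 2 * α * σ.f i) (hd : ∀ i, d i = c * σ.norm i) :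
    LatticeIso B (c • σ.form) := by
  have hν' (i : Fin t) : (σ.f i : ℤ) * β = ν i := by
    rw [hβ, hν]
    ring
  -- The vector w is isotropic because β - εm + ε²α = 0. The chains end in f_i [last] because f_i β
  -- = ν_i.
  refine CanonicalSymbol.latticeIso_of_chains (q .first) (q .last - (σ.ε : ℤ) • q .first)
    (chain q fun i => σ.f i) hc hσ ?_ ?_ ?_ ?_ μ 0 ν (fun i => -(σ.ε * μ i))
    (fun i i' => σ.f i' * ν i) ?_ ?_ ?_ ?_ ?_ (h.chain_chain hd)
    (h.chain_top_right hν') ?_ ?_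
  · rw [h.first_first, hα]
  · simp only [map_sub, map_smul, h.first_last, h.first_first, hm, hα, smul_eq_mul]
    ring
  · simp only [map_sub, map_smul, LinearMap.sub_apply, LinearMap.smul_apply, h.last_first,
      h.first_first, hα, smul_eq_mul]
    ring
  · simp only [map_sub, map_smul, LinearMap.sub_apply, LinearMap.smul_apply, h.last_first,
      h.last_last, h.first_last, h.first_first, hm, hβ, smul_eq_mul]
    ring
  · intro i x hx
    rw [chain_lt hx, h.first_mid]
  · intro i
    rw [chain_top, map_smul, h.first_last, hm, hμ, hα, smul_eq_mul]
    ring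
  · intro i
    refine forall_chain (P := fun v => B v _ = _) (fun j => h.mid_first i j) ?_
    rw [map_smul, LinearMap.smul_apply, h.last_first, smul_zero]
    rfl
  · intro i
    refine forall_chain (P := fun v => B v _ = _) (fun j => ?_) ?_
    · rw [map_sub, map_smul, h.mid_last, h.mid_first, smul_zero, sub_zero]
    · simp only [map_sub, map_smul, LinearMap.smul_apply, h.last_first, h.last_last, mul_zero,
        sub_zero, smul_eq_mul, hν']
  · intro i
    refine forall_chain (P := fun v => B _ v = _) (fun j => ?_) ?_
    · simp only [map_sub, map_smul, LinearMap.sub_apply, LinearMap.smul_apply, h.last_mid,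
        h.first_mid, zero_sub, smul_eq_mul]
    · simp only [map_sub, map_smul, LinearMap.sub_apply, LinearMap.smul_apply, h.last_last,
        h.first_last, hβ, hm, hμ, smul_eq_mul]
      ring
  · intro i
    rw [chain_top]
    refine Submodule.smul_mem _ _ ?_
    have := add_mem (Submodule.subset_span (R := ℤ)
      (s := {q .first, q .last - (σ.ε : ℤ) • q .first})
      (Set.mem_insert_of_mem _ rfl)) (Submodule.smul_mem _ (σ.ε : ℤ) (Submodule.subset_span
        (Set.mem_insert _ _)))
    rwa [sub_add_cancel] at this
  · intro N ha hw hmid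
    refine h.eq_top_of_mem ha ?_ hmid
    have := add_mem hw (N.smul_mem (σ.ε : ℤ) ha)
    rwa [sub_add_cancel] at this

/-- The second kind of canonical Gram matrix, where `a` is the last vertex. -/
theorem latticeIso_last (h : IsCanonicalGram B q α β m μ ν d) {c : ℤ} (hc : c ≠ 0)
    (hσ : IsBilinearLattice σ.form) (hβ : β = c * σ.κ) (hα : α = σ.ε ^ 2 * β)
    (hm : m = 2 * σ.ε * β) (hν : ∀ i, ν i = σ.ε * β * σ.f i)
    (hμ : ∀ i, μ i = σ.ε ^ 2 * β * σ.f i) (hd : ∀ i, d i = c * σ.norm i) :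
    LatticeIso B (c • σ.form) := by
  have hν' (i : Fin t) : (σ.ε * σ.f i : ℤ) * β = ν i := by
    rw [hν]
    ring
  -- Here ε²β - εm + α = 0 makes w isotropic, and the chains end in εf_i [last] because εf_i β =
  -- ν_i.
  refine CanonicalSymbol.latticeIso_of_chains (q .last) ((σ.ε : ℤ) • q .last - q .first)
    (chain q fun i => σ.ε * σ.f i) hc hσ ?_ ?_ ?_ ?_ 0 ν (fun i => σ.ε * ν i) (fun i => -μ i)
    (fun i i' => σ.ε * σ.f i' * ν i) ?_ ?_ ?_ ?_ ?_ (h.chain_chain hd)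
    (h.chain_top_right hν') ?_ ?_
  · rw [h.last_last, hβ]
  · simp only [map_sub, map_smul, h.last_last, h.last_first, hβ, smul_eq_mul]
    ring
  · simp only [map_sub, map_smul, LinearMap.sub_apply, LinearMap.smul_apply, h.last_last,
      h.first_last, hm, hβ, smul_eq_mul]
    ring
  · simp only [map_sub, map_smul, LinearMap.sub_apply, LinearMap.smul_apply, h.last_first,
      h.last_last, h.first_last, h.first_first, hm, hα, smul_eq_mul]
    ring
  · intro i x hx
    rw [chain_lt hx, h.last_mid]
    rfl
  · intro i
    rw [chain_top, map_smul, h.last_last, hβ, smul_eq_mul, Pi.zero_apply]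
    ring
  · intro i
    refine forall_chain (P := fun v => B v _ = _) (fun j => h.mid_last i j) ?_
    rw [map_smul, LinearMap.smul_apply, h.last_last, smul_eq_mul, hν']
  · intro i
    refine forall_chain (P := fun v => B v _ = _) (fun j => ?_) ?_
    · rw [map_sub, map_smul, h.mid_last, h.mid_first, sub_zero, smul_eq_mul]
    · simp only [map_sub, map_smul, LinearMap.smul_apply, h.last_first, h.last_last,
        smul_eq_mul, ← hν']
      ring
  · intro i
    refine forall_chain (P := fun v => B _ v = _) (fun j => ?_) ?_
    · simp only [map_sub, map_smul, LinearMap.sub_apply, LinearMap.smul_apply, h.last_mid,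
        h.first_mid, zero_sub, smul_zero]
    · simp only [map_sub, map_smul, LinearMap.sub_apply, LinearMap.smul_apply, h.last_last,
        h.first_last, hm, hμ, smul_eq_mul]
      ring
  · intro i
    rw [chain_top]
    exact Submodule.smul_mem _ _ (Submodule.subset_span (Set.mem_insert _ _))
  · intro N ha hw hmid
    refine h.eq_top_of_mem ?_ ha hmid
    have := sub_mem (N.smul_mem (σ.ε : ℤ) ha) hw
    rwa [sub_sub_cancel] at this

end IsCanonicalGram

/-! ### Subrepresentations, quotients and extensions of representations -/

namespace BimodRep

variable {k F G M : Type u} [Field k] [DivisionRing F] [DivisionRing G]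
  [Algebra k F] [Algebra k G] [AddCommGroup M] [Module k M] [Module F M] [Module Gᵐᵒᵖ M]

namespace Hom

variable {X Y Z : BimodRep k F G M}

/-- The composition of homomorphisms. -/
def comp (g : Hom Y Z) (f : Hom X Y) : Hom X Z where
  u := g.u ∘ₗ f.u
  v := g.v ∘ₗ f.v
  comm x m := by simp [f.comm, g.comm]

/-- The identity. -/
def id (X : BimodRep k F G M) : Hom X X where
  u := LinearMap.id
  v := LinearMap.id
  comm _ _ := rfl

/-- Both components of a homomorphism are surjective. -/
def Surjective (f : Hom X Y) : Prop :=
  Function.Surjective f.u ∧ Function.Surjective f.v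

theorem Injective.comp {g : Hom Y Z} {f : Hom X Y} (hg : g.Injective) (hf : f.Injective) :
    (g.comp f).Injective :=
  ⟨hg.1.comp hf.1, hg.2.comp hf.2⟩

theorem Surjective.comp {g : Hom Y Z} {f : Hom X Y} (hg : g.Surjective) (hf : f.Surjective) :
    (g.comp f).Surjective :=
  ⟨hg.1.comp hf.1, hg.2.comp hf.2⟩

/-- An endomorphism as an element of the endomorphism algebra. -/
def toD (f : Hom X X) : X.D := ⟨(f.u, f.v), fun x m => f.comm x m⟩

/-- An element of the endomorphism algebra as an endomorphism. -/
def ofD (d : X.D) : Hom X X := ⟨d.1.1, d.1.2, fun x m => d.2 x m⟩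

end Hom

/-- The total dimension. -/
def size (X : BimodRep k F G M) : ℕ := Module.finrank Fᵐᵒᵖ X.U + Module.finrank Gᵐᵒᵖ X.V

/-- A multiple of the defect `dim U_F - ε dim V_G` of a representation of a tame bimodule. -/
def defect (X : BimodRep k F G M) : ℤ :=
  Module.finrank Gᵐᵒᵖ M * Module.finrank Fᵐᵒᵖ X.U - 2 * Module.finrank Gᵐᵒᵖ X.V

theorem size_eq_zero_iff (X : BimodRep k F G M) : X.size = 0 ↔ X.IsZero := by
  rw [size, Nat.add_eq_zero_iff, IsZero, Module.finrank_zero_iff, Module.finrank_zero_iff]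

theorem IsZero.defect_eq_zero {X : BimodRep k F G M} (h : X.IsZero) : X.defect = 0 := by
  obtain ⟨_, _⟩ := h
  rw [defect, Module.finrank_zero_of_subsingleton (M := X.U),
    Module.finrank_zero_of_subsingleton (M := X.V)]
  simp

/-- A subrepresentation. -/
def sub (X : BimodRep k F G M) (P : Submodule Fᵐᵒᵖ X.U) (Q : Submodule Gᵐᵒᵖ X.V)
    (h : ∀ x ∈ P, ∀ m, X.ρ x m ∈ Q) : BimodRep k F G M where
  U := P
  V := Q
  ρ := LinearMap.mk₂ k (fun x m => ⟨X.ρ x.1 m, h x.1 x.2 m⟩)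
    (fun x y m => Subtype.ext (by simp)) (fun c x m => Subtype.ext (by simp))
    (fun x m n => Subtype.ext (by simp)) (fun c x m => Subtype.ext (by simp))
  balanced x f m := Subtype.ext (X.balanced x.1 f m)
  map_right x m g := Subtype.ext (X.map_right x.1 m g)

/-- The inclusion of a subrepresentation. -/
def subHom (X : BimodRep k F G M) (P : Submodule Fᵐᵒᵖ X.U) (Q : Submodule Gᵐᵒᵖ X.V)
    (h : ∀ x ∈ P, ∀ m, X.ρ x m ∈ Q) : Hom (X.sub P Q h) X where
  u := P.subtype
  v := Q.subtype
  comm _ _ := rfl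

theorem subHom_injective (X : BimodRep k F G M) (P : Submodule Fᵐᵒᵖ X.U)
    (Q : Submodule Gᵐᵒᵖ X.V) (h : ∀ x ∈ P, ∀ m, X.ρ x m ∈ Q) : (X.subHom P Q h).Injective :=
  ⟨P.subtype_injective, Q.subtype_injective⟩

/-- The structure map of a quotient. -/
def quotρ (X : BimodRep k F G M) (P : Submodule Fᵐᵒᵖ X.U) (Q : Submodule Gᵐᵒᵖ X.V)
    (h : ∀ x ∈ P, ∀ m, X.ρ x m ∈ Q) (x : X.U ⧸ P) (m : M) : X.V ⧸ Q :=
  Quotient.liftOn' x (fun x => Q.mkQ (X.ρ x m)) fun x y hxy => by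
    rw [Submodule.quotientRel_def] at hxy
    rw [← sub_eq_zero, ← map_sub, ← LinearMap.sub_apply, ← map_sub]
    exact (Submodule.Quotient.mk_eq_zero Q).2 (h _ hxy m)

/-- A quotient representation. -/
def quot (X : BimodRep k F G M) (P : Submodule Fᵐᵒᵖ X.U) (Q : Submodule Gᵐᵒᵖ X.V)
    (h : ∀ x ∈ P, ∀ m, X.ρ x m ∈ Q) : BimodRep k F G M where
  U := X.U ⧸ P
  V := X.V ⧸ Q
  ρ := LinearMap.mk₂ k (X.quotρ P Q h)
    (fun x y m => by
      obtain ⟨x, rfl⟩ := P.mkQ_surjective x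
      obtain ⟨y, rfl⟩ := P.mkQ_surjective y
      change Q.mkQ (X.ρ (x + y) m) = Q.mkQ (X.ρ x m) + Q.mkQ (X.ρ y m)
      simp)
    (fun c x m => by
      obtain ⟨x, rfl⟩ := P.mkQ_surjective x
      change Q.mkQ (X.ρ (c • x) m) = c • Q.mkQ (X.ρ x m)
      rw [map_smul, LinearMap.smul_apply, LinearMap.map_smul_of_tower])
    (fun x m n => by
      obtain ⟨x, rfl⟩ := P.mkQ_surjective x
      change Q.mkQ (X.ρ x (m + n)) = Q.mkQ (X.ρ x m) + Q.mkQ (X.ρ x n)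
      simp)
    (fun c x m => by
      obtain ⟨x, rfl⟩ := P.mkQ_surjective x
      change Q.mkQ (X.ρ x (c • m)) = c • Q.mkQ (X.ρ x m)
      rw [map_smul, LinearMap.map_smul_of_tower])
  balanced x f m := by
    obtain ⟨x, rfl⟩ := P.mkQ_surjective x
    exact congrArg Q.mkQ (X.balanced x f m)
  map_right x m g := by
    obtain ⟨x, rfl⟩ := P.mkQ_surjective x
    exact congrArg Q.mkQ (X.map_right x m g)

/-- The projection to a quotient representation. -/
def quotHom (X : BimodRep k F G M) (P : Submodule Fᵐᵒᵖ X.U) (Q : Submodule Gᵐᵒᵖ X.V)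
    (h : ∀ x ∈ P, ∀ m, X.ρ x m ∈ Q) : Hom X (X.quot P Q h) where
  u := P.mkQ
  v := Q.mkQ
  comm _ _ := rfl

/-- Short exact sequences of representations. -/
structure IsSES {X Y Z : BimodRep k F G M} (i : Hom X Y) (p : Hom Y Z) : Prop where
  inj : i.Injective
  surj : p.Surjective
  exact_u : Function.Exact i.u p.u
  exact_v : Function.Exact i.v p.v

theorem exists_cokernel {X Y : BimodRep k F G M} (i : Hom X Y) (hi : i.Injective) :
    ∃ (Z : BimodRep k F G M) (p : Hom Y Z), IsSES i p := by
  have h : ∀ x ∈ LinearMap.range i.u, ∀ m, Y.ρ x m ∈ LinearMap.range i.v := by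
    rintro _ ⟨x, rfl⟩ m
    exact ⟨X.ρ x m, i.comm x m⟩
  refine ⟨Y.quot _ _ h, Y.quotHom _ _ h, hi, ⟨Submodule.mkQ_surjective _,
    Submodule.mkQ_surjective _⟩, fun x => ?_, fun x => ?_⟩
  · change Submodule.mkQ _ x = 0 ↔ _
    rw [← LinearMap.mem_ker, Submodule.ker_mkQ]
    rfl
  · change Submodule.mkQ _ x = 0 ↔ _
    rw [← LinearMap.mem_ker, Submodule.ker_mkQ]
    rfl

theorem exists_kernel {Y Z : BimodRep k F G M} (p : Hom Y Z) (hp : p.Surjective) :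
    ∃ (X : BimodRep k F G M) (i : Hom X Y), IsSES i p := by
  have h : ∀ x ∈ LinearMap.ker p.u, ∀ m, Y.ρ x m ∈ LinearMap.ker p.v := by
    intro x hx m
    rw [LinearMap.mem_ker] at *
    rw [p.comm, hx, map_zero, LinearMap.zero_apply]
  refine ⟨Y.sub _ _ h, Y.subHom _ _ h, Y.subHom_injective _ _ h, hp, fun x => ?_, fun x => ?_⟩
  · exact ⟨fun hx => ⟨⟨x, hx⟩, rfl⟩, fun ⟨y, hy⟩ => hy ▸ y.2⟩
  · exact ⟨fun hx => ⟨⟨x, hx⟩, rfl⟩, fun ⟨y, hy⟩ => hy ▸ y.2⟩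

theorem exists_image {X Y : BimodRep k F G M} (f : Hom X Y) :
    ∃ (I : BimodRep k F G M) (p : Hom X I) (i : Hom I Y), p.Surjective ∧ i.Injective ∧
      i.comp p = f := by
  have h : ∀ x ∈ LinearMap.range f.u, ∀ m, Y.ρ x m ∈ LinearMap.range f.v := by
    rintro _ ⟨x, rfl⟩ m
    exact ⟨X.ρ x m, f.comm x m⟩
  exact ⟨Y.sub _ _ h, ⟨f.u.rangeRestrict, f.v.rangeRestrict, fun x m => Subtype.ext (f.comm x m)⟩,
    Y.subHom _ _ h, ⟨f.u.surjective_rangeRestrict, f.v.surjective_rangeRestrict⟩,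
    Y.subHom_injective _ _ h, rfl⟩

namespace IsSES

variable {X Y Z : BimodRep k F G M} {i : Hom X Y} {p : Hom Y Z}

theorem finrank_u (h : IsSES i p) : Module.finrank Fᵐᵒᵖ Y.U =
    Module.finrank Fᵐᵒᵖ X.U + Module.finrank Fᵐᵒᵖ Z.U := by
  rw [← LinearMap.finrank_range_add_finrank_ker p.u, LinearMap.exact_iff.1 h.exact_u,
    LinearMap.range_eq_top.2 h.surj.1, finrank_top, LinearMap.finrank_range_of_inj h.inj.1,
    add_comm]

theorem finrank_v (h : IsSES i p) : Module.finrank Gᵐᵒᵖ Y.V =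
    Module.finrank Gᵐᵒᵖ X.V + Module.finrank Gᵐᵒᵖ Z.V := by
  rw [← LinearMap.finrank_range_add_finrank_ker p.v, LinearMap.exact_iff.1 h.exact_v,
    LinearMap.range_eq_top.2 h.surj.2, finrank_top, LinearMap.finrank_range_of_inj h.inj.2,
    add_comm]

theorem size_eq (h : IsSES i p) : Y.size = X.size + Z.size := by
  rw [size, size, size, h.finrank_u, h.finrank_v]
  ring

theorem defect_eq (h : IsSES i p) : Y.defect = X.defect + Z.defect := by
  rw [defect, defect, defect, h.finrank_u, h.finrank_v]
  push_cast
  ring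

end IsSES

theorem Hom.Injective.isIso {X Y : BimodRep k F G M} {i : Hom X Y} (hi : i.Injective)
    (h : Y.size ≤ X.size) : i.IsIso := by
  have hu := LinearMap.finrank_le_finrank_of_injective hi.1
  have hv := LinearMap.finrank_le_finrank_of_injective hi.2
  rw [size, size] at h
  exact ⟨⟨hi.1, (LinearMap.injective_iff_surjective_of_finrank_eq_finrank (by omega)).1 hi.1⟩,
    ⟨hi.2, (LinearMap.injective_iff_surjective_of_finrank_eq_finrank (by omega)).1 hi.2⟩⟩

theorem Hom.Surjective.isIso {X : BimodRep k F G M} {f : Hom X X} (hf : f.Surjective) :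
    f.IsIso :=
  ⟨⟨LinearMap.injective_iff_surjective.2 hf.1, hf.1⟩,
    ⟨LinearMap.injective_iff_surjective.2 hf.2, hf.2⟩⟩

theorem Hom.IsIso.defect_eq {X Y : BimodRep k F G M} {f : Hom X Y} (hf : f.IsIso) :
    X.defect = Y.defect := by
  rw [defect, defect, (LinearEquiv.ofBijective f.u hf.1).finrank_eq,
    (LinearEquiv.ofBijective f.v hf.2).finrank_eq]

/-- The space `Hom_G(U ⊗_F M, V)` of balanced maps. -/
def balancedMaps (Z Y : BimodRep k F G M) : Submodule k (Z.U →ₗ[k] M →ₗ[k] Y.V) where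
  carrier := {β | (∀ (x : Z.U) (f : F) (m : M), β (op f • x) m = β x (f • m)) ∧
    ∀ (x : Z.U) (m : M) (g : G), β x (op g • m) = op g • β x m}
  add_mem' {β γ} hβ hγ := ⟨fun x f m => by simp [hβ.1, hγ.1],
    fun x m g => by simp [hβ.2, hγ.2]⟩
  zero_mem' := ⟨fun x f m => by simp, fun x m g => by simp⟩
  smul_mem' c β hβ := ⟨fun x f m => by simp [hβ.1], fun x m g => by
    simp only [LinearMap.smul_apply, hβ.2]
    exact smul_comm c (op g) (β x m)⟩

/-- Composition of a balanced map with linear maps. -/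
def balancedComp {Z Y Z' Y' : BimodRep k F G M} (β : balancedMaps Z Y)
    (a : Z'.U →ₗ[Fᵐᵒᵖ] Z.U) (b : Y.V →ₗ[Gᵐᵒᵖ] Y'.V) : balancedMaps Z' Y' :=
  ⟨(β.1.compr₂ (b.restrictScalars k)).comp (a.restrictScalars k),
    fun x f m => by simp [β.2.1], fun x m g => by simp [β.2.2]⟩

@[simp] theorem balancedComp_apply {Z Y Z' Y' : BimodRep k F G M} (β : balancedMaps Z Y)
    (a : Z'.U →ₗ[Fᵐᵒᵖ] Z.U) (b : Y.V →ₗ[Gᵐᵒᵖ] Y'.V) (x : Z'.U) (m : M) :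
    (balancedComp β a b).1 x m = b (β.1 (a x) m) := rfl

/-- The structure map as a balanced map. -/
def structureMap (Z : BimodRep k F G M) : balancedMaps Z Z := ⟨Z.ρ, Z.balanced, Z.map_right⟩

/-- The map `(a, b) ↦ bρ - ρa` whose kernel is `Hom(Z, Y)` and whose cokernel is `Ext¹(Z, Y)`. -/
def extMap (Z Y : BimodRep k F G M) :
    (Z.U →ₗ[Fᵐᵒᵖ] Y.U) × (Z.V →ₗ[Gᵐᵒᵖ] Y.V) →ₗ[k] balancedMaps Z Y where
  toFun c := balancedComp Z.structureMap LinearMap.id c.2 -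
    balancedComp Y.structureMap c.1 LinearMap.id
  map_add' c d := by
    ext x m
    change (c.2 + d.2) (Z.ρ x m) - Y.ρ ((c.1 + d.1) x) m =
      (c.2 (Z.ρ x m) - Y.ρ (c.1 x) m) + (d.2 (Z.ρ x m) - Y.ρ (d.1 x) m)
    simp only [LinearMap.add_apply, map_add]
    abel
  map_smul' r c := by
    ext x m
    change (r • c.2) (Z.ρ x m) - Y.ρ ((r • c.1) x) m = r • (c.2 (Z.ρ x m) - Y.ρ (c.1 x) m)
    simp [smul_sub]

theorem extMap_apply {Z Y : BimodRep k F G M} (c : (Z.U →ₗ[Fᵐᵒᵖ] Y.U) × (Z.V →ₗ[Gᵐᵒᵖ] Y.V))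
    (x : Z.U) (m : M) : (extMap Z Y c).1 x m = c.2 (Z.ρ x m) - Y.ρ (c.1 x) m := rfl

/-- The vanishing of `Ext¹(Z, Y)`. -/
def ExtVanish (Z Y : BimodRep k F G M) : Prop := Function.Surjective (extMap Z Y)

theorem extVanish_iff {Z Y : BimodRep k F G M} : ExtVanish Z Y ↔ ∀ β : balancedMaps Z Y,
    ∃ (a : Z.U →ₗ[Fᵐᵒᵖ] Y.U) (b : Z.V →ₗ[Gᵐᵒᵖ] Y.V),
      ∀ x m, β.1 x m = b (Z.ρ x m) - Y.ρ (a x) m := by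
  constructor
  · intro h β
    obtain ⟨c, rfl⟩ := h β
    exact ⟨c.1, c.2, fun x m => rfl⟩
  · intro h β
    obtain ⟨a, b, hab⟩ := h β
    refine ⟨(a, b), ?_⟩
    ext x m
    exact (hab x m).symm

/-! ### Vanishing of Ext¹ in short exact sequences, and splitting -/

section Extensions

variable {A B C Y Z : BimodRep k F G M} {i : Hom A B} {p : Hom B C}

theorem exists_leftInverse {E V W : Type*} [DivisionRing E] [AddCommGroup V] [AddCommGroup W]
    [Module E V] [Module E W] {f : V →ₗ[E] W} (hf : Function.Injective f) :
    ∃ l : W →ₗ[E] V, ∀ x, l (f x) = x := by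
  obtain ⟨l, hl⟩ := LinearMap.exists_leftInverse_of_injective f (LinearMap.ker_eq_bot.2 hf)
  exact ⟨l, fun x => LinearMap.congr_fun hl x⟩

theorem exists_rightInverse {E V W : Type*} [DivisionRing E] [AddCommGroup V] [AddCommGroup W]
    [Module E V] [Module E W] {f : V →ₗ[E] W} (hf : Function.Surjective f) :
    ∃ s : W →ₗ[E] V, ∀ x, f (s x) = x := by
  obtain ⟨s, hs⟩ := LinearMap.exists_rightInverse_of_surjective f (LinearMap.range_eq_top.2 hf)
  exact ⟨s, fun x => LinearMap.congr_fun hs x⟩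

/-- A solution for the image in C is lifted along vector space sections. What is left of β takes
values in A, where it is solved again. -/
theorem ExtVanish.middle_right (h : IsSES i p) (hA : ExtVanish Z A) (hC : ExtVanish Z C) :
    ExtVanish Z B := by
  rw [extVanish_iff] at *
  intro β
  obtain ⟨l, hl⟩ := exists_leftInverse h.inj.2
  obtain ⟨su, hsu⟩ := exists_rightInverse h.surj.1
  obtain ⟨sv, hsv⟩ := exists_rightInverse h.surj.2
  obtain ⟨a, b, hab⟩ := hC (balancedComp β LinearMap.id p.v)
  simp only [balancedComp_apply, LinearMap.id_apply] at hab
  obtain ⟨a', b', hab'⟩ := hA (balancedComp (β - extMap Z B (su ∘ₗ a, sv ∘ₗ b)) LinearMap.id l)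
  refine ⟨su ∘ₗ a + i.u ∘ₗ a', sv ∘ₗ b + i.v ∘ₗ b', fun x m => ?_⟩
  have hmem : p.v (β.1 x m - (sv (b (Z.ρ x m)) - B.ρ (su (a x)) m)) = 0 := by
    rw [map_sub, map_sub, hab, hsv, p.comm, hsu, sub_self]
  obtain ⟨y, hy⟩ := (h.exact_v _).1 hmem
  have h' := hab' x m
  change l (β.1 x m - (sv (b (Z.ρ x m)) - B.ρ (su (a x)) m)) = _ at h'
  rw [← hy, hl] at h'
  rw [h', map_sub, i.comm] at hy
  rw [sub_eq_iff_eq_add.1 hy.symm]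
  simp only [LinearMap.add_apply, LinearMap.comp_apply, map_add]
  abel

/-- A solution on A is extended along vector space retractions. The remainder of β vanishes on A,
hence factors through C, where it is solved again. -/
theorem ExtVanish.middle_left (h : IsSES i p) (hA : ExtVanish A Y) (hC : ExtVanish C Y) :
    ExtVanish B Y := by
  rw [extVanish_iff] at *
  intro β
  obtain ⟨lu, hlu⟩ := exists_leftInverse h.inj.1
  obtain ⟨lv, hlv⟩ := exists_leftInverse h.inj.2
  obtain ⟨s, hs⟩ := exists_rightInverse h.surj.1
  obtain ⟨a, b, hab⟩ := hA (balancedComp β i.u LinearMap.id)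
  simp only [balancedComp_apply, LinearMap.id_apply] at hab
  obtain ⟨a', b', hab'⟩ := hC (balancedComp (β - extMap B Y (a ∘ₗ lu, b ∘ₗ lv)) s LinearMap.id)
  refine ⟨a ∘ₗ lu + a' ∘ₗ p.u, b ∘ₗ lv + b' ∘ₗ p.v, fun x m => ?_⟩
  have hker (y : A.U) : (β - extMap B Y (a ∘ₗ lu, b ∘ₗ lv)).1 (i.u y) m = 0 := by
    change β.1 (i.u y) m - (b (lv (B.ρ (i.u y) m)) - Y.ρ (a (lu (i.u y))) m) = 0
    rw [hab, hlu, ← i.comm, hlv, sub_self]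
  obtain ⟨y, hy⟩ := (h.exact_u (x - s (p.u x))).1 (by rw [map_sub, hs, sub_self])
  have h₁ := hker y
  rw [hy, map_sub, LinearMap.sub_apply, sub_eq_zero] at h₁
  have h₂ := hab' (p.u x) m
  rw [balancedComp_apply, LinearMap.id_apply, ← h₁] at h₂
  change β.1 x m - (b (lv (B.ρ x m)) - Y.ρ (a (lu x)) m) = _ at h₂
  rw [sub_eq_iff_eq_add.1 h₂, ← p.comm]
  simp only [LinearMap.add_apply, LinearMap.comp_apply, map_add]
  abel

/-- The category is hereditary: a balanced map on A extends to B along a vector space retraction,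
and a solution on B restricts to A. -/
theorem ExtVanish.of_injective (hi : i.Injective) (hB : ExtVanish B Y) : ExtVanish A Y := by
  rw [extVanish_iff] at *
  intro β
  obtain ⟨l, hl⟩ := exists_leftInverse hi.1
  obtain ⟨a, b, hab⟩ := hB (balancedComp β l LinearMap.id)
  refine ⟨a ∘ₗ i.u, b ∘ₗ i.v, fun x m => ?_⟩
  have := hab (i.u x) m
  rw [balancedComp_apply, hl, ← i.comm] at this
  exact this

/-- Linear retractions of the two components fail to commute with the structure maps by a balanced
map that vanishes on A and so comes from C. Writing it in the image of `extMap` gives the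
correction. -/
theorem IsSES.exists_retraction (h : IsSES i p) (hCA : ExtVanish C A) :
    ∃ r : Hom B A, (∀ x, r.u (i.u x) = x) ∧ ∀ x, r.v (i.v x) = x := by
  rw [extVanish_iff] at hCA
  obtain ⟨lu, hlu⟩ := exists_leftInverse h.inj.1
  obtain ⟨lv, hlv⟩ := exists_leftInverse h.inj.2
  obtain ⟨s, hs⟩ := exists_rightInverse h.surj.1
  obtain ⟨a, b, hab⟩ := hCA (balancedComp (extMap B A (lu, lv)) s LinearMap.id)
  have hu (x : A.U) : p.u (i.u x) = 0 := h.exact_u.apply_apply_eq_zero x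
  have hv (x : A.V) : p.v (i.v x) = 0 := h.exact_v.apply_apply_eq_zero x
  refine ⟨⟨lu - a ∘ₗ p.u, lv - b ∘ₗ p.v, fun x m => ?_⟩, fun x => ?_, fun x => ?_⟩
  · obtain ⟨y, hy⟩ := (h.exact_u (x - s (p.u x))).1 (by rw [map_sub, hs, sub_self])
    have h₁ : (extMap B A (lu, lv)).1 (i.u y) m = 0 := by
      rw [extMap_apply, hlu, ← i.comm, hlv, sub_self]
    rw [hy, map_sub, LinearMap.sub_apply, sub_eq_zero] at h₁
    have h₂ := hab (p.u x) m
    rw [balancedComp_apply, LinearMap.id_apply, ← h₁, extMap_apply, ← p.comm] at h₂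
    simp only [LinearMap.sub_apply, LinearMap.comp_apply, map_sub]
    rw [sub_eq_sub_iff_sub_eq_sub]
    exact h₂
  · simp [hlu, hu]
  · simp [hlv, hv]

end Extensions

end BimodRep

/-! ### Dimensions of spaces of homomorphisms -/

theorem finrank_linearMap_of_divisionRing (k : Type*) {E V W : Type*} [Field k] [DivisionRing E]
    [Algebra k E] [AddCommGroup V] [AddCommGroup W] [Module E V] [Module E W] [Module k W]
    [IsScalarTower k E W] [Module.Finite E V] [Module.Finite k W] :
    Module.finrank k (V →ₗ[E] W) = Module.finrank E V * Module.finrank k W := by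
  rw [← ((Module.finBasis E V).constr k (M' := W)).finrank_eq, Module.finrank_pi_fintype]
  simp

namespace BimodRep

variable {k F G M : Type u} [Field k] [DivisionRing F] [DivisionRing G]
  [Algebra k F] [Algebra k G] [AddCommGroup M] [Module k M] [Module F M] [Module Gᵐᵒᵖ M]

/-- The restriction of a balanced map to a basis of `U`. -/
def balancedEval (Z Y : BimodRep k F G M) [IsScalarTower k Gᵐᵒᵖ M] : balancedMaps Z Y →ₗ[k]
    (Fin (Module.finrank Fᵐᵒᵖ Z.U) → M →ₗ[Gᵐᵒᵖ] Y.V) where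
  toFun β j :=
    { toFun := β.1 (Module.finBasis Fᵐᵒᵖ Z.U j)
      map_add' := map_add _
      map_smul' g m := β.2.2 _ m g.unop }
  map_add' _ _ := rfl
  map_smul' _ _ := rfl

theorem balancedEval_injective (Z Y : BimodRep k F G M) [IsScalarTower k Gᵐᵒᵖ M] :
    Function.Injective (balancedEval Z Y) := by
  rw [injective_iff_map_eq_zero]
  intro β hβ
  ext x m
  have h (j) (m : M) : β.1 (Module.finBasis Fᵐᵒᵖ Z.U j) m = 0 :=
    LinearMap.congr_fun (congrFun hβ j) m
  change β.1 x m = 0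
  rw [← (Module.finBasis Fᵐᵒᵖ Z.U).sum_repr x, map_sum, LinearMap.sum_apply, Finset.sum_eq_zero]
  intro j _
  rw [← op_unop (((Module.finBasis Fᵐᵒᵖ Z.U).repr x) j), β.2.1, h]

theorem finrank_op (E : Type*) [Ring E] [Algebra k E] :
    Module.finrank k Eᵐᵒᵖ = Module.finrank k E :=
  (opLinearEquiv k (M := E)).symm.finrank_eq

instance finite_linearMap_of_divisionRing {E V W : Type*} [DivisionRing E]
    [Algebra k E] [AddCommGroup V] [AddCommGroup W] [Module E V] [Module E W] [Module k W]
    [IsScalarTower k E W] [Module.Finite E V] [Module.Finite k W] :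
    Module.Finite k (V →ₗ[E] W) :=
  Module.Finite.equiv ((Module.finBasis E V).constr k (M' := W))

/-- The kernel of `extMap X X` is the endomorphism algebra. -/
def kerExtMapEquiv (X : BimodRep k F G M) : LinearMap.ker (extMap X X) ≃ₗ[k] X.D where
  toFun c := ⟨c.1, fun x m => by
    have h := congrArg (fun β : balancedMaps X X => β.1 x m) c.2
    exact sub_eq_zero.1 h⟩
  map_add' _ _ := rfl
  map_smul' _ _ := rfl
  invFun d := ⟨d.1, by
    rw [LinearMap.mem_ker]
    ext x m
    exact sub_eq_zero.2 (d.2 x m)⟩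
  left_inv _ := rfl
  right_inv _ := rfl

theorem finrank_ker_eq_zero {Z Y : BimodRep k F G M}
    (h : ∀ f : Hom Z Y, (∀ x, f.u x = 0) ∧ ∀ x, f.v x = 0) :
    Module.finrank k (LinearMap.ker (extMap Z Y)) = 0 := by
  have : LinearMap.ker (extMap Z Y) = ⊥ := by
    rw [eq_bot_iff]
    intro c hc
    have := h ⟨c.1, c.2, fun x m => by
      have h := congrArg (fun β : balancedMaps Z Y => β.1 x m) hc
      exact sub_eq_zero.1 h⟩
    exact Prod.ext (LinearMap.ext this.1) (LinearMap.ext this.2)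
  rw [this, finrank_bot]

instance (X : BimodRep k F G M) : IsScalarTower k X.D X.U where
  smul_assoc _ _ _ := rfl

instance (X : BimodRep k F G M) : IsScalarTower k X.D X.V where
  smul_assoc _ _ _ := rfl

/-- All non-zero endomorphisms are isomorphisms. -/
def IsBrick (X : BimodRep k F G M) : Prop :=
  ¬ X.IsZero ∧ ∀ f : Hom X X, (∀ x, f.u x = 0) ∧ (∀ x, f.v x = 0) ∨ f.IsIso

/-- The endomorphism algebra of a brick is a division ring. -/
theorem IsBrick.isUnit_or_eq_zero {X : BimodRep k F G M} (hX : X.IsBrick) (d : X.D) :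
    IsUnit d ∨ d = 0 := by
  rcases hX.2 (Hom.ofD d) with h | h
  · right
    exact Subtype.ext (Prod.ext (LinearMap.ext h.1) (LinearMap.ext h.2))
  · left
    let eu := LinearEquiv.ofBijective d.1.1 h.1
    let ev := LinearEquiv.ofBijective d.1.2 h.2
    let d' : X.D := ⟨(eu.symm.toLinearMap, ev.symm.toLinearMap), fun x m => by
      apply ev.injective
      change ev (ev.symm _) = d.1.2 (X.ρ (eu.symm x) m)
      rw [ev.apply_symm_apply, d.2]
      exact congrArg (fun y => X.ρ y m) (eu.apply_symm_apply x).symm⟩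
    exact ⟨⟨d, d', Subtype.ext (Prod.ext (LinearMap.ext fun x => eu.apply_symm_apply x)
      (LinearMap.ext fun x => ev.apply_symm_apply x)),
      Subtype.ext (Prod.ext (LinearMap.ext fun x => eu.symm_apply_apply x)
      (LinearMap.ext fun x => ev.symm_apply_apply x))⟩, rfl⟩

theorem IsBrick.nontrivial {X : BimodRep k F G M} (hX : X.IsBrick) : Nontrivial X.D := by
  refine ⟨0, 1, fun h => hX.1 ⟨subsingleton_of_forall_eq 0 fun x => ?_,
    subsingleton_of_forall_eq 0 fun x => ?_⟩⟩
  · exact (LinearMap.congr_fun (congrArg (fun d : X.D => d.1.1) h) x).symm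
  · exact (LinearMap.congr_fun (congrArg (fun d : X.D => d.1.2) h) x).symm

/-- The endomorphism algebra of a brick as a division ring. -/
@[reducible] def IsBrick.divisionRing {X : BimodRep k F G M} (hX : X.IsBrick) : DivisionRing X.D :=
  have := hX.nontrivial
  DivisionRing.ofIsUnitOrEqZero hX.isUnit_or_eq_zero

instance [Module.Finite k F] (X : BimodRep k F G M) : Module.Finite k X.U :=
  Module.Finite.trans Fᵐᵒᵖ X.U

instance [Module.Finite k G] (X : BimodRep k F G M) : Module.Finite k X.V :=
  Module.Finite.trans Gᵐᵒᵖ X.V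

theorem finrank_U [Module.Finite k F] (X : BimodRep k F G M) :
    Module.finrank k X.U = Module.finrank k F * Module.finrank Fᵐᵒᵖ X.U := by
  rw [← Module.finrank_mul_finrank k Fᵐᵒᵖ X.U, finrank_op]

theorem finrank_V [Module.Finite k G] (X : BimodRep k F G M) :
    Module.finrank k X.V = Module.finrank k G * Module.finrank Gᵐᵒᵖ X.V := by
  rw [← Module.finrank_mul_finrank k Gᵐᵒᵖ X.V, finrank_op]

variable [Module.Finite k G]

theorem finite_balancedMaps (Z Y : BimodRep k F G M) [IsScalarTower k Gᵐᵒᵖ M]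
    [Module.Finite Gᵐᵒᵖ M] : Module.Finite k (balancedMaps Z Y) :=
  Module.Finite.of_injective _ (balancedEval_injective Z Y)

/-- An upper bound for the target of `extMap` suffices to force surjectivity by counting dimensions;
equality is not needed. -/
theorem finrank_balancedMaps_le (Z Y : BimodRep k F G M) [IsScalarTower k Gᵐᵒᵖ M]
    [Module.Finite Gᵐᵒᵖ M] : Module.finrank k (balancedMaps Z Y) ≤
      Module.finrank Fᵐᵒᵖ Z.U * (Module.finrank Gᵐᵒᵖ M * Module.finrank k Y.V) := by
  refine (LinearMap.finrank_le_finrank_of_injective (balancedEval_injective Z Y)).trans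
    (le_of_eq ?_)
  rw [Module.finrank_pi_fintype, finrank_linearMap_of_divisionRing k (V := M) (W := Y.V)]
  rw [Finset.sum_const, Finset.card_univ, Fintype.card_fin, smul_eq_mul]

variable [Module.Finite k F]

theorem finrank_homs (Z Y : BimodRep k F G M) :
    Module.finrank k ((Z.U →ₗ[Fᵐᵒᵖ] Y.U) × (Z.V →ₗ[Gᵐᵒᵖ] Y.V)) =
      Module.finrank Fᵐᵒᵖ Z.U * Module.finrank k Y.U +
        Module.finrank Gᵐᵒᵖ Z.V * Module.finrank k Y.V := by
  rw [Module.finrank_prod, finrank_linearMap_of_divisionRing k (V := Z.U) (W := Y.U),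
    finrank_linearMap_of_divisionRing k (V := Z.V) (W := Y.V)]

theorem surjective_of_finrank_le {k : Type*} [Field k] {V W : Type*} [AddCommGroup V]
    [AddCommGroup W] [Module k V] [Module k W] [Module.Finite k V] [Module.Finite k W] (f : V →ₗ[k] W)
    (h : Module.finrank k (LinearMap.ker f) + Module.finrank k W ≤ Module.finrank k V) :
    Function.Surjective f := by
  have := LinearMap.finrank_range_add_finrank_ker f
  rw [← LinearMap.range_eq_top]
  refine Submodule.eq_top_of_finrank_eq (le_antisymm (Submodule.finrank_le _) ?_)
  omega

/-- The hypothesis says that dim Hom(Z, Y) is at most the Euler form computed from dimension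
vectors; as that value is a lower bound for dim Hom - dim Ext¹, no room is left for Ext¹. -/
theorem extVanish_of_finrank_le (Z Y : BimodRep k F G M) [IsScalarTower k Gᵐᵒᵖ M]
    [Module.Finite Gᵐᵒᵖ M]
    (h : Module.finrank k (LinearMap.ker (extMap Z Y)) +
      Module.finrank Fᵐᵒᵖ Z.U * (Module.finrank Gᵐᵒᵖ M * Module.finrank k Y.V) ≤
      Module.finrank Fᵐᵒᵖ Z.U * Module.finrank k Y.U +
        Module.finrank Gᵐᵒᵖ Z.V * Module.finrank k Y.V) : ExtVanish Z Y := by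
  have := finite_balancedMaps Z Y
  refine surjective_of_finrank_le (k := k) (V := (Z.U →ₗ[Fᵐᵒᵖ] Y.U) × (Z.V →ₗ[Gᵐᵒᵖ] Y.V))
    (W := balancedMaps Z Y) (extMap Z Y) ?_
  rw [finrank_homs]
  exact (Nat.add_le_add_left (finrank_balancedMaps_le Z Y) _).trans h

instance (X : BimodRep k F G M) : Module.Finite k X.D :=
  Module.Finite.of_injective X.D.val.toLinearMap Subtype.val_injective

theorem IsBrick.finrank_U_eq {X : BimodRep k F G M} (hX : X.IsBrick) :
    Module.finrank k X.U = Module.finrank k X.D * Module.finrank X.D X.U := by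
  let := hX.divisionRing
  exact (Module.finrank_mul_finrank k X.D X.U).symm

theorem IsBrick.finrank_V_eq {X : BimodRep k F G M} (hX : X.IsBrick) :
    Module.finrank k X.V = Module.finrank k X.D * Module.finrank X.D X.V := by
  let := hX.divisionRing
  exact (Module.finrank_mul_finrank k X.D X.V).symm

end BimodRep

/-! ### Regular-simple representations of tame bimodules -/

namespace BimodRep

variable {k F G M : Type u} [Field k] [DivisionRing F] [DivisionRing G]
  [Algebra k F] [Algebra k G] [AddCommGroup M] [Module k M] [Module F M] [Module Gᵐᵒᵖ M]

/-- All non-zero quotients have positive defect. -/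
def IsTorsion (Y : BimodRep k F G M) : Prop :=
  ∀ (C : BimodRep k F G M) (p : Hom Y C), p.Surjective → ¬ C.IsZero → 0 < C.defect

/-- No subrepresentation has positive defect. -/
def IsTorsionFree (Z : BimodRep k F G M) : Prop :=
  ∀ (W : BimodRep k F G M) (i : Hom W Z), i.Injective → W.defect ≤ 0

theorem IsTorsion.of_surjective {Y C : BimodRep k F G M} (hY : Y.IsTorsion) {p : Hom Y C}
    (hp : p.Surjective) : C.IsTorsion :=
  fun D q hq => hY D (q.comp p) (hq.comp hp)

theorem IsTorsionFree.of_injective {Z W : BimodRep k F G M} (hZ : Z.IsTorsionFree) {i : Hom W Z}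
    (hi : i.Injective) : W.IsTorsionFree :=
  fun D j hj => hZ D (i.comp j) (hi.comp hj)

/-- The image of an endomorphism is a quotient of Y, hence torsion, and it is also a
subrepresentation; so it is zero or everything. -/
theorem IsTorsion.isBrick {Y : BimodRep k F G M} (hY : Y.IsTorsion) (h0 : ¬ Y.IsZero)
    (h : ∀ (A C : BimodRep k F G M) (i : Hom A Y) (p : Hom Y C), IsSES i p → A.IsTorsion →
      A.IsZero ∨ C.IsZero) : Y.IsBrick := by
  refine ⟨h0, fun f => ?_⟩
  obtain ⟨I, q, j, hq, hj, rfl⟩ := exists_image f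
  obtain ⟨C, p, hp⟩ := exists_cokernel j hj
  rcases h I C j p hp (hY.of_surjective hq) with hI | hC
  · left
    obtain ⟨_, _⟩ := hI
    refine ⟨fun x => ?_, fun x => ?_⟩
    · change j.u (q.u x) = 0
      rw [Subsingleton.elim (q.u x) 0, map_zero]
    · change j.v (q.v x) = 0
      rw [Subsingleton.elim (q.v x) 0, map_zero]
  · right
    have := hp.size_eq
    rw [C.size_eq_zero_iff.2 hC, add_zero] at this
    have hjs := hj.isIso this.le
    exact Hom.Surjective.isIso (Hom.Surjective.comp ⟨hjs.1.2, hjs.2.2⟩ hq)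

/-! ### Vanishing of Ext¹ from torsion-free to torsion representations -/

section Tame

variable [Module.Finite k F] [Module.Finite k G] [IsScalarTower k F M] [IsScalarTower k Gᵐᵒᵖ M]

/-- Computing dim_k M over F and over G and eliminating dim _F M by tameness gives this relation,
which is the vanishing of the discriminant of the quadratic form. -/
theorem _root_.IsTameBimodule.finrank_sq (hM : IsTameBimodule F G M) :
    ((Module.finrank Gᵐᵒᵖ M : ℤ)) ^ 2 * Module.finrank k G = 4 * Module.finrank k F := by
  have h₁ := Module.finrank_mul_finrank k F M
  have h₂ := Module.finrank_mul_finrank k Gᵐᵒᵖ M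
  rw [finrank_op, ← h₁] at h₂
  have h₃ : Module.finrank F M * Module.finrank Gᵐᵒᵖ M = 4 := hM
  zify at h₂ h₃
  linear_combination (Module.finrank Gᵐᵒᵖ M : ℤ) * h₂ + (Module.finrank k F : ℤ) * h₃

theorem _root_.IsTameBimodule.finrank_pos (hM : IsTameBimodule F G M) :
    0 < Module.finrank Gᵐᵒᵖ M := by
  refine Nat.pos_of_ne_zero fun h => ?_
  rw [IsTameBimodule, h, mul_zero] at hM
  omega

theorem _root_.IsTameBimodule.finite (hM : IsTameBimodule F G M) : Module.Finite Gᵐᵒᵖ M :=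
  Module.finite_of_finrank_pos hM.finrank_pos

/-- Expressing the Euler form through defects makes its sign visible. For Z = Y the last bracket is
the square of the defect. -/
theorem euler_eq (hM : IsTameBimodule F G M) (Z Y : BimodRep k F G M) :
    (Module.finrank Gᵐᵒᵖ M : ℤ) ^ 2 * (Module.finrank Fᵐᵒᵖ Z.U * Module.finrank k Y.U +
      Module.finrank Gᵐᵒᵖ Z.V * Module.finrank k Y.V -
      Module.finrank Fᵐᵒᵖ Z.U * (Module.finrank Gᵐᵒᵖ M * Module.finrank k Y.V)) =
    Module.finrank k F *
      (Module.finrank Gᵐᵒᵖ M * Module.finrank Fᵐᵒᵖ Z.U * Y.defect -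
        2 * Module.finrank Gᵐᵒᵖ Y.V * Z.defect) := by
  rw [finrank_U, finrank_V, defect, defect]
  have h := hM.finrank_sq (k := k)
  push_cast
  linear_combination (Module.finrank Gᵐᵒᵖ Z.V * Module.finrank Gᵐᵒᵖ Y.V -
    Module.finrank Gᵐᵒᵖ M * Module.finrank Fᵐᵒᵖ Z.U * Module.finrank Gᵐᵒᵖ Y.V : ℤ) * h

/-- Without homomorphisms the Euler form is at most -dim Ext¹(Z, Y), whereas the signs of the
defects make it non-negative. -/
theorem extVanish_of_hom_eq_zero (hM : IsTameBimodule F G M) {Z Y : BimodRep k F G M}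
    (hZ : Z.defect ≤ 0) (hY : 0 < Y.defect)
    (h : ∀ f : Hom Z Y, (∀ x, f.u x = 0) ∧ ∀ x, f.v x = 0) : ExtVanish Z Y := by
  have := hM.finite
  refine extVanish_of_finrank_le Z Y ?_
  rw [finrank_ker_eq_zero h, zero_add]
  have key := euler_eq hM Z Y
  have hpos : 0 < (Module.finrank Gᵐᵒᵖ M : ℤ) ^ 2 := by
    have := hM.finrank_pos
    positivity
  have hnn : (0 : ℤ) ≤ Module.finrank k F *
      (Module.finrank Gᵐᵒᵖ M * Module.finrank Fᵐᵒᵖ Z.U * Y.defect -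
        2 * Module.finrank Gᵐᵒᵖ Y.V * Z.defect) := by
    refine mul_nonneg (Int.natCast_nonneg _) (sub_nonneg.2 (le_trans (b := 0) ?_ ?_))
    · exact mul_nonpos_of_nonneg_of_nonpos (by positivity) hZ
    · positivity
  rw [← key] at hnn
  have := nonneg_of_mul_nonneg_right hnn hpos
  zify
  linarith

/-- The Euler form at (Y, Y) is positive, and it is a multiple of dim End(Y) because U and V are
vector spaces over the division ring End(Y). Hence it is at least dim End(Y). -/
theorem IsBrick.extVanish_self (hM : IsTameBimodule F G M) {Y : BimodRep k F G M}
    (hY : Y.IsBrick) (hdef : Y.defect ≠ 0) : ExtVanish Y Y := by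
  have := hM.finite
  refine extVanish_of_finrank_le Y Y ?_
  rw [(kerExtMapEquiv Y).finrank_eq]
  have key := euler_eq hM Y Y
  have hF : 0 < (Module.finrank k F : ℤ) := by exact_mod_cast Module.finrank_pos
  have hpos : 0 < (Module.finrank Gᵐᵒᵖ M : ℤ) ^ 2 := by
    have := hM.finrank_pos
    positivity
  have hsq : (Module.finrank Gᵐᵒᵖ M * Module.finrank Fᵐᵒᵖ Y.U * Y.defect -
        2 * Module.finrank Gᵐᵒᵖ Y.V * Y.defect : ℤ) = Y.defect ^ 2 := by
    rw [defect]
    ring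
  rw [hsq] at key
  have hnum := pos_of_mul_pos_right (key ▸ mul_pos hF (by positivity)) hpos.le
  have hdvd : (Module.finrank k Y.D : ℤ) ∣ Module.finrank Fᵐᵒᵖ Y.U * Module.finrank k Y.U +
      Module.finrank Gᵐᵒᵖ Y.V * Module.finrank k Y.V -
      Module.finrank Fᵐᵒᵖ Y.U * (Module.finrank Gᵐᵒᵖ M * Module.finrank k Y.V) := by
    have h₁ : (Module.finrank k Y.D : ℤ) ∣ Module.finrank k Y.U := by
      exact_mod_cast Dvd.intro _ hY.finrank_U_eq.symm
    have h₂ : (Module.finrank k Y.D : ℤ) ∣ Module.finrank k Y.V := by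
      exact_mod_cast Dvd.intro _ hY.finrank_V_eq.symm
    exact dvd_sub (dvd_add (h₁.mul_left _) (h₂.mul_left _)) ((h₂.mul_left _).mul_left _)
  have := Int.le_of_dvd hnum hdvd
  zify
  linarith

/-- Induction on the size of Y reduces to a Y without proper non-zero torsion subrepresentations,
which is a brick of positive defect with no self-extensions. For such Y, induction on the size of Z
reduces to the case Hom(Z, Y) = 0, settled by the sign of the Euler form. -/
theorem extVanish_of_isTorsion (hM : IsTameBimodule F G M) (n : ℕ) :
    ∀ Y : BimodRep k F G M, Y.size = n → Y.IsTorsion → ∀ Z : BimodRep k F G M, Z.IsTorsionFree →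
      ExtVanish Z Y := by
  induction n using Nat.strong_induction_on with
  | _ n ih =>
  intro Y hn hY
  by_cases h0 : Y.IsZero
  · intro Z _
    rw [extVanish_iff]
    have := h0.2
    exact fun β => ⟨0, 0, fun x m => Subsingleton.elim _ _⟩
  by_cases hred : ∀ (A C : BimodRep k F G M) (i : Hom A Y) (p : Hom Y C), IsSES i p →
      A.IsTorsion → A.IsZero ∨ C.IsZero
  · have hbrick := hY.isBrick h0 hred
    have hdef : 0 < Y.defect := hY Y (Hom.id Y) ⟨Function.surjective_id, Function.surjective_id⟩ h0
    have hself := hbrick.extVanish_self hM hdef.ne'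
    suffices H : ∀ m, ∀ Z : BimodRep k F G M, Z.size = m → Z.IsTorsionFree → ExtVanish Z Y from
      fun Z => H _ Z rfl
    intro m
    induction m using Nat.strong_induction_on with
    | _ m ihm =>
    intro Z hm hZ
    by_cases hhom : ∀ f : Hom Z Y, (∀ x, f.u x = 0) ∧ ∀ x, f.v x = 0
    · exact extVanish_of_hom_eq_zero hM
        (hZ Z (Hom.id Z) ⟨Function.injective_id, Function.injective_id⟩) hdef hhom
    · obtain ⟨f, hf⟩ := not_forall.1 hhom
      -- The image I embeds in Y, so Ext¹(I, Y) = 0 follows from Ext¹(Y, Y) = 0; the kernel is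
      -- torsion-free and smaller than Z.
      obtain ⟨I, q, j, hq, hj, rfl⟩ := exists_image f
      obtain ⟨K, i, hi⟩ := exists_kernel q hq
      have hI : I.size ≠ 0 := by
        rw [Ne, size_eq_zero_iff]
        rintro ⟨_, _⟩
        refine hf ⟨fun x => ?_, fun x => ?_⟩
        · change j.u (q.u x) = 0
          rw [Subsingleton.elim (q.u x) 0, map_zero]
        · change j.v (q.v x) = 0
          rw [Subsingleton.elim (q.v x) 0, map_zero]
      have := hi.size_eq
      exact ExtVanish.middle_left hi (ihm K.size (by omega) K rfl (hZ.of_injective hi.inj))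
        (ExtVanish.of_injective hj hself)
  · push Not at hred
    obtain ⟨A, C, i, p, hip, hA, hA0, hC0⟩ := hred
    rw [← size_eq_zero_iff] at hA0 hC0
    have := hip.size_eq
    intro Z hZ
    exact ExtVanish.middle_right hip (ih A.size (by omega) A rfl hA Z hZ)
      (ih C.size (by omega) C rfl (hY.of_surjective hip.surj) Z hZ)

/-- The subrepresentations of an indecomposable representation of defect zero have non-positive
defect. -/
theorem IsIndecomposable.isTorsionFree (hM : IsTameBimodule F G M) {X : BimodRep k F G M}
    (hX : X.IsIndecomposable) (hdef : X.defect = 0) : X.IsTorsionFree := by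
  by_contra hne
  rw [IsTorsionFree] at hne
  push Not at hne
  obtain ⟨W, i, hi, hW⟩ := hne
  have hbound (A : BimodRep k F G M) (i : Hom A X) (hi : i.Injective) :
      A.defect ≤ Module.finrank Gᵐᵒᵖ M * Module.finrank Fᵐᵒᵖ X.U := by
    have := LinearMap.finrank_le_finrank_of_injective hi.1
    have h2 : Module.finrank Gᵐᵒᵖ M * Module.finrank Fᵐᵒᵖ A.U ≤
      Module.finrank Gᵐᵒᵖ M * Module.finrank Fᵐᵒᵖ X.U := Nat.mul_le_mul_left _ this
    zify at h2
    rw [defect]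
    linarith [Int.natCast_nonneg (Module.finrank Gᵐᵒᵖ A.V)]
  -- As for a maximal destabilising subobject: maximise the defect first, then minimise the size.
  obtain ⟨d, ⟨A, iA, hA, rfl⟩, hmax⟩ := Int.exists_greatest_of_bdd
    (P := fun d => ∃ (A : BimodRep k F G M) (i : Hom A X), i.Injective ∧ A.defect = d)
    ⟨_, by rintro _ ⟨A, i, hi, rfl⟩; exact hbound A i hi⟩ ⟨_, W, i, hi, rfl⟩
  have hpos : 0 < A.defect := hW.trans_le (hmax _ ⟨W, i, hi, rfl⟩)
  classical
  have hex : ∃ n, ∃ (Y : BimodRep k F G M) (j : Hom Y X), j.Injective ∧ Y.defect = A.defect ∧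
      Y.size = n := ⟨_, A, iA, hA, rfl, rfl⟩
  obtain ⟨Y, j, hj, hYdef, hYsize⟩ := Nat.find_spec hex
  -- Maximality gives every quotient of Y non-negative defect; a non-zero quotient of defect zero
  -- would leave a smaller kernel of the same maximal defect.
  have hYtor : Y.IsTorsion := by
    intro C p hp hC
    obtain ⟨K, l, hl⟩ := exists_kernel p hp
    have hK := hmax _ ⟨K, j.comp l, hj.comp hl.inj, rfl⟩
    have hdef := hl.defect_eq
    refine lt_of_le_of_ne (by omega) fun hC0 => ?_
    have hsize := hl.size_eq
    rw [← size_eq_zero_iff] at hC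
    have := Nat.find_min' hex ⟨K, j.comp l, hj.comp hl.inj, by omega, rfl⟩
    omega
  obtain ⟨Z, p, hp⟩ := exists_cokernel j hj
  -- A subrepresentation of X/Y of positive defect would have a preimage in X of defect larger than
  -- that of Y.
  have hZ : Z.IsTorsionFree := by
    intro W i hi
    obtain ⟨C, q, hq⟩ := exists_cokernel i hi
    obtain ⟨W', l, hl⟩ := exists_kernel (q.comp p) (hq.surj.comp hp.surj)
    have h₁ := hmax _ ⟨W', l, hl.inj, rfl⟩
    have h₂ := hl.defect_eq
    have h₃ := hq.defect_eq
    have h₄ := hp.defect_eq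
    omega
  obtain ⟨r, hru, hrv⟩ := hp.exists_retraction (extVanish_of_isTorsion hM _ Y rfl hYtor Z hZ)
  have hidem : (j.comp r).toD * (j.comp r).toD = (j.comp r).toD :=
    Subtype.ext (Prod.ext (LinearMap.ext fun x => congrArg j.u (hru (r.u x)))
      (LinearMap.ext fun x => congrArg j.v (hrv (r.v x))))
  rcases hX.2 _ hidem with h | h
  · have hu (x : X.U) : j.u (r.u x) = 0 :=
      LinearMap.congr_fun (congrArg (fun d : X.D => d.1.1) h) x
    have hv (x : X.V) : j.v (r.v x) = 0 :=
      LinearMap.congr_fun (congrArg (fun d : X.D => d.1.2) h) x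
    have hY0 : Y.IsZero := by
      refine ⟨subsingleton_of_forall_eq 0 fun x => ?_, subsingleton_of_forall_eq 0 fun x => ?_⟩
      · rw [← hru x, ← map_zero r.u]
        exact congrArg r.u ((congrArg j.u (hru x)).symm.trans (hu (j.u x)))
      · rw [← hrv x, ← map_zero r.v]
        exact congrArg r.v ((congrArg j.v (hrv x)).symm.trans (hv (j.v x)))
    have := hY0.defect_eq_zero
    omega
  · have hu (x : X.U) : j.u (r.u x) = x :=
      LinearMap.congr_fun (congrArg (fun d : X.D => d.1.1) h) x
    have hv (x : X.V) : j.v (r.v x) = x :=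
      LinearMap.congr_fun (congrArg (fun d : X.D => d.1.2) h) x
    have hiso : j.IsIso := ⟨⟨hj.1, fun x => ⟨_, hu x⟩⟩, ⟨hj.2, fun x => ⟨_, hv x⟩⟩⟩
    have := hiso.defect_eq
    omega

end Tame

/-! ### Regular-simple representations are indecomposable of defect zero -/

theorem IsSummand.trans {X Y Z : BimodRep k F G M} (h : IsSummand X Y) (h' : IsSummand Y Z) :
    IsSummand X Z := by
  obtain ⟨i, r, hu, hv⟩ := h
  obtain ⟨j, s, hu', hv'⟩ := h'
  exact ⟨j.comp i, r.comp s, fun x => (congrArg r.u (hu' (i.u x))).trans (hu x),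
    fun x => (congrArg r.v (hv' (i.v x))).trans (hv x)⟩

theorem IsSummand.refl (X : BimodRep k F G M) : IsSummand X X :=
  ⟨Hom.id X, Hom.id X, fun _ => rfl, fun _ => rfl⟩

/-- The image of an idempotent endomorphism is a direct summand, hence again regular, so simplicity
among regular representations applies to it. -/
theorem IsRegularSimple.isIndecomposable {X : BimodRep k F G M} (hX : X.IsRegularSimple) :
    X.IsIndecomposable := by
  refine ⟨hX.2.1, fun e he => ?_⟩
  have heu (x : X.U) : e.1.1 (e.1.1 x) = e.1.1 x :=
    LinearMap.congr_fun (congrArg (fun d : X.D => d.1.1) he) x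
  have hev (x : X.V) : e.1.2 (e.1.2 x) = e.1.2 x :=
    LinearMap.congr_fun (congrArg (fun d : X.D => d.1.2) he) x
  obtain ⟨I, q, j, hq, hj, hjq⟩ := exists_image (Hom.ofD e)
  have hu (x : X.U) : j.u (q.u x) = e.1.1 x := congrArg (fun f : Hom X X => f.u x) hjq
  have hv (x : X.V) : j.v (q.v x) = e.1.2 x := congrArg (fun f : Hom X X => f.v x) hjq
  have hI : IsSummand I X := by
    refine ⟨j, q, fun x => ?_, fun x => ?_⟩
    · obtain ⟨y, rfl⟩ := hq.1 x
      apply hj.1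
      rw [hu, hu, heu]
    · obtain ⟨y, rfl⟩ := hq.2 x
      apply hj.2
      rw [hv, hv, hev]
  rcases hX.2.2 I j (fun Y hY hYI => hX.1 Y hY (hYI.trans hI)) hj with h | h
  · left
    obtain ⟨_, _⟩ := h
    refine Subtype.ext (Prod.ext (LinearMap.ext fun x => ?_) (LinearMap.ext fun x => ?_))
    · rw [← hu, Subsingleton.elim (q.u x) 0, map_zero]
      rfl
    · rw [← hv, Subsingleton.elim (q.v x) 0, map_zero]
      rfl
  · right
    refine Subtype.ext (Prod.ext (LinearMap.ext fun x => ?_) (LinearMap.ext fun x => ?_))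
    · obtain ⟨y, rfl⟩ := (h.1.2.comp hq.1) x
      change e.1.1 (j.u (q.u y)) = j.u (q.u y)
      rw [hu, heu]
    · obtain ⟨y, rfl⟩ := (h.2.2.comp hq.2) x
      change e.1.2 (j.v (q.v y)) = j.v (q.v y)
      rw [hv, hev]

theorem _root_.IsTameBimodule.epsilon_mul (hM : IsTameBimodule F G M) :
    bimoduleEpsilon F G M * Module.finrank Gᵐᵒᵖ M = 2 := by
  have h : (Module.finrank F M : ℝ) * Module.finrank Gᵐᵒᵖ M = 4 := by exact_mod_cast hM
  have hb : (0 : ℝ) < Module.finrank Gᵐᵒᵖ M := by exact_mod_cast hM.finrank_pos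
  have : (Module.finrank F M : ℝ) / Module.finrank Gᵐᵒᵖ M = (2 / Module.finrank Gᵐᵒᵖ M) ^ 2 := by
    field_simp
    linarith
  rw [bimoduleEpsilon, this, Real.sqrt_sq (by positivity)]
  field_simp

theorem defect_eq_zero_iff (hM : IsTameBimodule F G M) (X : BimodRep k F G M) :
    X.defect = 0 ↔ (Module.finrank Fᵐᵒᵖ X.U : ℝ) =
      bimoduleEpsilon F G M * Module.finrank Gᵐᵒᵖ X.V := by
  have hb : (Module.finrank Gᵐᵒᵖ M : ℝ) ≠ 0 := by exact_mod_cast hM.finrank_pos.ne'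
  have he := hM.epsilon_mul
  rw [← mul_right_inj' hb, defect, ← Int.cast_inj (α := ℝ)]
  push_cast
  constructor
  · intro h
    linear_combination h - Module.finrank Gᵐᵒᵖ X.V * he
  · intro h
    linear_combination h + Module.finrank Gᵐᵒᵖ X.V * he

theorem IsRegularSimple.defect_eq_zero {X : BimodRep k F G M} (hM : IsTameBimodule F G M)
    (hX : X.IsRegularSimple) : X.defect = 0 :=
  (defect_eq_zero_iff hM X).2 (hX.1 X hX.isIndecomposable (.refl X))

/-! ### Regular-simple representations: division endomorphism rings and surjective structure maps -/

section Tame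

variable [Module.Finite k F] [Module.Finite k G] [IsScalarTower k F M] [IsScalarTower k Gᵐᵒᵖ M]

namespace IsRegularSimple

variable {X : BimodRep k F G M}

theorem isTorsionFree (hM : IsTameBimodule F G M) (hX : X.IsRegularSimple) : X.IsTorsionFree :=
  hX.isIndecomposable.isTorsionFree hM (hX.defect_eq_zero hM)

/-- Kernel and image of an endomorphism are subrepresentations, so both defects are non-positive;
they add up to zero and therefore vanish. The same argument applied to summands shows that the image
is regular, and simplicity finishes as in Schur's lemma. -/
theorem isBrick (hM : IsTameBimodule F G M) (hX : X.IsRegularSimple) : X.IsBrick := by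
  refine ⟨hX.2.1, fun f => ?_⟩
  obtain ⟨I, q, j, hq, hj, rfl⟩ := exists_image f
  obtain ⟨K, i, hi⟩ := exists_kernel q hq
  have hfree := hX.isTorsionFree hM
  have hdef : I.defect = 0 := by
    have h₁ := hfree K i hi.inj
    have h₂ := hfree I j hj
    have h₃ := hi.defect_eq
    rw [hX.defect_eq_zero hM] at h₃
    omega
  have hreg : I.IsRegular := by
    rintro S hS ⟨l, r, hu, hv⟩
    rw [← defect_eq_zero_iff hM]
    obtain ⟨K', i', hi'⟩ := exists_kernel r ⟨fun x => ⟨_, hu x⟩, fun x => ⟨_, hv x⟩⟩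
    have h₁ := hfree K' (j.comp i') (hj.comp hi'.inj)
    have h₂ := hfree S (j.comp l) (hj.comp
      ⟨Function.LeftInverse.injective hu, Function.LeftInverse.injective hv⟩)
    have h₃ := hi'.defect_eq
    omega
  rcases hX.2.2 I j hreg hj with h | h
  · left
    obtain ⟨_, _⟩ := h
    refine ⟨fun x => ?_, fun x => ?_⟩
    · change j.u (q.u x) = 0
      rw [Subsingleton.elim (q.u x) 0, map_zero]
    · change j.v (q.v x) = 0
      rw [Subsingleton.elim (q.v x) 0, map_zero]
  · right
    exact Hom.Surjective.isIso (Hom.Surjective.comp ⟨h.1.2, h.2.2⟩ hq)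

/-- If the image of the structure map were smaller than V, then U together with this image would be
a subrepresentation of positive defect. -/
theorem span_range (hM : IsTameBimodule F G M) (hX : X.IsRegularSimple) :
    Submodule.span Gᵐᵒᵖ {y | ∃ x m, X.ρ x m = y} = ⊤ := by
  set Q := Submodule.span Gᵐᵒᵖ {y | ∃ x m, X.ρ x m = y}
  have h : ∀ x ∈ (⊤ : Submodule Fᵐᵒᵖ X.U), ∀ m, X.ρ x m ∈ Q :=
    fun x _ m => Submodule.subset_span ⟨x, m, rfl⟩
  have h₁ := hX.isTorsionFree hM _ _ (X.subHom_injective ⊤ Q h)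
  have h₂ := hX.defect_eq_zero hM
  have h₃ : (X.sub ⊤ Q h).defect = Module.finrank Gᵐᵒᵖ M * Module.finrank Fᵐᵒᵖ X.U -
      2 * Module.finrank Gᵐᵒᵖ Q := by
    change (Module.finrank Gᵐᵒᵖ M * Module.finrank Fᵐᵒᵖ (⊤ : Submodule Fᵐᵒᵖ X.U) - _ : ℤ) = _
    rw [finrank_top]
    rfl
  rw [defect] at h₂
  refine Submodule.eq_top_of_finrank_eq (le_antisymm (Submodule.finrank_le Q) ?_)
  omega

end IsRegularSimple

end Tame

end BimodRep

/-! ### Dimensions of the blocks of a canonical algebra -/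

namespace BimodRep

variable {k F G M : Type u} [Field k] [DivisionRing F] [DivisionRing G]
  [Algebra k F] [Algebra k G] [AddCommGroup M] [Module k M] [Module F M] [Module Gᵐᵒᵖ M]

section Tensor

variable (X : BimodRep k F G M)

theorem tmul_op_smul (x : X.U) (f : F) (m : M) : X.tmul (op f • x) m = X.tmul x (f • m) := by
  rw [← sub_eq_zero, tmul, tmul, ← map_sub, Submodule.mkQ_apply, Submodule.Quotient.mk_eq_zero]
  exact Submodule.subset_span ⟨x, f, m, rfl⟩

/-- The map `x ⊗ m ↦ (x_j m)_j`, where the `x_j` are the coordinates of `x` in a basis of `U_F`. -/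
def tensorCoord [IsScalarTower k F M] :
    X.Tensor →ₗ[k] (Fin (Module.finrank Fᵐᵒᵖ X.U) → M) :=
  X.tensorRel.liftQ (TensorProduct.lift (LinearMap.mk₂ k
    (fun x m j => ((Module.finBasis Fᵐᵒᵖ X.U).repr x j).unop • m)
    (fun x y m => funext fun j => by simp [add_smul])
    (fun c x m => funext fun j => by
      have h : (Module.finBasis Fᵐᵒᵖ X.U).repr (c • x) j =
          c • (Module.finBasis Fᵐᵒᵖ X.U).repr x j :=
        LinearMap.map_smul_of_tower ((Module.finBasis Fᵐᵒᵖ X.U).coord j) c x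
      rw [h, unop_smul, smul_assoc]
      rfl)
    (fun x m n => funext fun j => by simp)
    (fun c x m => funext fun j => smul_comm _ c m))) (by
    rw [tensorRel, Submodule.span_le]
    rintro _ ⟨x, f, m, rfl⟩
    rw [SetLike.mem_coe, LinearMap.mem_ker, map_sub, sub_eq_zero]
    funext j
    simp [mul_smul])

theorem tensorCoord_tmul [IsScalarTower k F M] (x : X.U) (m : M)
    (j : Fin (Module.finrank Fᵐᵒᵖ X.U)) :
    X.tensorCoord (X.tmul x m) j = ((Module.finBasis Fᵐᵒᵖ X.U).repr x j).unop • m := rfl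

/-- The map `(m_j)_j ↦ ∑ x_j ⊗ m_j`, where the `x_j` form a basis of `U_F`. -/
def tensorOfCoord : (Fin (Module.finrank Fᵐᵒᵖ X.U) → M) →ₗ[k] X.Tensor :=
  ∑ j, (X.tensorRel.mkQ ∘ₗ TensorProduct.mk k X.U M (Module.finBasis Fᵐᵒᵖ X.U j)) ∘ₗ
    LinearMap.proj j

theorem tensorOfCoord_apply (m : Fin (Module.finrank Fᵐᵒᵖ X.U) → M) :
    X.tensorOfCoord m = ∑ j, X.tmul (Module.finBasis Fᵐᵒᵖ X.U j) (m j) := by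
  rw [tensorOfCoord, LinearMap.sum_apply]
  rfl

theorem tensorOfCoord_tensorCoord [IsScalarTower k F M] (z : X.Tensor) :
    X.tensorOfCoord (X.tensorCoord z) = z := by
  refine DFunLike.congr_fun (tensor_hom_ext
    (f := (X.tensorOfCoord ∘ₗ X.tensorCoord).toAddMonoidHom)
    (g := AddMonoidHom.id _) fun x m => ?_) z
  change X.tensorOfCoord (X.tensorCoord (X.tmul x m)) = X.tmul x m
  rw [tensorOfCoord_apply]
  simp only [tensorCoord_tmul, ← tmul_op_smul, op_unop]
  conv_rhs => rw [← (Module.finBasis Fᵐᵒᵖ X.U).sum_repr x]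
  simp only [tmul, TensorProduct.sum_tmul, map_sum]

theorem tensorCoord_tensorOfCoord [IsScalarTower k F M]
    (m : Fin (Module.finrank Fᵐᵒᵖ X.U) → M) : X.tensorCoord (X.tensorOfCoord m) = m := by
  funext i
  rw [tensorOfCoord_apply, map_sum, Finset.sum_apply, Finset.sum_eq_single i]
  · rw [tensorCoord_tmul]
    simp
  · intro j _ hj
    rw [tensorCoord_tmul]
    simp [hj]
  · simp

/-- The choice of a basis of `U_F` identifies `U ⊗_F M` with a power of `M`. -/
def tensorEquiv [IsScalarTower k F M] :
    X.Tensor ≃ₗ[k] (Fin (Module.finrank Fᵐᵒᵖ X.U) → M) :=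
  LinearEquiv.ofLinearMap X.tensorCoord X.tensorOfCoord
    (LinearMap.ext X.tensorCoord_tensorOfCoord) (LinearMap.ext X.tensorOfCoord_tensorCoord)

theorem finrank_UStar [Module.Finite k F] : Module.finrank k X.UStar = Module.finrank k X.U := by
  rw [finrank_linearMap_of_divisionRing k, finrank_U, mul_comm]

end Tensor

section Tame

variable [Module.Finite k F] [Module.Finite k G] [IsScalarTower k F M] [IsScalarTower k Gᵐᵒᵖ M]

theorem _root_.IsTameBimodule.finrank_eq (hM : IsTameBimodule F G M) :
    Module.Finite k M ∧ Module.finrank k M = Module.finrank k F * Module.finrank F M ∧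
      Module.finrank k M = Module.finrank k G * Module.finrank Gᵐᵒᵖ M := by
  have := hM.finite
  refine ⟨Module.Finite.trans Gᵐᵒᵖ M, (Module.finrank_mul_finrank k F M).symm, ?_⟩
  rw [← Module.finrank_mul_finrank k Gᵐᵒᵖ M, finrank_op]

variable [SMulCommClass F Gᵐᵒᵖ M] {X : BimodRep k F G M}

theorem IsRegularSimple.rhoTensor_surjective (hM : IsTameBimodule F G M)
    (hX : X.IsRegularSimple) : Function.Surjective X.rhoTensor := by
  let ρ' : X.Tensor →ₗ[Gᵐᵒᵖ] X.V :=
    { X.rhoTensor with map_smul' := fun g z => X.rhoTensor_op_smul g z }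
  have h : LinearMap.range ρ' = ⊤ := by
    rw [← top_le_iff, ← hX.span_range hM, Submodule.span_le]
    rintro _ ⟨x, m, rfl⟩
    exact ⟨X.tmul x m, rfl⟩
  intro y
  obtain ⟨z, hz⟩ := LinearMap.range_eq_top.1 h y
  exact ⟨z, hz⟩

/-- Defect zero says that U ⊗_F M has twice the dimension of V; the map onto V is surjective, so its
kernel is as large as V. -/
theorem IsRegularSimple.finrank_VPlus (hM : IsTameBimodule F G M) (hX : X.IsRegularSimple) :
    Module.Finite k X.VPlus ∧ Module.finrank k X.VPlus = Module.finrank k X.V := by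
  obtain ⟨hfin, -, hdim⟩ := hM.finrank_eq (k := k)
  have hT : Module.Finite k X.Tensor := Module.Finite.equiv X.tensorEquiv.symm
  refine ⟨inferInstanceAs (Module.Finite k (LinearMap.ker X.rhoTensor)), ?_⟩
  have h₁ := LinearMap.finrank_range_add_finrank_ker X.rhoTensor
  rw [LinearMap.range_eq_top.2 (hX.rhoTensor_surjective hM), finrank_top,
    X.tensorEquiv.finrank_eq, Module.finrank_pi_fintype, Finset.sum_const, Finset.card_univ,
    Fintype.card_fin, smul_eq_mul, hdim, finrank_V] at h₁
  have h₂ := hX.defect_eq_zero hM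
  rw [defect] at h₂
  rw [finrank_V]
  change Module.finrank k (LinearMap.ker X.rhoTensor) = _
  zify at h₁ ⊢
  linear_combination h₁ + Module.finrank k G * h₂

end Tame

end BimodRep

/-! ### Opposite algebras -/

namespace TriangularIdempotents

variable {A : Type u} [Ring A] {ι : Type} [Fintype ι]

/-- The idempotents `e x` of the opposite ring, with the opposite order. -/
def opposite (T : TriangularIdempotents A ι)
    (rightInv : ∀ x a, T.e x * a * T.e x ≠ 0 → ∃ b, (T.e x * a * T.e x) * b = T.e x) :
    TriangularIdempotents Aᵐᵒᵖ ι where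
  e x := op (T.e x)
  -- The sum of all heights bounds each of them, so the truncated subtraction reverses the order.
  h x := ∑ y, T.h y - T.h x
  complete :=
    { idem := fun x => by
        rw [IsIdempotentElem, ← op_mul, T.e_mul_e]
      ortho := fun x y hxy => by
        change op (T.e x) * op (T.e y) = 0
        rw [← op_mul, T.complete.ortho hxy.symm, op_zero]
      complete := by
        rw [← Finset.op_sum, T.complete.complete, op_one] }
  ne_zero x h := T.ne_zero x (op_injective h)
  triangular x y a h := by
    have h' : T.e y * a.unop * T.e x ≠ 0 := fun h0 => h (by
      rw [mul_assoc] at h0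
      exact unop_injective h0)
    refine (T.triangular y x _ h').imp Eq.symm fun hlt => ?_
    have hx := Finset.single_le_sum (f := T.h) (fun _ _ => Nat.zero_le _) (Finset.mem_univ x)
    omega
  leftInv x a h := by
    obtain ⟨b, hb⟩ := rightInv x a.unop fun h0 => h (by
      rw [mul_assoc] at h0
      exact unop_injective h0)
    refine ⟨op b, unop_injective ?_⟩
    rw [mul_assoc] at hb
    exact (congrArg (· * b) (mul_assoc _ _ _)).symm.trans (by simpa [mul_assoc] using hb)

theorem finrank_peirce₂_opposite (k : Type u) [Field k] [Algebra k A]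
    (T : TriangularIdempotents A ι)
    (h : ∀ x a, T.e x * a * T.e x ≠ 0 → ∃ b, (T.e x * a * T.e x) * b = T.e x) (x y : ι) :
    Module.finrank k ((T.opposite h).peirce₂ k x y) = Module.finrank k (T.peirce₂ k y x) := by
  refine LinearEquiv.finrank_eq (LinearEquiv.ofSubmodules (MulOpposite.opLinearEquiv k).symm _ _ ?_)
  ext a
  rw [Submodule.mem_map_equiv, mem_peirce₂, mem_peirce₂]
  change op (T.e x) * op a * op (T.e y) = op a ↔ _
  rw [← op_mul, ← op_mul, op_inj, mul_assoc]

theorem finrank_peirce₂_of_range {k : Type u} [Field k] [Algebra k A]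
    (T : TriangularIdempotents A ι) {x y : ι} {W : Type*} [AddCommGroup W] [Module k W]
    (f : W →ₗ[k] A) (hf : Function.Injective f) (h₁ : ∀ w, T.e x * f w * T.e y = f w)
    (h₂ : ∀ a, ∃ w, T.e x * a * T.e y = f w) :
    Module.finrank k (T.peirce₂ k x y) = Module.finrank k W := by
  have h : T.peirce₂ k x y = LinearMap.range f := by
    ext a
    constructor
    · intro ha
      obtain ⟨w, hw⟩ := h₂ a
      exact ⟨w, hw.symm.trans ha⟩
    · rintro ⟨w, rfl⟩
      exact h₁ w
  rw [h, LinearMap.finrank_range_of_inj hf]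

end TriangularIdempotents

/-! ### The Peirce decomposition of a canonical algebra -/

namespace Vertex

variable {t : ℕ} {p : Fin t → ℕ}

/-- The vertices form a disjoint union. -/
def equivSum (p : Fin t → ℕ) : Vertex p ≃ Unit ⊕ Unit ⊕ (Σ i, Fin (p i - 1)) where
  toFun
    | .first => .inl ()
    | .last => .inr (.inl ())
    | .mid i j => .inr (.inr ⟨i, j⟩)
  invFun
    | .inl _ => .first
    | .inr (.inl _) => .last
    | .inr (.inr x) => .mid x.1 x.2
  left_inv x := by cases x <;> rfl
  right_inv x := by rcases x with _ | _ | _ <;> rfl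

instance : Fintype (Vertex p) := Fintype.ofEquiv _ (equivSum p).symm

theorem sum_eq {A : Type*} [AddCommMonoid A] (f : Vertex p → A) :
    ∑ x, f x = f .first + (f .last + ∑ i, ∑ r, f (.mid i r)) := by
  rw [← (equivSum p).symm.sum_comp, Fintype.sum_sum_type, Fintype.sum_sum_type,
    Fintype.sum_sigma, Fintype.sum_unique, Fintype.sum_unique]
  rfl

/-- The distance to the first vertex, with a large value for the last vertex. -/
def height : Vertex p → ℕ
  | .first => 0
  | .last => 1 + ∑ i, p i
  | .mid _ r => r + 1

theorem height_mid_lt_last (i : Fin t) (r : Fin (p i - 1)) :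
    height (.mid i r : Vertex p) < height (.last : Vertex p) := by
  have := Finset.single_le_sum (f := p) (fun _ _ => Nat.zero_le _) (Finset.mem_univ i)
  simp only [height]
  omega

end Vertex

namespace BimodRep

variable {k F G M : Type u} [Field k] [DivisionRing F] [DivisionRing G]
  [Algebra k F] [Algebra k G] [AddCommGroup M] [Module k M] [Module F M] [Module Gᵐᵒᵖ M]
  (X : BimodRep k F G M) {n : ℕ}

theorem rowMul_single_one (φ : Fin n → X.UStar) (r : Fin n) :
    X.rowMul φ (Matrix.single r r 1) = Pi.single r (φ r) := by
  funext s
  rw [rowMul, Finset.sum_eq_single r]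
  · by_cases h : s = r
    · subst h
      rw [Matrix.single_apply_same, Pi.single_eq_same]
      rfl
    · rw [Matrix.single_apply_of_col_ne _ _ (Ne.symm h), Pi.single_eq_of_ne h]
      exact LinearMap.comp_zero _
  · intro q _ hq
    rw [Matrix.single_apply_of_row_ne (Ne.symm hq)]
    exact LinearMap.comp_zero _
  · simp

theorem single_one_colMul (z : Fin n → X.VPlus) (r : Fin n) :
    X.colMul (Matrix.single r r 1) z = Pi.single r (z r) := by
  funext s
  rw [colMul, Finset.sum_eq_single r]
  · by_cases h : s = r
    · subst h
      rw [Matrix.single_apply_same, Pi.single_eq_same, one_smul]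
    · rw [Matrix.single_apply_of_row_ne (Ne.symm h), Pi.single_eq_of_ne h, zero_smul]
  · intro q _ hq
    rw [Matrix.single_apply_of_col_ne _ _ (Ne.symm hq), zero_smul]
  · simp

end BimodRep

namespace CanonicalAlgebra

variable {k F G M : Type u} [Field k] [DivisionRing F] [DivisionRing G]
  [Algebra k F] [Algebra k G] [AddCommGroup M] [Module k M] [Module F M] [Module Gᵐᵒᵖ M]
  {t : ℕ} {p : Fin t → ℕ} {R : Fin t → BimodRep k F G M}

/-- The matrix over `D` with a single entry. -/
def single (X : BimodRep k F G M) {n : ℕ} (r s : Fin n) (h : r ≤ s) (d : X.D) :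
    Matrix.blockTriangularSubalgebra k X.D (id : Fin n → Fin n) :=
  ⟨Matrix.single r s d, Matrix.blockTriangular_single h d⟩

theorem finite [Module.Finite k F] [Module.Finite k G] [Module.Finite k M]
    (hV : ∀ i, Module.Finite k (R i).VPlus) : Module.Finite k (CanonicalAlgebra p R) := by
  have := hV
  have (i : Fin t) : Module.Finite k (Matrix.blockTriangularSubalgebra k (R i).D
      (id : Fin (p i - 1) → Fin (p i - 1))) :=
    Module.Finite.of_injective (Subalgebra.val _).toLinearMap Subtype.val_injective
  let f : (F × (∀ i, Fin (p i - 1) → (R i).UStar) × M ×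
      (∀ i, Matrix.blockTriangularSubalgebra k (R i).D (id : Fin (p i - 1) → Fin (p i - 1))) ×
      (∀ i, Fin (p i - 1) → (R i).VPlus) × G) →ₗ[k] CanonicalAlgebra p R :=
    { toFun := (equivProd p R).symm
      map_add' := fun x y => rfl
      map_smul' := fun c x => rfl }
  exact Module.Finite.of_surjective f (equivProd p R).symm.surjective

variable (p R) in
/-- The idempotents of the diagonal entries. -/
def idem : Vertex p → CanonicalAlgebra p R
  | .first => ⟨1, 0, 0, 0, 0, 0⟩
  | .last => ⟨0, 0, 0, 0, 0, 1⟩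
  | .mid i r => ⟨0, 0, 0, Pi.single i (single (R i) r r le_rfl 1), 0, 0⟩

variable [IsScalarTower k F M] [IsScalarTower k Gᵐᵒᵖ M] [SMulCommClass F Gᵐᵒᵖ M]
  (x : CanonicalAlgebra p R)

theorem first_mul : idem p R .first * x = ⟨x.a, x.u, x.m, 0, 0, 0⟩ := by
  ext1 <;> try funext i
  all_goals simp [idem, mul_a, mul_u, mul_m, mul_d, mul_v, mul_g, BimodRep.zero_rowMul,
    BimodRep.zero_rowCol, BimodRep.zero_colMul]

theorem last_mul : idem p R .last * x = ⟨0, 0, 0, 0, 0, x.g⟩ := by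
  ext1 <;> try funext i
  all_goals simp [idem, mul_a, mul_u, mul_m, mul_d, mul_v, mul_g, BimodRep.zero_rowMul,
    BimodRep.zero_rowCol, BimodRep.zero_colMul]

theorem mul_first : x * idem p R .first = ⟨x.a, 0, 0, 0, 0, 0⟩ := by
  ext1 <;> try funext i
  all_goals simp [idem, mul_a, mul_u, mul_m, mul_d, mul_v, mul_g, BimodRep.rowMul_zero,
    BimodRep.rowCol_zero, BimodRep.colMul_zero]

theorem mul_last : x * idem p R .last = ⟨0, 0, x.m, 0, x.v, x.g⟩ := by
  ext1 <;> try funext i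
  all_goals simp [idem, mul_a, mul_u, mul_m, mul_d, mul_v, mul_g, BimodRep.rowMul_zero,
    BimodRep.rowCol_zero, BimodRep.colMul_zero]

theorem mid_mul (i : Fin t) (r : Fin (p i - 1)) : idem p R (.mid i r) * x =
    ⟨0, 0, 0, Pi.single i (single (R i) r r le_rfl 1 * x.d i),
      Pi.single i (Pi.single r (x.v i r)), 0⟩ := by
  ext1
  · simp [idem, mul_a]
  · funext j
    simp [idem, mul_u, BimodRep.zero_rowMul]
  · simp [idem, mul_m, BimodRep.zero_rowCol]
  · simp [idem, mul_d, Pi.single_mul_left]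
  · funext j
    rw [mul_v]
    simp only [idem, Pi.zero_apply, smul_zero, add_zero]
    by_cases h : j = i
    · subst h
      rw [Pi.single_eq_same, Pi.single_eq_same]
      exact (R j).single_one_colMul _ _
    · rw [Pi.single_eq_of_ne h, Pi.single_eq_of_ne h]
      exact (R j).zero_colMul _
  · simp [idem, mul_g]

theorem mul_mid (i : Fin t) (r : Fin (p i - 1)) : x * idem p R (.mid i r) =
    ⟨0, Pi.single i (Pi.single r (x.u i r)), 0,
      Pi.single i (x.d i * single (R i) r r le_rfl 1), 0, 0⟩ := by
  ext1
  · simp [idem, mul_a]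
  · funext j
    rw [mul_u]
    simp only [idem, Pi.zero_apply, smul_zero, zero_add]
    by_cases h : j = i
    · subst h
      rw [Pi.single_eq_same, Pi.single_eq_same]
      exact (R j).rowMul_single_one _ _
    · rw [Pi.single_eq_of_ne h, Pi.single_eq_of_ne h]
      exact (R j).rowMul_zero _
  · simp [idem, mul_m, BimodRep.rowCol_zero]
  · simp [idem, mul_d, Pi.single_mul_right]
  · funext j
    simp [idem, mul_v, BimodRep.colMul_zero]
  · simp [idem, mul_g]

theorem idem_complete : CompleteOrthogonalIdempotents (idem p R) where
  idem v := by
    cases v with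
    | first => exact first_mul _
    | last => exact last_mul _
    | mid i r =>
      rw [IsIdempotentElem, mid_mul]
      simp only [idem]
      congr 1
      · rw [Pi.single_eq_same]
        congr 1
        exact Subtype.ext (by simp [single])
      · simp
  ortho v w hvw := by
    change idem p R v * idem p R w = 0
    cases v with
    | first =>
      rw [first_mul]
      cases w <;> first | contradiction | rfl
    | last =>
      rw [last_mul]
      cases w <;> first | contradiction | rfl
    | mid i r =>
      rw [mid_mul]
      cases w with
      | first =>
        ext1 <;> simp [idem]
      | last =>
        ext1 <;> simp [idem]
      | mid j s =>
        have : Pi.single i (single (R i) r r le_rfl 1 *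
            (Pi.single j (single (R j) s s le_rfl 1) : ∀ i, Matrix.blockTriangularSubalgebra k
              (R i).D (id : Fin (p i - 1) → Fin (p i - 1))) i) =
            (0 : ∀ i, Matrix.blockTriangularSubalgebra k
              (R i).D (id : Fin (p i - 1) → Fin (p i - 1))) := by
          by_cases h : i = j
          · subst h
            have hrs : r ≠ s := fun h => hvw (h ▸ rfl)
            rw [Pi.single_eq_same, Pi.single_eq_zero_iff]
            exact Subtype.ext (by simp [single, hrs])
          · rw [Pi.single_eq_of_ne h, mul_zero, Pi.single_zero]
        ext1 <;> simp [idem, this]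
  complete := by
    let f : (∀ i, Matrix.blockTriangularSubalgebra k (R i).D
        (id : Fin (p i - 1) → Fin (p i - 1))) →+ CanonicalAlgebra p R :=
      AddMonoidHom.mk' (fun d => ⟨0, 0, 0, d, 0, 0⟩) fun d d' => by
        ext1 <;> simp
    have h : ∑ i, ∑ r, idem p R (.mid i r) = f 1 := by
      change ∑ i, ∑ r, f (Pi.single i (single (R i) r r le_rfl 1)) = _
      simp_rw [← map_sum]
      congr 1
      funext i
      rw [Finset.sum_apply, Finset.sum_eq_single i]
      · rw [Finset.sum_apply]
        simp only [Pi.single_eq_same]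
        apply Subtype.ext
        rw [AddSubmonoidClass.coe_finsetSum]
        exact Matrix.sum_single_one
      · intro j _ hj
        rw [Finset.sum_apply]
        exact Finset.sum_eq_zero fun r _ => Pi.single_eq_of_ne hj.symm _
      · simp
    rw [Vertex.sum_eq, h]
    ext1 <;> simp [f, idem]

end CanonicalAlgebra

/-! ### Matrices with a single entry and the dimensions of the Peirce blocks -/

namespace CanonicalAlgebra

variable {k F G M : Type u} [Field k] [DivisionRing F] [DivisionRing G]
  [Algebra k F] [Algebra k G] [AddCommGroup M] [Module k M] [Module F M] [Module Gᵐᵒᵖ M]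
  {t : ℕ} {p : Fin t → ℕ} {R : Fin t → BimodRep k F G M}

section Entries

variable (p R)

/-- The matrices whose only non-zero entry is in `F`. -/
def entryA : F →ₗ[k] CanonicalAlgebra p R where
  toFun a := ⟨a, 0, 0, 0, 0, 0⟩
  map_add' a b := by ext1 <;> simp
  map_smul' c a := by
    ext1 <;> simp
    exact funext₂ fun _ _ => (smul_zero c).symm

/-- The matrices whose only non-zero entry is in `M`. -/
def entryM : M →ₗ[k] CanonicalAlgebra p R where
  toFun a := ⟨0, 0, a, 0, 0, 0⟩
  map_add' a b := by ext1 <;> simp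
  map_smul' c a := by
    ext1 <;> simp
    exact funext₂ fun _ _ => (smul_zero c).symm

/-- The matrices whose only non-zero entry is in `G`. -/
def entryG : G →ₗ[k] CanonicalAlgebra p R where
  toFun a := ⟨0, 0, 0, 0, 0, a⟩
  map_add' a b := by ext1 <;> simp
  map_smul' c a := by
    ext1 <;> simp
    exact funext₂ fun _ _ => (smul_zero c).symm

/-- The matrices with a single non-zero entry in `U_i^*`. -/
def entryU (i : Fin t) (r : Fin (p i - 1)) : (R i).UStar →ₗ[k] CanonicalAlgebra p R where
  toFun a := ⟨0, Pi.single i (Pi.single r a), 0, 0, 0, 0⟩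
  map_add' a b := by ext1 <;> simp [Pi.single_add]
  map_smul' c a := by
    ext1 <;> simp [Pi.single_smul]
    exact Pi.single_smul (f := fun i => Fin (p i - 1) → (R i).UStar) i c (Pi.single r a)

/-- The matrices with a single non-zero entry in `V_i⁺`. -/
def entryV (i : Fin t) (r : Fin (p i - 1)) : (R i).VPlus →ₗ[k] CanonicalAlgebra p R where
  toFun a := ⟨0, 0, 0, 0, Pi.single i (Pi.single r a), 0⟩
  map_add' a b := by ext1 <;> simp [Pi.single_add]
  map_smul' c a := by
    ext1 <;> simp [Pi.single_smul]
    exact funext₂ fun _ _ => (smul_zero c).symm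

/-- The matrices with a single non-zero entry in `D_i`. -/
def entryD (i : Fin t) (r s : Fin (p i - 1)) (h : r ≤ s) :
    (R i).D →ₗ[k] CanonicalAlgebra p R where
  toFun a := ⟨0, 0, 0, Pi.single i (single (R i) r s h a), 0, 0⟩
  map_add' a b := by
    have : single (R i) r s h (a + b) = single (R i) r s h a + single (R i) r s h b :=
      Subtype.ext (Matrix.single_add r s a b)
    ext1 <;> simp [this, Pi.single_add]
  map_smul' c a := by
    have : single (R i) r s h (c • a) = c • single (R i) r s h a :=
      Subtype.ext (Matrix.smul_single c r s a).symm
    ext1 <;> simp [this, Pi.single_smul]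
    exact funext₂ fun _ _ => (smul_zero c).symm

theorem entryA_injective : Function.Injective (entryA p R) := fun _ _ h => congrArg a h

theorem entryM_injective : Function.Injective (entryM p R) := fun _ _ h => congrArg m h

theorem entryG_injective : Function.Injective (entryG p R) := fun _ _ h => congrArg g h

theorem entryU_injective (i : Fin t) (r : Fin (p i - 1)) :
    Function.Injective (entryU p R i r) := fun _ _ h =>
  Pi.single_injective r (Pi.single_injective i (congrArg u h))

theorem entryV_injective (i : Fin t) (r : Fin (p i - 1)) :
    Function.Injective (entryV p R i r) := fun _ _ h =>
  Pi.single_injective r (Pi.single_injective i (congrArg v h))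

theorem entryD_injective (i : Fin t) (r s : Fin (p i - 1)) (h : r ≤ s) :
    Function.Injective (entryD p R i r s h) := fun x y hxy => by
  have := congrArg Subtype.val (Pi.single_injective i (congrArg d hxy))
  simpa [single] using congrFun₂ this r s

end Entries

variable [IsScalarTower k F M] [IsScalarTower k Gᵐᵒᵖ M] [SMulCommClass F Gᵐᵒᵖ M]
  (x : CanonicalAlgebra p R)

theorem first_mul_first : idem p R .first * x * idem p R .first = entryA p R x.a := by
  rw [first_mul, mul_first]
  rfl

theorem first_mul_last : idem p R .first * x * idem p R .last = entryM p R x.m := by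
  rw [first_mul, mul_last]
  rfl

theorem last_mul_first : idem p R .last * x * idem p R .first = 0 := by
  rw [last_mul, mul_first]
  rfl

theorem last_mul_last : idem p R .last * x * idem p R .last = entryG p R x.g := by
  rw [last_mul, mul_last]
  rfl

theorem first_mul_mid (i : Fin t) (r : Fin (p i - 1)) :
    idem p R .first * x * idem p R (.mid i r) = entryU p R i r (x.u i r) := by
  rw [first_mul, mul_mid]
  ext1 <;> simp [entryU]

theorem mid_mul_first (i : Fin t) (r : Fin (p i - 1)) :
    idem p R (.mid i r) * x * idem p R .first = 0 := by
  rw [mid_mul, mul_first]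
  rfl

theorem last_mul_mid (i : Fin t) (r : Fin (p i - 1)) :
    idem p R .last * x * idem p R (.mid i r) = 0 := by
  rw [last_mul, mul_mid]
  ext1 <;> simp

theorem mid_mul_last (i : Fin t) (r : Fin (p i - 1)) :
    idem p R (.mid i r) * x * idem p R .last = entryV p R i r (x.v i r) := by
  rw [mid_mul, mul_last]
  rfl

theorem mid_mul_mid_of_le (i : Fin t) (r s : Fin (p i - 1)) (h : r ≤ s) :
    idem p R (.mid i r) * x * idem p R (.mid i s) = entryD p R i r s h ((x.d i).1 r s) := by
  rw [mid_mul, mul_mid]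
  have : single (R i) r r le_rfl 1 * x.d i * single (R i) s s le_rfl 1 =
      single (R i) r s h ((x.d i).1 r s) := by
    apply Subtype.ext
    change Matrix.single r r 1 * (x.d i).1 * Matrix.single s s 1 = Matrix.single r s _
    rw [Matrix.single_mul_mul_single, one_mul, mul_one]
  ext1 <;> simp [entryD, this]

theorem mid_mul_mid_of_lt (i : Fin t) (r s : Fin (p i - 1)) (h : s < r) :
    idem p R (.mid i r) * x * idem p R (.mid i s) = 0 := by
  rw [mid_mul, mul_mid]
  have : single (R i) r r le_rfl 1 * x.d i * single (R i) s s le_rfl 1 = 0 := by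
    apply Subtype.ext
    change Matrix.single r r 1 * (x.d i).1 * Matrix.single s s 1 = 0
    rw [Matrix.single_mul_mul_single, (x.d i).2 h, mul_zero, zero_mul, Matrix.single_zero]
  ext1 <;> simp [this]

theorem mid_mul_mid_of_ne (i j : Fin t) (r : Fin (p i - 1)) (s : Fin (p j - 1)) (h : i ≠ j) :
    idem p R (.mid i r) * x * idem p R (.mid j s) = 0 := by
  rw [mid_mul, mul_mid]
  ext1 <;> simp [Pi.single_eq_of_ne h.symm]

theorem entryA_mul (b c : F) : entryA p R b * entryA p R c = entryA p R (b * c) := by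
  ext1 <;> try funext i
  all_goals simp [entryA, mul_a, mul_u, mul_m, mul_d, mul_v, mul_g, BimodRep.zero_rowMul,
    BimodRep.zero_rowCol, BimodRep.zero_colMul]

theorem entryG_mul (b c : G) : entryG p R b * entryG p R c = entryG p R (b * c) := by
  ext1 <;> try funext i
  all_goals simp [entryG, mul_a, mul_u, mul_m, mul_d, mul_v, mul_g, BimodRep.zero_rowMul,
    BimodRep.zero_rowCol, BimodRep.zero_colMul]

theorem entryD_mul (i : Fin t) (r : Fin (p i - 1)) (b c : (R i).D) :
    entryD p R i r r le_rfl b * entryD p R i r r le_rfl c = entryD p R i r r le_rfl (b * c) := by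
  have : single (R i) r r le_rfl b * single (R i) r r le_rfl c =
      single (R i) r r le_rfl (b * c) :=
    Subtype.ext (Matrix.single_mul_single_same (c := b) r r r c)
  ext1
  · simp [entryD, mul_a]
  · funext j
    simp [entryD, mul_u, BimodRep.zero_rowMul]
  · simp [entryD, mul_m, BimodRep.zero_rowCol]
  · simp [entryD, mul_d, ← Pi.single_mul, this]
  · funext j
    simp [entryD, mul_v, BimodRep.colMul_zero]
  · simp [entryD, mul_g]

theorem idem_triangular (v w : Vertex p) (h : idem p R v * x * idem p R w ≠ 0) :
    v = w ∨ v.height < w.height := by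
  cases v with
  | first =>
    cases w with
    | first => exact .inl rfl
    | last => exact .inr (Nat.lt_of_lt_of_le zero_lt_one (Nat.le_add_right _ _))
    | mid i r => exact .inr (Nat.succ_pos _)
  | last =>
    cases w with
    | first => exact absurd (last_mul_first x) h
    | last => exact .inl rfl
    | mid i r => exact absurd (last_mul_mid x i r) h
  | mid i r =>
    cases w with
    | first => exact absurd (mid_mul_first x i r) h
    | last => exact .inr (Vertex.height_mid_lt_last i r)
    | mid j s =>
      by_cases hij : i = j
      · subst hij
        rcases lt_trichotomy r s with hrs | rfl | hrs
        · exact .inr (Nat.succ_lt_succ hrs)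
        · exact .inl rfl
        · exact absurd (mid_mul_mid_of_lt x i r s hrs) h
      · exact absurd (mid_mul_mid_of_ne x i j r s hij) h

/-- The corner rings are F, G and the endomorphism rings D_i, all division rings. Two-sided inverses
are recorded because the opposite algebra needs right ones. -/
theorem idem_inv (hR : ∀ i, (R i).IsBrick) (v : Vertex p)
    (h : idem p R v * x * idem p R v ≠ 0) :
    ∃ y, y * (idem p R v * x * idem p R v) = idem p R v ∧
      (idem p R v * x * idem p R v) * y = idem p R v := by
  cases v with
  | first =>
    rw [first_mul_first] at *
    have h0 : x.a ≠ 0 := fun h0 => h (by rw [h0, map_zero])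
    exact ⟨entryA p R x.a⁻¹, by rw [entryA_mul, inv_mul_cancel₀ h0]; rfl,
      by rw [entryA_mul, mul_inv_cancel₀ h0]; rfl⟩
  | last =>
    rw [last_mul_last] at *
    have h0 : x.g ≠ 0 := fun h0 => h (by rw [h0, map_zero])
    exact ⟨entryG p R x.g⁻¹, by rw [entryG_mul, inv_mul_cancel₀ h0]; rfl,
      by rw [entryG_mul, mul_inv_cancel₀ h0]; rfl⟩
  | mid i r =>
    rw [mid_mul_mid_of_le x i r r le_rfl] at *
    have h0 : (x.d i).1 r r ≠ 0 := fun h0 => h (by rw [h0, map_zero])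
    obtain ⟨d, hd⟩ := ((hR i).isUnit_or_eq_zero _).resolve_right h0
    refine ⟨entryD p R i r r le_rfl (d⁻¹ : (R i).Dˣ), ?_, ?_⟩
    · rw [entryD_mul, ← hd, Units.inv_mul]
      rfl
    · rw [entryD_mul, ← hd, Units.mul_inv]
      rfl

theorem idem_ne_zero (hR : ∀ i, (R i).IsBrick) (v : Vertex p) : idem p R v ≠ 0 := by
  intro h
  cases v with
  | first => exact one_ne_zero (entryA_injective p R (h.trans (map_zero _).symm))
  | last => exact one_ne_zero (entryG_injective p R (h.trans (map_zero _).symm))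
  | mid i r =>
    have := (hR i).nontrivial
    exact one_ne_zero (entryD_injective p R i r r le_rfl (h.trans (map_zero _).symm))

/-- The idempotents of the diagonal entries of a canonical algebra. -/
def triangularIdempotents (hR : ∀ i, (R i).IsBrick) :
    TriangularIdempotents (CanonicalAlgebra p R) (Vertex p) where
  e := idem p R
  h := Vertex.height
  complete := idem_complete
  ne_zero := idem_ne_zero hR
  triangular v w x h := idem_triangular x v w h
  leftInv v x h := (idem_inv x hR v h).imp fun _ h => h.1

theorem finrank_peirce₂ (hR : ∀ i, (R i).IsBrick) (v w : Vertex p) :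
    Module.finrank k ((triangularIdempotents (p := p) hR).peirce₂ k v w) =
      match v, w with
      | .first, .first => Module.finrank k F
      | .first, .last => Module.finrank k M
      | .first, .mid i _ => Module.finrank k (R i).UStar
      | .last, .first => 0
      | .last, .last => Module.finrank k G
      | .last, .mid _ _ => 0
      | .mid _ _, .first => 0
      | .mid i _, .last => Module.finrank k (R i).VPlus
      | .mid i r, .mid j s =>
        if i = j then if (r : ℕ) ≤ s then Module.finrank k (R i).D else 0 else 0 := by
  have zero {v w : Vertex p} (h : ∀ x, idem p R v * x * idem p R w = 0) :
      Module.finrank k ((triangularIdempotents (p := p) hR).peirce₂ k v w) = 0 := by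
    have hbot : (triangularIdempotents (p := p) hR).peirce₂ k v w = ⊥ :=
      (Submodule.eq_bot_iff _).2 fun x hx => hx.symm.trans (h x)
    rw [hbot, finrank_bot]
  have entry {v w : Vertex p} {W : Type u} [AddCommGroup W] [Module k W]
      (f : W →ₗ[k] CanonicalAlgebra p R) (hf : Function.Injective f)
      (c : CanonicalAlgebra p R → W) (hc : ∀ y, c (f y) = y)
      (h : ∀ x, idem p R v * x * idem p R w = f (c x)) :
      Module.finrank k ((triangularIdempotents (p := p) hR).peirce₂ k v w) =
        Module.finrank k W :=
    TriangularIdempotents.finrank_peirce₂_of_range _ f hf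
      (fun y => (h (f y)).trans (by rw [hc])) fun x => ⟨c x, h x⟩
  cases v with
  | first =>
    cases w with
    | first => exact entry _ (entryA_injective p R) a (fun _ => rfl) first_mul_first
    | last => exact entry _ (entryM_injective p R) m (fun _ => rfl) first_mul_last
    | mid i r =>
      exact entry _ (entryU_injective p R i r) (fun x => x.u i r)
        (fun y => by simp [entryU]) (fun x => first_mul_mid x i r)
  | last =>
    cases w with
    | first => exact zero last_mul_first
    | last => exact entry _ (entryG_injective p R) g (fun _ => rfl) last_mul_last
    | mid i r => exact zero fun x => last_mul_mid x i r
  | mid i r =>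
    cases w with
    | first => exact zero fun x => mid_mul_first x i r
    | last =>
      exact entry _ (entryV_injective p R i r) (fun x => x.v i r)
        (fun y => by simp [entryV]) (fun x => mid_mul_last x i r)
    | mid j s =>
      by_cases hij : i = j
      · subst hij
        by_cases hrs : r ≤ s
        · simp only [if_true, Fin.val_fin_le, if_pos hrs]
          exact entry _ (entryD_injective p R i r s hrs) (fun x => (x.d i).1 r s)
            (fun y => by simp [entryD, single]) (fun x => mid_mul_mid_of_le x i r s hrs)
        · simp only [if_true, Fin.val_fin_le, if_neg hrs]
          exact zero fun x => mid_mul_mid_of_lt x i r s (not_le.1 hrs)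
      · simp only [if_neg hij]
        exact zero fun x => mid_mul_mid_of_ne x i j r s hij

end CanonicalAlgebra

/-! ### The Grothendieck groups of a canonical algebra -/

namespace Vertex

variable {t : ℕ} {p : Fin t → ℕ}

/-- The reversal of the order on the vertices. -/
def flip : Vertex p → Vertex p
  | .first => .last
  | .last => .first
  | .mid i r => .mid i r.rev

theorem flip_flip (v : Vertex p) : v.flip.flip = v := by
  cases v with
  | first => rfl
  | last => rfl
  | mid i r => exact congrArg _ (Fin.rev_rev r)

theorem flip_surjective : Function.Surjective (flip : Vertex p → Vertex p) :=
  fun v => ⟨v.flip, v.flip_flip⟩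

end Vertex

/-! ### The constant factor -/

namespace CanonicalSymbol

variable {t : ℕ} {σ : CanonicalSymbol t}

/-- With g = gcd(e_i, εf_i), the relation gives that e_i/g divides δ(εf_i/g); the two quotients by g
are coprime, so e_i/g divides δ. Hence κ divides δ, and the factor is c = δ/κ. -/
theorem exists_scale {δ : ℕ} (he : ∀ i, 0 < σ.e i) (hδ : 0 < δ) {d : Fin t → ℕ}
    (hd : ∀ i, d i * σ.e i = σ.ε * δ * σ.f i) :
    ∃ c : ℤ, 0 < c ∧ (δ : ℤ) = c * σ.κ ∧ ∀ i, (d i : ℤ) = c * σ.norm i := by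
  have hdvd : σ.κ ∣ δ := by
    refine Finset.lcm_dvd fun i _ => ?_
    have hg : 0 < Nat.gcd (σ.e i) (σ.ε * σ.f i) := Nat.gcd_pos_of_pos_left _ (he i)
    have hco := Nat.coprime_div_gcd_div_gcd hg
    refine hco.dvd_of_dvd_mul_left ?_
    refine Nat.dvd_of_mul_dvd_mul_right hg ?_
    rw [Nat.div_mul_cancel (Nat.gcd_dvd_left _ _), mul_right_comm,
      Nat.div_mul_cancel (Nat.gcd_dvd_right _ _)]
    exact ⟨d i, by linarith [hd i]⟩
  obtain ⟨c, rfl⟩ := hdvd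
  have hc : 0 < c := Nat.pos_of_mul_pos_left hδ
  refine ⟨c, by exact_mod_cast hc, by push_cast; ring, fun i => ?_⟩
  have he' : (σ.e i : ℤ) ≠ 0 := by exact_mod_cast (he i).ne'
  refine mul_right_cancel₀ he' ?_
  have h := hd i
  zify at h
  linear_combination h - c * σ.norm_mul i

end CanonicalSymbol

namespace IsCanonicalGram

variable {t : ℕ} {σ : CanonicalSymbol t} {V W : Type*} [AddCommGroup V] [AddCommGroup W]
  {B : LinearMap.BilinForm ℤ V} {B' : LinearMap.BilinForm ℤ W}

/-- Exchanging the two ends turns the first kind of Gram matrix into the second. The factor c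
depends only on δ and κ, so it is common to both lattices. -/
theorem latticeIso_pair {q : Vertex σ.p → V} {q' : Vertex σ.p → W} {α β m : ℤ}
    {μ ν : Fin t → ℤ} {d : Fin t → ℕ}
    (h : IsCanonicalGram B q α β m μ ν fun i => d i)
    (h' : IsCanonicalGram B' q' β α m ν μ fun i => d i) {δ : ℕ} (he : ∀ i, 0 < σ.e i) (hδ : 0 < δ)
    (hσ : IsBilinearLattice σ.form) (hα : α = δ) (hβ : β = σ.ε ^ 2 * δ) (hm : m = 2 * σ.ε * δ)
    (hμ : ∀ i, μ i = σ.ε * δ * σ.f i) (hν : ∀ i, ν i = σ.ε ^ 2 * δ * σ.f i)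
    (hd : ∀ i, d i * σ.e i = σ.ε * δ * σ.f i) :
    ∃ c : ℤ, 0 < c ∧ LatticeIso B (c • σ.form) ∧ LatticeIso B' (c • σ.form) := by
  obtain ⟨c, hc, hδ', hd'⟩ := CanonicalSymbol.exists_scale he hδ hd
  subst hα
  exact ⟨c, hc, h.latticeIso_first hc.ne' hσ hδ' hβ hm hμ hν hd',
    h'.latticeIso_last hc.ne' hσ hδ' hβ hm hμ hν hd'⟩

end IsCanonicalGram

namespace CanonicalAlgebra

variable {k F G M : Type u} [Field k] [DivisionRing F] [DivisionRing G]
  [Algebra k F] [Algebra k G] [AddCommGroup M] [Module k M] [Module F M] [Module Gᵐᵒᵖ M]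
  {t : ℕ} {p : Fin t → ℕ} {R : Fin t → BimodRep k F G M}
  [IsScalarTower k F M] [IsScalarTower k Gᵐᵒᵖ M] [SMulCommClass F Gᵐᵒᵖ M]

/-- The idempotents of the diagonal entries in the opposite of a canonical algebra. -/
def oppositeTriangularIdempotents (hR : ∀ i, (R i).IsBrick) :
    TriangularIdempotents (CanonicalAlgebra p R)ᵐᵒᵖ (Vertex p) :=
  (triangularIdempotents hR).opposite fun v x h => (idem_inv x hR v h).imp fun _ h => h.2

variable [Module.Finite k (CanonicalAlgebra p R)]

theorem isCanonicalGram (hR : ∀ i, (R i).IsBrick) :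
    IsCanonicalGram ((triangularIdempotents (p := p) hR).eulerForm k)
      ((triangularIdempotents (p := p) hR).basis k) (Module.finrank k F) (Module.finrank k G)
      (Module.finrank k M) (fun i => Module.finrank k (R i).UStar)
      (fun i => Module.finrank k (R i).VPlus) fun i => (Module.finrank k (R i).D : ℕ) := by
  constructor
  · exact Module.Basis.span_eq _
  all_goals
    intros
    rw [TriangularIdempotents.eulerForm_basis_basis, finrank_peirce₂]
    try push_cast
    try rfl

/-- Passing to the opposite algebra transposes the Gram matrix. Reversing the vertices restores the
triangular shape and swaps F with G and U_i^* with V_i⁺. -/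
theorem isCanonicalGram_opposite (hR : ∀ i, (R i).IsBrick) :
    IsCanonicalGram ((oppositeTriangularIdempotents (p := p) hR).eulerForm k)
      ((oppositeTriangularIdempotents (p := p) hR).basis k ∘ Vertex.flip)
      (Module.finrank k G) (Module.finrank k F)
      (Module.finrank k M) (fun i => Module.finrank k (R i).VPlus)
      (fun i => Module.finrank k (R i).UStar) fun i => (Module.finrank k (R i).D : ℕ) := by
  constructor
  · rw [Vertex.flip_surjective.range_comp]
    exact Module.Basis.span_eq _
  case mid_mid =>
    intro i r j s
    rw [Function.comp_apply, Function.comp_apply, TriangularIdempotents.eulerForm_basis_basis,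
      oppositeTriangularIdempotents, TriangularIdempotents.finrank_peirce₂_opposite,
      finrank_peirce₂]
    simp only [Vertex.flip]
    by_cases hij : i = j
    · subst hij
      simp only [if_true, Fin.val_fin_le, Fin.rev_le_rev]
      push_cast
      rfl
    · rw [if_neg hij, if_neg (Ne.symm hij), Nat.cast_zero]
  all_goals
    intros
    simp only [Function.comp_apply]
    rw [TriangularIdempotents.eulerForm_basis_basis, oppositeTriangularIdempotents,
      TriangularIdempotents.finrank_peirce₂_opposite, finrank_peirce₂]
    rfl

end CanonicalAlgebra

/-- The number dim M_G divides 4, and ε times it is 2. -/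
theorem IsTameBimodule.epsilon_cases {F G M : Type u} [DivisionRing F] [DivisionRing G]
    [AddCommGroup M] [Module F M] [Module Gᵐᵒᵖ M] (hM : IsTameBimodule F G M) :
    (∃ ε : ℕ, (ε = 1 ∨ ε = 2) ∧ bimoduleEpsilon F G M = ε) ∨ bimoduleEpsilon F G M = 1 / 2 := by
  have h := hM.epsilon_mul
  have hdvd : Module.finrank Gᵐᵒᵖ M ∣ 4 := ⟨_, (mul_comm _ _).trans hM |>.symm⟩
  have hle := Nat.le_of_dvd (by norm_num) hdvd
  generalize Module.finrank Gᵐᵒᵖ M = b at *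
  interval_cases b
  · simp at h
  · exact .inl ⟨2, .inr rfl, by push_cast at *; linarith⟩
  · exact .inl ⟨1, .inl rfl, by push_cast at *; linarith⟩
  · omega
  · exact .inr (by push_cast at h; linarith)

/-! ### The symbol read off from the dimensions -/

section Main

variable {k F G M : Type u} [Field k] [DivisionRing F] [DivisionRing G]
  [Algebra k F] [Algebra k G] [Module.Finite k F] [Module.Finite k G]
  [AddCommGroup M] [Module k M] [Module F M] [Module Gᵐᵒᵖ M]
  [IsScalarTower k F M] [IsScalarTower k Gᵐᵒᵖ M]

/-- The numerical relations between the invariants of a regular-simple representation. -/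
theorem BimodRep.IsRegularSimple.numerics (hM : IsTameBimodule F G M) {X : BimodRep k F G M}
    (hX : X.IsRegularSimple) :
    Module.finrank Gᵐᵒᵖ M * Module.finrank Fᵐᵒᵖ X.U = 2 * Module.finrank Gᵐᵒᵖ X.V ∧
      Module.finrank k X.D * Module.finrank X.D X.U =
        Module.finrank k F * Module.finrank Fᵐᵒᵖ X.U ∧
      Module.finrank k X.D * Module.finrank X.D X.V =
        Module.finrank k G * Module.finrank Gᵐᵒᵖ X.V ∧
      0 < Module.finrank Fᵐᵒᵖ X.U ∧ 0 < Module.finrank Gᵐᵒᵖ X.V := by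
  have h := hX.defect_eq_zero hM
  have hb := hM.finrank_pos
  rw [BimodRep.defect, sub_eq_zero] at h
  norm_cast at h
  have h0 : ¬ (Module.finrank Fᵐᵒᵖ X.U = 0 ∧ Module.finrank Gᵐᵒᵖ X.V = 0) := fun h0 =>
    hX.2.1 ⟨Module.finrank_zero_iff.1 h0.1, Module.finrank_zero_iff.1 h0.2⟩
  have h1 : Module.finrank Fᵐᵒᵖ X.U = 0 ↔ Module.finrank Gᵐᵒᵖ X.V = 0 := by
    constructor
    · intro h1
      rw [h1] at h
      omega
    · intro h1
      rw [h1] at h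
      exact (Nat.mul_eq_zero.1 h).resolve_left hb.ne'
  refine ⟨h, ?_, ?_, by omega, by omega⟩
  · rw [← BimodRep.finrank_U, (hX.isBrick hM).finrank_U_eq]
  · rw [← BimodRep.finrank_V, (hX.isBrick hM).finrank_V_eq]

variable [SMulCommClass F Gᵐᵒᵖ M] {V W : Type*} [AddCommGroup V] [AddCommGroup W]
  {B : LinearMap.BilinForm ℤ V} {B' : LinearMap.BilinForm ℤ W}
  {t : ℕ} {p : Fin t → ℕ} {R : Fin t → BimodRep k F G M} {q : Vertex p → V} {q' : Vertex p → W}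

/-- Every block dimension is expressed through ε, δ = dim_k F and the f_i; dim D_i is found by
computing dim_k U_i over F and over D_i. These are precisely the relations required by
`latticeIso_pair`. -/
theorem exists_canonicalSymbol (hM : IsTameBimodule F G M) (hp : ∀ i, 2 ≤ p i)
    (hR : ∀ i, (R i).IsRegularSimple)
    (h : IsCanonicalGram B q (Module.finrank k F) (Module.finrank k G) (Module.finrank k M)
      (fun i => Module.finrank k (R i).UStar) (fun i => Module.finrank k (R i).VPlus)
      fun i => (Module.finrank k (R i).D : ℕ))
    (h' : IsCanonicalGram B' q' (Module.finrank k G) (Module.finrank k F) (Module.finrank k M)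
      (fun i => Module.finrank k (R i).VPlus) (fun i => Module.finrank k (R i).UStar)
      fun i => (Module.finrank k (R i).D : ℕ)) {ε : ℕ} (hε : ε = 1 ∨ ε = 2)
    (heps : bimoduleEpsilon F G M = ε) :
    ∃ σ : CanonicalSymbol t, σ.p = p ∧ σ.ε = ε ∧
      (∀ i, σ.e i = Module.finrank (R i).D (R i).U ∧
        (σ.e i : ℝ) = 1 / bimoduleEpsilon F G M * Module.finrank (R i).D (R i).V) ∧
      (∀ i, σ.f i = Module.finrank Gᵐᵒᵖ (R i).V ∧
        (σ.f i : ℝ) = 1 / bimoduleEpsilon F G M * Module.finrank Fᵐᵒᵖ (R i).U) ∧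
      IsBilinearLattice σ.form ∧
      ∃ c : ℤ, 0 < c ∧ LatticeIso B (c • σ.form) ∧ LatticeIso B' (c • σ.form) := by
  have hb : ε * Module.finrank Gᵐᵒᵖ M = 2 := by
    have := hM.epsilon_mul
    rw [heps] at this
    exact_mod_cast this
  have ha : Module.finrank F M = 2 * ε := by
    have h4 : Module.finrank F M * Module.finrank Gᵐᵒᵖ M = 4 := hM
    have : Module.finrank F M * 2 = ε * 4 := by rw [← hb, ← h4]; ring
    omega
  have hε0 : 0 < ε := by omega
  obtain ⟨-, hMF, hMG⟩ := hM.finrank_eq (k := k)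
  have hFG : Module.finrank k G = ε ^ 2 * Module.finrank k F := by
    have : 2 * Module.finrank k G = 2 * (ε ^ 2 * Module.finrank k F) := by
      calc 2 * Module.finrank k G = ε * (Module.finrank k G * Module.finrank Gᵐᵒᵖ M) := by
            rw [← hb]; ring
        _ = ε * (Module.finrank k F * Module.finrank F M) := by rw [← hMG, hMF]
        _ = _ := by rw [ha]; ring
    omega
  have hU (i : Fin t) : Module.finrank Fᵐᵒᵖ (R i).U = ε * Module.finrank Gᵐᵒᵖ (R i).V := by
    have := ((hR i).numerics hM).1
    have : 2 * Module.finrank Fᵐᵒᵖ (R i).U = 2 * (ε * Module.finrank Gᵐᵒᵖ (R i).V) := by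
      calc _ = ε * (Module.finrank Gᵐᵒᵖ M * Module.finrank Fᵐᵒᵖ (R i).U) := by rw [← hb]; ring
        _ = _ := by rw [this]; ring
    omega
  have hδ : 0 < Module.finrank k F := Module.finrank_pos
  have hd (i : Fin t) : Module.finrank k (R i).D * Module.finrank (R i).D (R i).U =
      ε * Module.finrank k F * Module.finrank Gᵐᵒᵖ (R i).V := by
    rw [((hR i).numerics hM).2.1, hU]
    ring
  have hf (i : Fin t) : 0 < Module.finrank Gᵐᵒᵖ (R i).V := ((hR i).numerics hM).2.2.2.2
  have hdU (i : Fin t) : 0 < Module.finrank k (R i).D * Module.finrank (R i).D (R i).U := by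
    rw [hd]
    exact Nat.mul_pos (Nat.mul_pos hε0 hδ) (hf i)
  -- Both sides are compared after multiplication by dim_k D_i, using dim G = ε² dim F.
  have hV (i : Fin t) :
      Module.finrank (R i).D (R i).V = ε * Module.finrank (R i).D (R i).U := by
    refine Nat.eq_of_mul_eq_mul_left (Nat.pos_of_mul_pos_right (hdU i)) ?_
    rw [((hR i).numerics hM).2.2.1, mul_left_comm, hd, hFG]
    ring
  have hεR : (ε : ℝ) ≠ 0 := by exact_mod_cast hε0.ne'
  let σ : CanonicalSymbol t := ⟨p, fun i => Module.finrank (R i).D (R i).U,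
    fun i => Module.finrank Gᵐᵒᵖ (R i).V, ε⟩
  have he (i : Fin t) : 0 < σ.e i := Nat.pos_of_mul_pos_left (hdU i)
  have hσ : IsBilinearLattice σ.form := σ.isBilinearLattice_form hp he hf hε
  refine ⟨σ, rfl, rfl, fun i => ⟨rfl, ?_⟩, fun i => ⟨rfl, ?_⟩, hσ,
    h.latticeIso_pair (σ := σ) h' he hδ hσ rfl ?_ ?_ ?_ ?_ hd⟩
  · rw [heps, hV]
    push_cast
    field_simp
    rfl
  · rw [heps, hU]
    push_cast
    field_simp
    rfl
  · rw [hFG]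
    push_cast
    rfl
  · rw [hMF, ha]
    push_cast
    change _ = 2 * (ε : ℤ) * _
    ring
  · intro i
    rw [BimodRep.finrank_UStar, BimodRep.finrank_U, hU]
    push_cast
    change _ = (ε : ℤ) * _ * (Module.finrank Gᵐᵒᵖ (R i).V : ℤ)
    ring
  · intro i
    rw [((hR i).finrank_VPlus hM).2, BimodRep.finrank_V, hFG]
    push_cast
    rfl

/-- This is the mirror image of the case ε = 2: now dim F = 4 dim G, so δ = dim_k G and U_i, V_i
exchange their roles. -/
theorem exists_canonicalSymbol_of_epsilon_eq_half (hM : IsTameBimodule F G M)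
    (hp : ∀ i, 2 ≤ p i) (hR : ∀ i, (R i).IsRegularSimple)
    (h : IsCanonicalGram B q (Module.finrank k F) (Module.finrank k G) (Module.finrank k M)
      (fun i => Module.finrank k (R i).UStar) (fun i => Module.finrank k (R i).VPlus)
      fun i => (Module.finrank k (R i).D : ℕ))
    (h' : IsCanonicalGram B' q' (Module.finrank k G) (Module.finrank k F) (Module.finrank k M)
      (fun i => Module.finrank k (R i).VPlus) (fun i => Module.finrank k (R i).UStar)
      fun i => (Module.finrank k (R i).D : ℕ))
    (heps : bimoduleEpsilon F G M = 1 / 2) :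
    ∃ σ : CanonicalSymbol t, σ.p = p ∧ σ.ε = 2 ∧
      (∀ i, σ.e i = Module.finrank (R i).D (R i).V ∧
        (σ.e i : ℝ) = bimoduleEpsilon F G M * Module.finrank (R i).D (R i).U) ∧
      (∀ i, σ.f i = Module.finrank Fᵐᵒᵖ (R i).U ∧
        (σ.f i : ℝ) = bimoduleEpsilon F G M * Module.finrank Gᵐᵒᵖ (R i).V) ∧
      IsBilinearLattice σ.form ∧
      ∃ c : ℤ, 0 < c ∧ LatticeIso B (c • σ.form) ∧ LatticeIso B' (c • σ.form) := by
  have hb : Module.finrank Gᵐᵒᵖ M = 4 := by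
    have := hM.epsilon_mul
    rw [heps] at this
    have : (Module.finrank Gᵐᵒᵖ M : ℝ) = 4 := by linarith
    exact_mod_cast this
  have ha : Module.finrank F M = 1 := by
    have h4 : Module.finrank F M * Module.finrank Gᵐᵒᵖ M = 4 := hM
    rw [hb] at h4
    omega
  obtain ⟨-, hMF, hMG⟩ := hM.finrank_eq (k := k)
  have hFG : Module.finrank k F = 4 * Module.finrank k G := by
    rw [hMF, ha, hb] at hMG
    omega
  have hV (i : Fin t) : Module.finrank Gᵐᵒᵖ (R i).V = 2 * Module.finrank Fᵐᵒᵖ (R i).U := by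
    have := ((hR i).numerics hM).1
    rw [hb] at this
    omega
  have hδ : 0 < Module.finrank k G := Module.finrank_pos
  have hd (i : Fin t) : Module.finrank k (R i).D * Module.finrank (R i).D (R i).V =
      2 * Module.finrank k G * Module.finrank Fᵐᵒᵖ (R i).U := by
    rw [((hR i).numerics hM).2.2.1, hV]
    ring
  have hf (i : Fin t) : 0 < Module.finrank Fᵐᵒᵖ (R i).U := ((hR i).numerics hM).2.2.2.1
  have hdV (i : Fin t) : 0 < Module.finrank k (R i).D * Module.finrank (R i).D (R i).V := by
    rw [hd]
    exact Nat.mul_pos (Nat.mul_pos two_pos hδ) (hf i)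
  have hU (i : Fin t) :
      Module.finrank (R i).D (R i).U = 2 * Module.finrank (R i).D (R i).V := by
    refine Nat.eq_of_mul_eq_mul_left (Nat.pos_of_mul_pos_right (hdV i)) ?_
    rw [((hR i).numerics hM).2.1, mul_left_comm, hd, hFG]
    ring
  let σ : CanonicalSymbol t := ⟨p, fun i => Module.finrank (R i).D (R i).V,
    fun i => Module.finrank Fᵐᵒᵖ (R i).U, 2⟩
  have he (i : Fin t) : 0 < σ.e i := Nat.pos_of_mul_pos_left (hdV i)
  have hσ : IsBilinearLattice σ.form := σ.isBilinearLattice_form hp he hf (.inr rfl)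
  -- The opposite Gram matrix begins with dim G = δ, so it is the one of the first kind here.
  obtain ⟨c, hc, h₁, h₂⟩ := h'.latticeIso_pair (σ := σ) h he hδ hσ rfl
    (by rw [hFG]; push_cast; change _ = ((2 : ℕ) : ℤ) ^ 2 * _; push_cast; ring)
    (by rw [hMG, hb]; push_cast; change _ = 2 * ((2 : ℕ) : ℤ) * _; push_cast; ring)
    (fun i => by
      rw [((hR i).finrank_VPlus hM).2, BimodRep.finrank_V, hV]
      push_cast
      change _ = ((2 : ℕ) : ℤ) * _ * (Module.finrank Fᵐᵒᵖ (R i).U : ℤ)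
      push_cast
      ring)
    (fun i => by
      rw [BimodRep.finrank_UStar, BimodRep.finrank_U, hFG]
      push_cast
      change _ = ((2 : ℕ) : ℤ) ^ 2 * _ * (Module.finrank Fᵐᵒᵖ (R i).U : ℤ)
      push_cast
      ring) hd
  refine ⟨σ, rfl, rfl, fun i => ⟨rfl, ?_⟩, fun i => ⟨rfl, ?_⟩, hσ, c, hc, h₂, h₁⟩
  · rw [heps, hU]
    push_cast
    change (Module.finrank (R i).D (R i).V : ℝ) = _
    ring
  · rw [heps, hV]
    push_cast
    change (Module.finrank Fᵐᵒᵖ (R i).U : ℝ) = _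
    ring

end Main

end

theorem mainTheorem7 {k F G M : Type u} [Field k] [DivisionRing F] [DivisionRing G]
    [Algebra k F] [Algebra k G] [Module.Finite k F] [Module.Finite k G]
    [AddCommGroup M] [Module k M] [Module F M] [Module Gᵐᵒᵖ M]
    [IsScalarTower k F M] [IsScalarTower k Gᵐᵒᵖ M] [SMulCommClass F Gᵐᵒᵖ M]
    (hM : IsTameBimodule F G M) {t : ℕ} (p : Fin t → ℕ) (hp : ∀ i, 2 ≤ p i)
    (R : Fin t → BimodRep k F G M) (hR : ∀ i, (R i).IsRegularSimple)
    (hne : Pairwise fun i j => ¬ ∃ f : BimodRep.Hom (R i) (R j), f.IsIso) :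
    ∃ (B : LinearMap.BilinForm ℤ (K0 (CanonicalAlgebra p R)))
      (B' : LinearMap.BilinForm ℤ (K0 (CanonicalAlgebra p R)ᵐᵒᵖ)),
      IsEulerForm k B ∧ IsEulerForm k B' ∧
      IsBilinearLattice B ∧ IsBilinearLattice B' ∧ LatticeIso B B' ∧
      (∀ ε : ℕ, ε = 1 ∨ ε = 2 → bimoduleEpsilon F G M = ε →
        ∃ σ : CanonicalSymbol t,
          σ.p = p ∧ σ.ε = ε ∧
          (∀ i, σ.e i = Module.finrank (R i).D (R i).U ∧
            (σ.e i : ℝ) = 1 / bimoduleEpsilon F G M * Module.finrank (R i).D (R i).V) ∧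
          (∀ i, σ.f i = Module.finrank Gᵐᵒᵖ (R i).V ∧
            (σ.f i : ℝ) = 1 / bimoduleEpsilon F G M * Module.finrank Fᵐᵒᵖ (R i).U) ∧
          IsBilinearLattice σ.form ∧
          LatticeIsoUpToFactor B σ.form ∧ LatticeIsoUpToFactor B' σ.form) ∧
      (bimoduleEpsilon F G M = 1 / 2 →
        ∃ σ : CanonicalSymbol t,
          σ.p = p ∧ σ.ε = 2 ∧
          (∀ i, σ.e i = Module.finrank (R i).D (R i).V ∧
            (σ.e i : ℝ) = bimoduleEpsilon F G M * Module.finrank (R i).D (R i).U) ∧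
          (∀ i, σ.f i = Module.finrank Fᵐᵒᵖ (R i).U ∧
            (σ.f i : ℝ) = bimoduleEpsilon F G M * Module.finrank Gᵐᵒᵖ (R i).V) ∧
          IsBilinearLattice σ.form ∧
          LatticeIsoUpToFactor B σ.form ∧ LatticeIsoUpToFactor B' σ.form) := by
  have hb (i : Fin t) : (R i).IsBrick := (hR i).isBrick hM
  have := (hM.finrank_eq (k := k)).1
  have := CanonicalAlgebra.finite (p := p) fun i => ((hR i).finrank_VPlus hM).1
  have h := CanonicalAlgebra.isCanonicalGram (p := p) hb
  have h' := CanonicalAlgebra.isCanonicalGram_opposite (p := p) hb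
  have key {ε : ℕ} (hε : ε = 1 ∨ ε = 2) (heps : bimoduleEpsilon F G M = ε) :=
    exists_canonicalSymbol hM hp hR h h' hε heps
  have key' (heps : bimoduleEpsilon F G M = 1 / 2) :=
    exists_canonicalSymbol_of_epsilon_eq_half hM hp hR h h' heps
  -- One symbol with one factor c serves both Euler forms, so they are isometric through the common
  -- target `c • σ.form`.
  obtain ⟨σ, hσ, c, hc, h₁, h₂⟩ : ∃ σ : CanonicalSymbol t, IsBilinearLattice σ.form ∧
      ∃ c : ℤ, 0 < c ∧
        LatticeIso ((CanonicalAlgebra.triangularIdempotents hb).eulerForm k) (c • σ.form) ∧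
        LatticeIso ((CanonicalAlgebra.oppositeTriangularIdempotents hb).eulerForm k)
          (c • σ.form) := by
    rcases hM.epsilon_cases with ⟨ε, hε, heps⟩ | heps
    · obtain ⟨σ, -, -, -, -, hσ⟩ := key hε heps
      exact ⟨σ, hσ⟩
    · obtain ⟨σ, -, -, -, -, hσ⟩ := key' heps
      exact ⟨σ, hσ⟩
  refine ⟨_, _, TriangularIdempotents.isEulerForm k _, TriangularIdempotents.isEulerForm k _,
    h₁.isBilinearLattice_of_smul hc.ne' hσ, h₂.isBilinearLattice_of_smul hc.ne' hσ,
    h₁.of_common h₂, fun ε hε heps => ?_, fun heps => ?_⟩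
  · obtain ⟨σ, hp', hε', he, hf, hσ, c, hc, h₁, h₂⟩ := key hε heps
    exact ⟨σ, hp', hε', he, hf, hσ, ⟨c, hc, h₁⟩, ⟨c, hc, h₂⟩⟩
  · obtain ⟨σ, hp', hε', he, hf, hσ, c, hc, h₁, h₂⟩ := key' heps
    exact ⟨σ, hp', hε', he, hf, hσ, ⟨c, hc, h₁⟩, ⟨c, hc, h₂⟩⟩
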